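/- Max-min graph coloring is the following problem: given a finite simple graph $G=(V,E)$ with $n\ge 1$ vertices, find a proper coloring $\varphi:V\to\mathbb N$ that maximizes $\min_{v\in V}|\varphi^{-1}(\varphi(v))|$, the size of its smallest (nonempty) color class. Let $\mathrm{OPT}(G)$ be the maximum value, $\Delta$ the maximum degree of $G$ and $\chi$ its chromatic number. Max-min graph coloring can be approximated in polynomial time within a factor $\left(1+O\left(\frac1n\right)\right)\frac{\Delta+1}{\chi}$, where the constant in $O(1/n)$ is at most linear in $\Delta$. That is, there are an absolute constant $C$, a polynomial $T$ and a single algorithm which, given (the adjacency matrix of) any finite simple graph $G$ on $n$ vertices, halts after at most $T(n)$ steps and outputs a proper coloring $\varphi$ of $G$ such that, if $n\ge 1$, $$\mathrm{OPT}(G)\;\le\;\left(1+C\,\frac{\Delta}{n}\right)\frac{\Delta+1}{\chi}\;\min_{v\in V}|\varphi^{-1}(\varphi(v))| .$$ (Steps are counted on a random access machine with addition, truncated subtraction, tests for zero and indexed memory access; this is polynomially equivalent to Turing machine time.) -/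

import Mathlib

/-! ## A random access machine with a step count

Programs are structured programs over finitely many natural-number registers and finitely many
arrays of natural numbers.  The arithmetic is addition and truncated subtraction only, so in `t`
steps numbers reach at most `O(t)` more bits than they had at the start, and unit-cost running
times on this machine and running times on a Turing machine are polynomially related. -/

namespace RAM

/-- Expressions: constants, registers, array cells, sums and truncated differences. -/
inductive Expr where
  | const (k : ℕ)
  | reg (x : ℕ)
  | get (a : ℕ) (i : Expr)
  | add (e₁ e₂ : Expr)
  | sub (e₁ e₂ : Expr)

/-- Programs. A test `e` succeeds when the value of `e` is not `0`. -/
inductive Prog where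
  | skip
  | assign (x : ℕ) (e : Expr)
  | store (a : ℕ) (i e : Expr)
  | seq (p q : Prog)
  | ite (e : Expr) (p q : Prog)
  | while (e : Expr) (p : Prog)

/-- The state of the memory: register `x` holds `reg x`, cell `i` of array `a` holds `arr a i`. -/
structure State where
  reg : ℕ → ℕ
  arr : ℕ → ℕ → ℕ

/-- The value of an expression. -/
def Expr.eval (s : State) : Expr → ℕ
  | .const k => k
  | .reg x => s.reg x
  | .get a i => s.arr a (i.eval s)
  | .add e₁ e₂ => e₁.eval s + e₂.eval s
  | .sub e₁ e₂ => e₁.eval s - e₂.eval s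

/-- The number of steps it takes to evaluate an expression: one for each operation. -/
def Expr.cost : Expr → ℕ
  | .const _ => 1
  | .reg _ => 1
  | .get _ i => i.cost + 1
  | .add e₁ e₂ => e₁.cost + e₂.cost + 1
  | .sub e₁ e₂ => e₁.cost + e₂.cost + 1

/-- Write `v` into register `x`. -/
def State.setReg (s : State) (x v : ℕ) : State :=
  { s with reg := Function.update s.reg x v }

/-- Write `v` into cell `i` of array `a`. -/
def State.setArr (s : State) (a i v : ℕ) : State :=
  { s with arr := Function.update s.arr a (Function.update (s.arr a) i v) }

/-- `Exec p s s' t`: started in the state `s`, the program `p` halts in the state `s'` after exactly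
`t` steps. -/
inductive Exec : Prog → State → State → ℕ → Prop where
  | skip (s : State) : Exec .skip s s 1
  | assign (s : State) (x : ℕ) (e : Expr) :
      Exec (.assign x e) s (s.setReg x (e.eval s)) (e.cost + 1)
  | store (s : State) (a : ℕ) (i e : Expr) :
      Exec (.store a i e) s (s.setArr a (i.eval s) (e.eval s)) (i.cost + e.cost + 1)
  | seq {p q : Prog} {s s' s'' : State} {t t' : ℕ} :
      Exec p s s' t → Exec q s' s'' t' → Exec (.seq p q) s s'' (t + t')
  | ite_true {e : Expr} {p q : Prog} {s s' : State} {t : ℕ} :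
      e.eval s ≠ 0 → Exec p s s' t → Exec (.ite e p q) s s' (e.cost + 1 + t)
  | ite_false {e : Expr} {p q : Prog} {s s' : State} {t : ℕ} :
      e.eval s = 0 → Exec q s s' t → Exec (.ite e p q) s s' (e.cost + 1 + t)
  | while_true {e : Expr} {p : Prog} {s s' s'' : State} {t t' : ℕ} :
      e.eval s ≠ 0 → Exec p s s' t → Exec (.while e p) s' s'' t' →
        Exec (.while e p) s s'' (e.cost + 1 + t + t')
  | while_false {e : Expr} {p : Prog} {s : State} :
      e.eval s = 0 → Exec (.while e p) s s (e.cost + 1)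

/-- The initial state on the input `G`: register `0` holds the number `n` of vertices, array `0`
holds the adjacency matrix row by row (the entry of the pair `(u, v)` is in cell `u * n + v`), and
everything else is `0`. -/
def inputGraph {n : ℕ} (G : SimpleGraph (Fin n)) [DecidableRel G.Adj] : State where
  reg x := if x = 0 then n else 0
  arr a i := if a = 0 ∧ ∃ u v : Fin n, i = (u : ℕ) * n + v ∧ G.Adj u v then 1 else 0

/-- The output read from a final state: the color of the vertex `v` is in cell `v` of array `1`. -/
def outputColors (n : ℕ) (s : State) : Fin n → ℕ :=
  fun v => s.arr 1 v

end RAM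

/-! ## Max-min graph coloring -/

/-- The size `a_v` of the color class of the vertex `v` under `φ`. -/
def colorClassSize {V : Type*} [Fintype V] (φ : V → ℕ) (v : V) : ℕ :=
  (Finset.univ.filter fun u => φ u = φ v).card

/-- The objective of max-min graph coloring: the size of the smallest (nonempty) color class. -/
noncomputable def minColorClass {V : Type*} [Fintype V] (φ : V → ℕ) : ℕ :=
  ⨅ v, colorClassSize φ v

/-- The optimum of max-min graph coloring, over all proper colorings with colors in `ℕ`. -/
noncomputable def maxMinColoring {V : Type*} [Fintype V] (G : SimpleGraph V) : ℕ :=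
  ⨆ φ : G.Coloring ℕ, minColorClass φ

/-- The program `p` is a polynomial-time approximation algorithm for max-min graph coloring within
the factor `ρ`: on every graph it halts after a number of steps that is polynomial in the number of
vertices and outputs a proper coloring, and on every nonempty graph `G` the smallest color
class of the output has at least `1 / ρ G` times the largest possible size. -/
def IsMaxMinColoringApprox (p : RAM.Prog)
    (ρ : ∀ {n : ℕ} (G : SimpleGraph (Fin n)) [DecidableRel G.Adj], ℝ) : Prop :=
  ∃ T : Polynomial ℕ, ∀ (n : ℕ) (G : SimpleGraph (Fin n)) [DecidableRel G.Adj],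
    ∃ (s : RAM.State) (t : ℕ), RAM.Exec p (RAM.inputGraph G) s t ∧ t ≤ T.eval n ∧
      (∀ u v, G.Adj u v → RAM.outputColors n s u ≠ RAM.outputColors n s v) ∧
      (0 < n → (maxMinColoring G : ℝ) ≤ ρ G * minColorClass (RAM.outputColors n s))

/-! Put r = Δ + 1 and k = ⌊n/r⌋ - 1. A proper coloring uses at least χ colors, and its classes
together have n vertices, so OPT · χ ≤ n. It therefore suffices to find, in polynomial time, a
proper coloring with r colors whose classes all have at least k vertices: since n < r (k + 2), the
ratio follows by arithmetic (`approximation_bound`). Such a coloring is obtained by a variant of the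
Kierstead–Kostochka proof of the Hajnal–Szemerédi theorem. It works with partial colorings whose
classes have at most k vertices; a color of at least r means "uncolored".

Fix a class c₀ with fewer than k vertices. A class is accessible if a path of classes leads from it
to c₀ such that each class on the path has a vertex without neighbors in the next one. If an
uncolored vertex has no neighbor in some accessible class, it enters that class, and one vertex is
passed on along the path: c₀ grows by one and every other class keeps its size. Otherwise the
situation is `Stuck`: every vertex outside the set A of accessible classes has a neighbor in each of
them. Let Q be the set of colors in play and q = |Q| - |A|. The set B of vertices outside A then has
more than qk elements.

A stuck coloring is changed by an exchange. Call z, of class W, solo for y in B if z is the only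
neighbor of y in W. If z can move to a class that reaches c₀ without W, then y takes the place of z
and z moves on along the path. If no such exchange exists, `exists_terminal` provides a set T of
classes all of whose paths to c₀ pass through one class U, while no class of T separates any other
class from c₀. Counting edges between B and a class of T, with weight 2 on solo vertices, gives |T|
> q. If for every z in T the vertices of B for which z is solo formed a clique, a discharging
argument with charges q/s(z), where s(z) is the size of that clique, would give |B| ≤ qk. So some z
is solo for nonadjacent y₁ and y₂. These two replace z and a further vertex w of W; w moves on along
a path and z becomes uncolored. This is `Stuck.exists_swap`.

An exchange gives A one more vertex and takes at most one vertex from the other classes, or two when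
2q < |Q|. Afterwards the colors of A are settled, and the work continues one level up, with the q
remaining colors. The degree condition is inherited, because each remaining vertex has a neighbor in
every class of A. The potential `pot` weighs each missing vertex of a class by the number of colors
active at the level of that class: the gain counts |Q|, the loss at most 2q or q, hence less
(`Inv.push`). If no active class is small, the level goes down again at no cost. Thus 2 · pot +
level decreases in every round until the potential is 0 (`iter_spec`), and 2n² rounds suffice. The
vertices still uncolored are then colored greedily.

For the running time, the algorithm is written in a language whose loops all run up to n. A compiler
to the machine (`LProg.exec_compile`) gives a polynomial step bound from the syntax alone, so that
only the final states of bounded programs have to be studied. -/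

namespace RAM

/-! ## A language of programs with bounded loops -/

/-- Conditions: tests of expressions, closed under negation, conjunction and existential
quantification of a register over the numbers below a bound. -/
inductive Form where
  | atom (e : Expr)
  | not (F : Form)
  | and (F G : Form)
  | ex (x : ℕ) (F : Form)

/-- The truth of a condition in a state, with quantifiers bounded by `n`. -/
def Form.holds (n : ℕ) : Form → State → Prop
  | .atom e, s => e.eval s ≠ 0
  | .not F, s => ¬ F.holds n s
  | .and F G, s => F.holds n s ∧ G.holds n s
  | .ex x F, s => ∃ i < n, F.holds n (s.setReg x i)

/-- Programs all of whose loops run over the numbers below a bound. -/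
inductive LProg where
  | skip
  | assign (x : ℕ) (e : Expr)
  | store (a : ℕ) (i e : Expr)
  | seq (p q : LProg)
  | ite (F : Form) (p q : LProg)
  | loop (x : ℕ) (p : LProg)
  | find (x : ℕ) (F : Form)
  | count (t x : ℕ) (F : Form)

open Classical in
/-- The final state of a bounded program: `loop x p` runs `p` for all values of `x` below `n`,
`find x F` puts into `x` a number below `n` that satisfies `F` if there is one, and `count t x F`
puts into `t` the number of values of `x` below `n` that satisfy `F`. -/
noncomputable def LProg.run (n : ℕ) : LProg → State → State
  | .skip, s => s
  | .assign x e, s => s.setReg x (e.eval s)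
  | .store a i e, s => s.setArr a (i.eval s) (e.eval s)
  | .seq p q, s => q.run n (p.run n s)
  | .ite F p q, s => if F.holds n s then p.run n s else q.run n s
  | .loop x p, s => (List.range n).foldl (fun s i => p.run n (s.setReg x i)) s
  | .find x F, s => s.setReg x
      ((List.range n).foldl (fun b i => if F.holds n (s.setReg x i) then i else b) (s.reg x))
  | .count t x F, s => s.setReg t (Nat.count (fun i => F.holds n (s.setReg x i)) n)

@[simp] theorem State.setReg_reg (s : State) (x v y : ℕ) :
    (s.setReg x v).reg y = if y = x then v else s.reg y := by
  simp [State.setReg, Function.update_apply]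

@[simp] theorem State.setReg_arr (s : State) (x v : ℕ) : (s.setReg x v).arr = s.arr := rfl

@[simp] theorem State.setArr_reg (s : State) (a i v : ℕ) : (s.setArr a i v).reg = s.reg := rfl

@[simp] theorem State.setArr_arr (s : State) (a i v b j : ℕ) :
    (s.setArr a i v).arr b j = if b = a ∧ j = i then v else s.arr b j := by
  by_cases hb : b = a
  · subst hb
    simp [State.setArr, Function.update_apply]
  · simp [State.setArr, hb]

theorem State.ext' {s t : State} (h : ∀ x, s.reg x = t.reg x) (h' : ∀ a i, s.arr a i = t.arr a i) :
    s = t := by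
  cases s; cases t
  simp only [State.mk.injEq]
  exact ⟨funext h, funext fun a => funext (h' a)⟩

@[simp] theorem State.setReg_setReg (s : State) (x v w : ℕ) :
    (s.setReg x v).setReg x w = s.setReg x w := by
  apply State.ext' <;> intros <;> simp
  split_ifs <;> rfl

@[simp] theorem State.setReg_self (s : State) (x : ℕ) : s.setReg x (s.reg x) = s := by
  apply State.ext' <;> intros <;> simp
  rintro rfl; rfl

/-! ### Compilation -/

/-- Move the registers of an expression to the even places. -/
def Expr.ren : Expr → Expr
  | .const k => .const k
  | .reg x => .reg (2 * x)
  | .get a i => .get a i.ren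
  | .add e₁ e₂ => .add e₁.ren e₂.ren
  | .sub e₁ e₂ => .sub e₁.ren e₂.ren

/-- The machine state `σ` holds the state `s` in its even registers and the bound `n` in
register `1`. -/
structure Rel (n : ℕ) (σ s : State) : Prop where
  arr : σ.arr = s.arr
  reg : ∀ x, σ.reg (2 * x) = s.reg x
  bound : σ.reg 1 = n

/-- The scratch registers with index below `d` agree. -/
def Keep (d : ℕ) (σ σ' : State) : Prop := ∀ j < d, σ'.reg (2 * j + 1) = σ.reg (2 * j + 1)

theorem Keep.refl (d : ℕ) (σ : State) : Keep d σ σ := fun _ _ => rfl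

theorem Keep.trans {d d' : ℕ} {σ σ' σ'' : State} (h : Keep d σ σ') (h' : Keep d' σ' σ'')
    (hd : d ≤ d') : Keep d σ σ'' :=
  fun j hj => (h' j (hj.trans_le hd)).trans (h j hj)

theorem Keep.setReg_odd {d j v : ℕ} {σ σ' : State} (h : Keep d σ σ') (hj : d ≤ j) :
    Keep d σ (σ'.setReg (2 * j + 1) v) := by
  intro i hi
  rw [State.setReg_reg, if_neg (by omega)]
  exact h i hi

theorem Keep.setReg_even {d j v : ℕ} {σ σ' : State} (h : Keep d σ σ') :
    Keep d σ (σ'.setReg (2 * j) v) := by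
  intro i hi
  rw [State.setReg_reg, if_neg (by omega)]
  exact h i hi

/-- The case `j = 0` is excluded because scratch place `0` is register `1`, which holds the bound.
Hence the condition `1 ≤ d` throughout the compilation. -/
theorem Rel.setReg_odd {n j v : ℕ} {σ s : State} (h : Rel n σ s) (hj : 1 ≤ j) :
    Rel n (σ.setReg (2 * j + 1) v) s := by
  refine ⟨h.arr, fun x => ?_, ?_⟩
  · rw [State.setReg_reg, if_neg (by omega), h.reg]
  · rw [State.setReg_reg, if_neg (by omega), h.bound]

theorem Rel.setReg_even {n x v : ℕ} {σ s : State} (h : Rel n σ s) :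
    Rel n (σ.setReg (2 * x) v) (s.setReg x v) := by
  refine ⟨h.arr, fun y => ?_, ?_⟩
  · simp only [State.setReg_reg, h.reg]
    congr 1
    simp
  · rw [State.setReg_reg, if_neg (by omega), h.bound]

theorem Rel.eval {n : ℕ} {σ s : State} (h : Rel n σ s) (e : Expr) :
    e.ren.eval σ = e.eval s := by
  induction e with
  | const k => rfl
  | reg x => exact h.reg x
  | get a i ih => simp [Expr.ren, Expr.eval, ih, h.arr]
  | add e₁ e₂ h₁ h₂ => simp [Expr.ren, Expr.eval, h₁, h₂]
  | sub e₁ e₂ h₁ h₂ => simp [Expr.ren, Expr.eval, h₁, h₂]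

/-- Run `body` with the scratch register `d` counting from `0` up to the bound. -/
def forLoop (d : ℕ) (body : Prog) : Prog :=
  .seq (.assign (2 * d + 1) (.const 0))
    (.while (.sub (.reg 1) (.reg (2 * d + 1)))
      (.seq body (.assign (2 * d + 1) (.add (.reg (2 * d + 1)) (.const 1)))))

/-- The invariant `J i` refers to the moment when the counter has just been set to `i`. A turn costs
`8` steps besides the body, `4` for the test and `4` for the increment; the final `6` pays for the
initial assignment and the last, failing test. -/
theorem exec_forLoop {n d B : ℕ} {body : Prog} (J : ℕ → State → Prop)
    (hn : ∀ i σ, J i σ → σ.reg 1 = n)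
    (hbody : ∀ i < n, ∀ σ, J i σ → σ.reg (2 * d + 1) = i → ∃ σ' t, Exec body σ σ' t ∧ t ≤ B ∧
      σ'.reg (2 * d + 1) = i ∧ J (i + 1) (σ'.setReg (2 * d + 1) (i + 1)))
    {σ : State} (h0 : J 0 (σ.setReg (2 * d + 1) 0)) :
    ∃ σ' t, Exec (forLoop d body) σ σ' t ∧ t ≤ n * (B + 8) + 6 ∧ J n σ' := by
  have key : ∀ l i, i + l = n → ∀ σ, J i σ → σ.reg (2 * d + 1) = i →
      ∃ σ' t, Exec (.while (.sub (.reg 1) (.reg (2 * d + 1)))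
        (.seq body (.assign (2 * d + 1) (.add (.reg (2 * d + 1)) (.const 1))))) σ σ' t ∧
        t ≤ l * (B + 8) + 4 ∧ J n σ' := by
    intro l
    induction l with
    | zero =>
      intro i hi σ hJ hσ
      refine ⟨σ, _, Exec.while_false ?_, ?_, ?_⟩
      · simp [Expr.eval, hn i σ hJ, hσ]; omega
      · simp [Expr.cost]
      · rwa [show n = i by omega]
    | succ l ih =>
      intro i hi σ hJ hσ
      obtain ⟨σ', t, hex, ht, hr, hJ'⟩ := hbody i (by omega) σ hJ hσ
      obtain ⟨σ'', t', hex', ht', hJ''⟩ := ih (i + 1) (by omega) _ hJ' (by simp)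
      have hstep : Exec (.seq body (.assign (2 * d + 1) (.add (.reg (2 * d + 1)) (.const 1)))) σ
          (σ'.setReg (2 * d + 1) (i + 1)) (t + 4) := by
        have := Exec.assign σ' (2 * d + 1) (.add (.reg (2 * d + 1)) (.const 1))
        simp only [Expr.eval, hr, Expr.cost] at this
        exact Exec.seq hex this
      refine ⟨σ'', _, Exec.while_true ?_ hstep hex', ?_, hJ''⟩
      · simp [Expr.eval, hn i σ hJ, hσ]; omega
      · simp only [Expr.cost]
        rw [Nat.succ_mul]; omega
  obtain ⟨σ', t, hex, ht, hJ⟩ := key n 0 (by simp) _ h0 (by simp)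
  refine ⟨σ', _, Exec.seq (Exec.assign σ _ _) hex, ?_, hJ⟩
  simp only [Expr.cost]; omega

/-- Count in the scratch register `d` the values of register `x` for which `body` leaves a nonzero
value in the scratch register `d + 3`. -/
def countCode (x d : ℕ) (body : Prog) : Prog :=
  .seq (.assign (2 * (d + 1) + 1) (.reg (2 * x)))
    (.seq (.assign (2 * d + 1) (.const 0))
      (.seq (forLoop (d + 2)
        (.seq (.assign (2 * x) (.reg (2 * (d + 2) + 1)))
          (.seq body
            (.ite (.reg (2 * (d + 3) + 1))
              (.assign (2 * d + 1) (.add (.reg (2 * d + 1)) (.const 1))) .skip))))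
        (.assign (2 * x) (.reg (2 * (d + 1) + 1)))))

/-- The code that puts a nonzero value into the scratch register `d` if the condition holds, and
`0` otherwise. -/
def Form.compile : Form → ℕ → Prog
  | .atom e, d => .assign (2 * d + 1) e.ren
  | .not F, d => .seq (F.compile d) (.assign (2 * d + 1) (.sub (.const 1) (.reg (2 * d + 1))))
  | .and F G, d => .seq (F.compile d) (.ite (.reg (2 * d + 1)) (G.compile d) .skip)
  | .ex x F, d => countCode x d (F.compile (d + 3))

/-- A bound for the cost of an expression moved to the even registers. -/
theorem Expr.ren_cost (e : Expr) : e.ren.cost = e.cost := by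
  induction e <;> simp [Expr.ren, Expr.cost, *]

open Polynomial in
/-- A bound for the number of steps of the code of a condition. -/
noncomputable def Form.cost : Form → ℕ[X]
  | .atom e => C (e.cost + 1)
  | .not F => F.cost + 4
  | .and F G => F.cost + G.cost + 3
  | .ex _ F => X * (F.cost + 16) + 12

/-- The code `body` decides the predicate `P` of the state in the scratch register `d`. -/
def Decides (n d B : ℕ) (body : Prog) (P : State → Prop) : Prop :=
  ∀ σ s, Rel n σ s → ∃ σ' t, Exec body σ σ' t ∧ t ≤ B ∧ Rel n σ' s ∧ Keep d σ σ' ∧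
    (σ'.reg (2 * d + 1) ≠ 0 ↔ P s)

open Classical in
-- The scratch places `d`, `d + 1`, `d + 2`, `d + 3` hold the count, the saved value of `x`, the
-- loop counter and the verdict of the body. Restoring `x` at the end makes the count free of side
-- effects on the simulated state.
theorem exec_countCode {n d B : ℕ} (x : ℕ) {body : Prog} {P : State → Prop} (hd : 1 ≤ d)
    (hbody : Decides n (d + 3) B body P) {σ s : State} (h : Rel n σ s) :
    ∃ σ' t, Exec (countCode x d body) σ σ' t ∧ t ≤ n * (B + 16) + 12 ∧ Rel n σ' s ∧ Keep d σ σ' ∧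
      σ'.reg (2 * d + 1) = Nat.count (fun i => P (s.setReg x i)) n := by
  -- During the loop register `x` holds the last value tried, so the simulated state is `s` only up
  -- to this register.
  let J : ℕ → State → Prop := fun i τ =>
    Rel n τ (s.setReg x (τ.reg (2 * x))) ∧ Keep d σ τ ∧ τ.reg (2 * (d + 1) + 1) = s.reg x ∧
      τ.reg (2 * d + 1) = Nat.count (fun i => P (s.setReg x i)) i
  have hloop := exec_forLoop (n := n) (d := d + 2) (B := B + 8)
    (body := .seq (.assign (2 * x) (.reg (2 * (d + 2) + 1)))
          (.seq body
            (.ite (.reg (2 * (d + 3) + 1))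
              (.assign (2 * d + 1) (.add (.reg (2 * d + 1)) (.const 1))) .skip))) J
    (fun i τ hτ => hτ.1.bound) ?_
    (σ := (σ.setReg (2 * (d + 1) + 1) (s.reg x)).setReg (2 * d + 1) 0) ?_
  · obtain ⟨τ, t, hex, ht, hR, hK, hx, hc⟩ := hloop
    refine ⟨τ.setReg (2 * x) (s.reg x), _, Exec.seq (Exec.assign _ _ _) (Exec.seq (Exec.assign _ _ _)
      (Exec.seq (t := t) (t' := 2) (s' := τ) ?_ ?_)), ?_, ?_, ?_, ?_⟩
    · simpa [Expr.eval, h.reg] using hex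
    · have := Exec.assign τ (2 * x) (.reg (2 * (d + 1) + 1))
      simpa [Expr.eval, hx, Expr.cost] using this
    · simp only [Expr.cost]
      have : n * (B + 8 + 8) = n * (B + 16) := by ring
      omega
    · have := hR.setReg_even (x := x) (v := s.reg x)
      simpa using this
    · exact hK.setReg_even
    · rw [State.setReg_reg, if_neg (by omega), hc]
  · rintro i hi τ ⟨hR, hK, hx, hc⟩ hτ
    have hR' : Rel n (τ.setReg (2 * x) i) (s.setReg x i) := by
      simpa using hR.setReg_even (x := x) (v := i)
    obtain ⟨τ', t, hex, ht, hR'', hK', hP⟩ := hbody _ _ hR'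
    have e1 := hK' d (by omega)
    have e2 := hK' (d + 1) (by omega)
    have e3 := hK' (d + 2) (by omega)
    rw [State.setReg_reg, if_neg (by omega)] at e1 e2 e3
    have hassign : Exec (.assign (2 * x) (.reg (2 * (d + 2) + 1))) τ (τ.setReg (2 * x) i) 2 := by
      have := Exec.assign τ (2 * x) (.reg (2 * (d + 2) + 1))
      simpa [Expr.eval, hτ, Expr.cost] using this
    have hKK : Keep d σ τ' := (hK.setReg_even (j := x) (v := i)).trans hK' (by omega)
    by_cases hPi : P (s.setReg x i)
    · refine ⟨τ'.setReg (2 * d + 1) (τ.reg (2 * d + 1) + 1), _, Exec.seq hassign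
        (Exec.seq hex (Exec.ite_true (t := 4) (hP.2 hPi) ?_)), ?_, ?_, ?_, ?_, ?_, ?_⟩
      · have := Exec.assign τ' (2 * d + 1) (.add (.reg (2 * d + 1)) (.const 1))
        simpa [Expr.eval, e1, Expr.cost] using this
      · simp only [Expr.cost]; omega
      · rw [State.setReg_reg, if_neg (by omega), e3, hτ]
      · have : Rel n ((τ'.setReg (2 * d + 1) (τ.reg (2 * d + 1) + 1)).setReg (2 * (d + 2) + 1)
            (i + 1)) (s.setReg x i) := (hR''.setReg_odd hd).setReg_odd (by omega)
        have hv : i = ((τ'.setReg (2 * d + 1) (τ.reg (2 * d + 1) + 1)).setReg (2 * (d + 2) + 1)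
            (i + 1)).reg (2 * x) := by
          rw [this.reg]; simp
        rw [← hv]; exact this
      · exact (hKK.setReg_odd le_rfl).setReg_odd (by omega)
      · simp only [State.setReg_reg]
        rw [if_neg (by omega), if_neg (by omega), e2, hx]
      · simp only [State.setReg_reg]
        rw [if_neg (by omega), if_pos trivial, hc, Nat.count_succ, if_pos hPi]
    · refine ⟨τ', _, Exec.seq hassign
        (Exec.seq hex (Exec.ite_false (t := 1)
          (by simpa [Expr.eval] using fun h => hPi (hP.1 h)) (Exec.skip _))), ?_, ?_, ?_, ?_, ?_, ?_⟩
      · simp only [Expr.cost]; omega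
      · rw [e3, hτ]
      · have : Rel n (τ'.setReg (2 * (d + 2) + 1) (i + 1)) (s.setReg x i) :=
          hR''.setReg_odd (by omega)
        have hv : i = (τ'.setReg (2 * (d + 2) + 1) (i + 1)).reg (2 * x) := by
          rw [this.reg]; simp
        rw [← hv]; exact this
      · exact hKK.setReg_odd (by omega)
      · simp only [State.setReg_reg]
        rw [if_neg (by omega), e2, hx]
      · simp only [State.setReg_reg]
        rw [if_neg (by omega), e1, hc, Nat.count_succ, if_neg hPi, add_zero]
  · have hR : Rel n (((σ.setReg (2 * (d + 1) + 1) (s.reg x)).setReg (2 * d + 1) 0).setReg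
        (2 * (d + 2) + 1) 0) s :=
      ((h.setReg_odd (by omega)).setReg_odd hd).setReg_odd (by omega)
    refine ⟨?_, ?_, ?_, ?_⟩
    · rw [hR.reg, State.setReg_self]; exact hR
    · exact (((Keep.refl d σ).setReg_odd (by omega)).setReg_odd le_rfl).setReg_odd (by omega)
    · simp only [State.setReg_reg]
      rw [if_neg (by omega), if_neg (by omega), if_pos trivial]
    · simp only [State.setReg_reg]
      rw [if_neg (by omega), if_pos trivial]; simp

/-- A quantifier is decided by counting its witnesses. Its body uses scratch places from `d + 3` on,
so nested loops do not disturb the outer counters. -/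
theorem Form.compile_decides (n : ℕ) (F : Form) (d : ℕ) (hd : 1 ≤ d) :
    Decides n d (F.cost.eval n) (F.compile d) (F.holds n) := by
  induction F generalizing d with
  | atom e =>
    intro σ s h
    refine ⟨_, _, Exec.assign _ _ _, ?_, h.setReg_odd hd, (Keep.refl d σ).setReg_odd le_rfl, ?_⟩
    · simp [Form.cost, Expr.ren_cost]
    · simp [h.eval, Form.holds]
  | not F ih =>
    intro σ s h
    obtain ⟨σ', t, hex, ht, hR, hK, hP⟩ := ih d hd σ s h
    refine ⟨_, _, Exec.seq hex (Exec.assign _ _ _), ?_, hR.setReg_odd hd, hK.setReg_odd le_rfl, ?_⟩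
    · simp [Form.cost, Expr.cost]; omega
    · rw [Form.holds, ← hP]
      simp [Expr.eval]; omega
  | and F G ihF ihG =>
    intro σ s h
    obtain ⟨σ', t, hex, ht, hR, hK, hP⟩ := ihF d hd σ s h
    by_cases hF : F.holds n s
    · obtain ⟨σ'', t', hex', ht', hR', hK', hP'⟩ := ihG d hd σ' s hR
      refine ⟨σ'', _, Exec.seq hex (Exec.ite_true (hP.2 hF) hex'), ?_, hR', hK.trans hK' le_rfl, ?_⟩
      · simp [Form.cost, Expr.cost]; omega
      · rw [hP', Form.holds]; tauto
    · refine ⟨σ', _, Exec.seq hex (Exec.ite_false (by simpa [Expr.eval] using fun h => hF (hP.1 h))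
        (Exec.skip _)), ?_, hR, hK, ?_⟩
      · simp [Form.cost, Expr.cost]; omega
      · rw [hP, Form.holds]; tauto
  | ex x F ih =>
    intro σ s h
    obtain ⟨σ', t, hex, ht, hR, hK, hc⟩ := exec_countCode x hd (ih (d + 3) (by omega)) h
    refine ⟨σ', t, hex, ?_, hR, hK, ?_⟩
    · simpa [Form.cost] using ht
    · classical
      rw [hc, Form.holds, Nat.count_eq_card_filter_range, Finset.card_ne_zero]
      simp [Finset.Nonempty]

/-- The machine code of a bounded program, with scratch registers from `d` on. -/
def LProg.compile : LProg → ℕ → Prog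
  | .skip, _ => .skip
  | .assign x e, _ => .assign (2 * x) e.ren
  | .store a i e, _ => .store a i.ren e.ren
  | .seq p q, d => .seq (p.compile d) (q.compile d)
  | .ite F p q, d => .seq (F.compile d) (.ite (.reg (2 * d + 1)) (p.compile d) (q.compile d))
  | .loop x p, d => forLoop d (.seq (.assign (2 * x) (.reg (2 * d + 1))) (p.compile (d + 1)))
  | .find x F, d =>
      .seq (.assign (2 * d + 1) (.reg (2 * x)))
        (.seq (forLoop (d + 1)
          (.seq (.assign (2 * x) (.reg (2 * (d + 1) + 1)))
            (.seq (F.compile (d + 2))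
              (.ite (.reg (2 * (d + 2) + 1)) (.assign (2 * d + 1) (.reg (2 * (d + 1) + 1))) .skip))))
          (.assign (2 * x) (.reg (2 * d + 1))))
  | .count t x F, d =>
      .seq (countCode x d (F.compile (d + 3))) (.assign (2 * t) (.reg (2 * d + 1)))

open Polynomial in
/-- A bound for the number of steps of the code of a bounded program. -/
noncomputable def LProg.cost : LProg → ℕ[X]
  | .skip => 1
  | .assign _ e => C (e.cost + 1)
  | .store _ i e => C (i.cost + e.cost + 1)
  | .seq p q => p.cost + q.cost
  | .ite F p q => F.cost + p.cost + q.cost + 2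
  | .loop _ p => X * (p.cost + 10) + 6
  | .find _ F => X * (F.cost + 16) + 10
  | .count _ _ F => X * (F.cost + 16) + 14

/-- Every loop makes `n` turns and the nesting depth is fixed by the program, so the cost is a
polynomial in `n`. -/
theorem LProg.exec_compile (n : ℕ) (p : LProg) (d : ℕ) (hd : 1 ≤ d) {σ s : State}
    (h : Rel n σ s) : ∃ σ' t, Exec (p.compile d) σ σ' t ∧ t ≤ p.cost.eval n ∧
      Rel n σ' (p.run n s) ∧ Keep d σ σ' := by
  classical
  induction p generalizing d σ s with
  | skip => exact ⟨σ, _, Exec.skip _, by simp [LProg.cost], h, Keep.refl _ _⟩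
  | assign x e =>
    refine ⟨_, _, Exec.assign _ _ _, ?_, ?_, (Keep.refl d σ).setReg_even⟩
    · simp [LProg.cost, Expr.ren_cost]
    · rw [h.eval]; exact h.setReg_even
  | store a i e =>
    refine ⟨_, _, Exec.store _ _ _ _, ?_, ?_, Keep.refl d σ⟩
    · simp [LProg.cost, Expr.ren_cost]
    · rw [h.eval, h.eval]
      exact ⟨by simp [State.setArr, LProg.run, h.arr], h.reg, h.bound⟩
  | seq p q ihp ihq =>
    obtain ⟨σ', t, hex, ht, hR, hK⟩ := ihp d hd h
    obtain ⟨σ'', t', hex', ht', hR', hK'⟩ := ihq d hd hR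
    refine ⟨σ'', _, Exec.seq hex hex', ?_, hR', hK.trans hK' le_rfl⟩
    simp [LProg.cost]; omega
  | ite F p q ihp ihq =>
    obtain ⟨σ', t, hex, ht, hR, hK, hP⟩ := F.compile_decides n d hd σ s h
    by_cases hF : F.holds n s
    · obtain ⟨σ'', t', hex', ht', hR', hK'⟩ := ihp d hd hR
      refine ⟨σ'', _, Exec.seq hex (Exec.ite_true (hP.2 hF) hex'), ?_, ?_, hK.trans hK' le_rfl⟩
      · simp [LProg.cost, Expr.cost]; omega
      · rwa [LProg.run, if_pos hF]
    · obtain ⟨σ'', t', hex', ht', hR', hK'⟩ := ihq d hd hR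
      refine ⟨σ'', _, Exec.seq hex (Exec.ite_false
        (by simpa [Expr.eval] using fun h => hF (hP.1 h)) hex'), ?_, ?_, hK.trans hK' le_rfl⟩
      · simp [LProg.cost, Expr.cost]; omega
      · rwa [LProg.run, if_neg hF]
  | loop x p ih =>
    have := exec_forLoop (n := n) (d := d) (B := p.cost.eval n + 2)
      (body := .seq (.assign (2 * x) (.reg (2 * d + 1))) (p.compile (d + 1)))
      (fun i τ => Rel n τ ((List.range i).foldl (fun s i => p.run n (s.setReg x i)) s) ∧
        Keep d σ τ) (fun i τ hτ => hτ.1.bound) ?_ (σ := σ)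
        ⟨h.setReg_odd hd, (Keep.refl d σ).setReg_odd le_rfl⟩
    · obtain ⟨σ', t, hex, ht, hR, hK⟩ := this
      refine ⟨σ', t, hex, ?_, hR, hK⟩
      simpa [LProg.cost, add_assoc] using ht
    · rintro i hi τ ⟨hR, hK⟩ hτ
      obtain ⟨τ', t, hex, ht, hR', hK'⟩ := ih (d + 1) (by omega) (hR.setReg_even (x := x) (v := i))
      refine ⟨τ', _, Exec.seq (t := 2) (s' := τ.setReg (2 * x) i) ?_ hex, by omega, ?_, ?_, ?_⟩
      · have := Exec.assign τ (2 * x) (.reg (2 * d + 1))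
        simpa [Expr.eval, hτ, Expr.cost] using this
      · rw [hK' d (by omega), State.setReg_reg, if_neg (by omega), hτ]
      · rw [List.range_succ, List.foldl_append]
        exact hR'.setReg_odd hd
      · exact ((hK.setReg_even (j := x) (v := i)).trans hK' (by omega)).setReg_odd le_rfl
  | find x F =>
    -- The last witness below `i`, or the old value of `x`. It is kept in scratch place `d` because
    -- `x` itself varies during the search.
    let f : ℕ → ℕ := fun i => (List.range i).foldl
      (fun b i => if F.holds n (s.setReg x i) then i else b) (s.reg x)
    have := exec_forLoop (n := n) (d := d + 1) (B := F.cost.eval n + 6)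
      (body := .seq (.assign (2 * x) (.reg (2 * (d + 1) + 1)))
            (.seq (F.compile (d + 2))
              (.ite (.reg (2 * (d + 2) + 1)) (.assign (2 * d + 1) (.reg (2 * (d + 1) + 1))) .skip)))
      (fun i τ => Rel n τ (s.setReg x (τ.reg (2 * x))) ∧ Keep d σ τ ∧ τ.reg (2 * d + 1) = f i)
      (fun i τ hτ => hτ.1.bound) ?_ (σ := σ.setReg (2 * d + 1) (s.reg x)) ?_
    · obtain ⟨τ, t, hex, ht, hR, hK, hf⟩ := this
      refine ⟨τ.setReg (2 * x) (f n), _, Exec.seq (Exec.assign _ _ _)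
        (Exec.seq (t := t) (t' := 2) (s' := τ) ?_ ?_), ?_, ?_, ?_⟩
      · simpa [Expr.eval, h.reg] using hex
      · have := Exec.assign τ (2 * x) (.reg (2 * d + 1))
        simpa [Expr.eval, hf, Expr.cost] using this
      · simp only [LProg.cost, Expr.cost, Polynomial.eval_add, Polynomial.eval_mul,
          Polynomial.eval_X, Polynomial.eval_ofNat]
        have : n * (F.cost.eval n + 6 + 8) ≤ n * (F.cost.eval n + 16) :=
          Nat.mul_le_mul_left _ (by omega)
        omega
      · have := hR.setReg_even (x := x) (v := f n)
        rwa [State.setReg_setReg] at this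
      · exact hK.setReg_even
    · rintro i hi τ ⟨hR, hK, hf⟩ hτ
      have hR' : Rel n (τ.setReg (2 * x) i) (s.setReg x i) := by
        simpa using hR.setReg_even (x := x) (v := i)
      obtain ⟨τ', t, hex, ht, hR'', hK', hP⟩ := F.compile_decides n (d + 2) (by omega) _ _ hR'
      have e1 := hK' d (by omega)
      have e2 := hK' (d + 1) (by omega)
      rw [State.setReg_reg, if_neg (by omega)] at e1 e2
      have hassign : Exec (.assign (2 * x) (.reg (2 * (d + 1) + 1))) τ (τ.setReg (2 * x) i) 2 := by
        have := Exec.assign τ (2 * x) (.reg (2 * (d + 1) + 1))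
        simpa [Expr.eval, hτ, Expr.cost] using this
      have hKK : Keep d σ τ' := (hK.setReg_even (j := x) (v := i)).trans hK' (by omega)
      have hfs : f (i + 1) = if F.holds n (s.setReg x i) then i else f i := by
        simp only [f, List.range_succ, List.foldl_append, List.foldl_cons, List.foldl_nil]
      by_cases hPi : F.holds n (s.setReg x i)
      · refine ⟨τ'.setReg (2 * d + 1) i, _, Exec.seq hassign
          (Exec.seq hex (Exec.ite_true (t := 2) (hP.2 hPi) ?_)), ?_, ?_, ?_, ?_, ?_⟩
        · have := Exec.assign τ' (2 * d + 1) (.reg (2 * (d + 1) + 1))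
          simpa [Expr.eval, e2, hτ, Expr.cost] using this
        · simp only [Expr.cost]; omega
        · rw [State.setReg_reg, if_neg (by omega), e2, hτ]
        · have : Rel n ((τ'.setReg (2 * d + 1) i).setReg (2 * (d + 1) + 1)
              (i + 1)) (s.setReg x i) := (hR''.setReg_odd hd).setReg_odd (by omega)
          have hv : i = ((τ'.setReg (2 * d + 1) i).setReg (2 * (d + 1) + 1)
              (i + 1)).reg (2 * x) := by
            rw [this.reg]; simp
          rw [← hv]; exact this
        · exact (hKK.setReg_odd le_rfl).setReg_odd (by omega)
        · simp only [State.setReg_reg]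
          rw [if_neg (by omega), if_pos trivial, hfs, if_pos hPi]
      · refine ⟨τ', _, Exec.seq hassign
          (Exec.seq hex (Exec.ite_false (t := 1)
            (by simpa [Expr.eval] using fun h => hPi (hP.1 h)) (Exec.skip _))),
          ?_, ?_, ?_, ?_, ?_⟩
        · simp only [Expr.cost]; omega
        · rw [e2, hτ]
        · have : Rel n (τ'.setReg (2 * (d + 1) + 1) (i + 1)) (s.setReg x i) :=
            hR''.setReg_odd (by omega)
          have hv : i = (τ'.setReg (2 * (d + 1) + 1) (i + 1)).reg (2 * x) := by
            rw [this.reg]; simp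
          rw [← hv]; exact this
        · exact hKK.setReg_odd (by omega)
        · simp only [State.setReg_reg]
          rw [if_neg (by omega), e1, hf, hfs, if_neg hPi]
    · have hR : Rel n ((σ.setReg (2 * d + 1) (s.reg x)).setReg (2 * (d + 1) + 1) 0) s :=
        (h.setReg_odd hd).setReg_odd (by omega)
      refine ⟨?_, ?_, ?_⟩
      · rw [hR.reg, State.setReg_self]; exact hR
      · exact ((Keep.refl d σ).setReg_odd le_rfl).setReg_odd (by omega)
      · simp only [State.setReg_reg]
        rw [if_neg (by omega), if_pos trivial]; rfl
  | count t x F =>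
    obtain ⟨σ', t', hex, ht, hR, hK, hc⟩ :=
      exec_countCode x hd (F.compile_decides n (d + 3) (by omega)) h
    refine ⟨_, _, Exec.seq hex (Exec.assign _ _ _), ?_, ?_, hK.setReg_even⟩
    · simp [LProg.cost, Expr.cost]; omega
    · simp only [Expr.eval, hc, LProg.run]
      exact hR.setReg_even

end RAM

/-! ## Accessible color classes -/

namespace MaxMin

open Finset Relation

/-- No neighbor of `v` has the color `c`. -/
def Free (n : ℕ) (E : ℕ → ℕ → Prop) (φ : ℕ → ℕ) (v c : ℕ) : Prop := ∀ u < n, E v u → φ u ≠ c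

/-- The color class of `c`. -/
def cls (n : ℕ) (φ : ℕ → ℕ) (c : ℕ) : Finset ℕ := {v ∈ range n | φ v = c}

/-- Some vertex of color `c` can be recolored with `d`. -/
def Move (n : ℕ) (E : ℕ → ℕ → Prop) (φ : ℕ → ℕ) (c d : ℕ) : Prop :=
  ∃ v < n, φ v = c ∧ Free n E φ v d

/-- The vertex `z` is the only neighbor of `y` with the color of `z`. -/
def Solo (n : ℕ) (E : ℕ → ℕ → Prop) (φ : ℕ → ℕ) (y z : ℕ) : Prop :=
  E y z ∧ ∀ u < n, E y u → φ u = φ z → u = z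

@[simp] theorem mem_cls {n : ℕ} {φ : ℕ → ℕ} {c v : ℕ} : v ∈ cls n φ c ↔ v < n ∧ φ v = c := by
  simp [cls]

/-- There is a path from `c` to `c₀` in `A` that avoids `W`. -/
def Avoid (R : ℕ → ℕ → Prop) (A : Finset ℕ) (c₀ W c : ℕ) : Prop :=
  ReflTransGen (fun a b => R a b ∧ (a ∈ A ∧ a ≠ W) ∧ (b ∈ A ∧ b ≠ W)) c c₀ ∧ c ∈ A ∧ c ≠ W

theorem Avoid.head {R : ℕ → ℕ → Prop} {A : Finset ℕ} {c₀ W c d : ℕ} (h : Avoid R A c₀ W d)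
    (hR : R c d) (hc : c ∈ A) (hW : c ≠ W) : Avoid R A c₀ W c :=
  ⟨ReflTransGen.head ⟨hR, ⟨hc, hW⟩, h.2⟩ h.1, hc, hW⟩

theorem Avoid.root {R : ℕ → ℕ → Prop} {A : Finset ℕ} {c₀ W : ℕ} (h : c₀ ∈ A) (hW : c₀ ≠ W) :
    Avoid R A c₀ W c₀ := ⟨.refl, h, hW⟩

/-- For each `U` consider the classes that are cut off from the root when `U` is removed, and choose
`U` with this set nonempty and as small as possible. If a member `W` cut off a class in turn, all
that it cuts off would form a proper subset. An arc from a member to a class that is neither `U` nor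
cut off would give the member a path around `U`. -/
theorem exists_terminal {R : ℕ → ℕ → Prop} {A : Finset ℕ} {c₀ : ℕ} (hc₀ : c₀ ∈ A)
    (hreach : ∀ c ∈ A, ReflTransGen (fun a b => R a b ∧ a ∈ A ∧ b ∈ A) c c₀)
    (hA : ∃ c ∈ A, c ≠ c₀) :
    ∃ U ∈ A, ∃ T ⊆ A, T.Nonempty ∧ c₀ ∉ T ∧ U ∉ T ∧
      (∀ W ∈ T, ∀ X ∈ A, X ≠ W → Avoid R A c₀ W X) ∧
      ∀ W ∈ T, ∀ X ∈ A, X ≠ U → X ∉ T → ¬ R W X := by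
  classical
  let T : ℕ → Finset ℕ := fun U => {c ∈ A | c ≠ U ∧ ¬ Avoid R A c₀ U c}
  have hT : ∀ U c, c ∈ T U ↔ c ∈ A ∧ c ≠ U ∧ ¬ Avoid R A c₀ U c := fun U c => by simp [T]
  have hne : ({U ∈ A | (T U).Nonempty} : Finset ℕ).Nonempty := by
    obtain ⟨c, hc, hcc⟩ := hA
    -- All paths end at `c₀`, so `c₀` cuts off every other class and is a candidate for `U`.
    refine ⟨c₀, mem_filter.2 ⟨hc₀, c, (hT _ _).2 ⟨hc, hcc, ?_⟩⟩⟩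
    rintro ⟨h, -, -⟩
    rcases ReflTransGen.cases_tail h with h | ⟨b, -, -, -, -, h⟩
    · exact hcc h.symm
    · exact h rfl
  obtain ⟨U, hU, hmin⟩ := exists_min_image _ (fun U => #(T U)) hne
  simp only [mem_filter] at hU hmin
  have hroot : c₀ ∉ T U := fun h => by
    rw [hT] at h
    exact h.2.2 (Avoid.root hc₀ h.2.1)
  refine ⟨U, hU.1, T U, filter_subset _ _, hU.2, hroot, by simp [hT], ?_, ?_⟩
  · intro W hW
    by_contra! hcon
    obtain ⟨X, hX, hXW, hXa⟩ := hcon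
    have hWU := (hT _ _).1 hW
    have hcW : c₀ ≠ W := by rintro rfl; exact hroot hW
    -- No class on a path around `U` is cut off by `U`; in particular `W` is not on it.
    have claim : ∀ c, Avoid R A c₀ U c → Avoid R A c₀ W c := by
      rintro c ⟨h, hc, hcU⟩
      induction h using ReflTransGen.head_induction_on with
      | refl => exact Avoid.root hc₀ hcW
      | head h' h ih =>
        refine (ih h'.2.2.1 h'.2.2.2).head h'.1 hc ?_
        rintro rfl
        exact hWU.2.2 ⟨ReflTransGen.head h' h, hc, hcU⟩
    -- Past its last visit to `U`, a path from `U` to the root avoids `U` and hence, by the claim,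
    -- `W`.
    have claim' : Avoid R A c₀ W U := by
      have : ∀ c, ReflTransGen (fun a b => R a b ∧ a ∈ A ∧ b ∈ A) c c₀ →
          Avoid R A c₀ U c ∨ Avoid R A c₀ W U := by
        intro c h
        induction h using ReflTransGen.head_induction_on with
        | refl =>
          by_cases h : c₀ = U
          · right; rw [← h]; exact Avoid.root hc₀ hcW
          · left; exact Avoid.root hc₀ h
        | @head a b h' h ih =>
          rcases ih with ih | ih
          · by_cases ha : a = U
            · right
              rw [ha] at h'
              exact (claim _ ih).head h'.1 hU.1 hWU.2.1.symm
            · left; exact ih.head h'.1 h'.2.1 ha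
          · exact Or.inr ih
      rcases this U (hreach U hU.1) with h | h
      · exact absurd rfl h.2.2
      · exact h
    have hss : T W ⊂ T U := by
      refine (ssubset_iff_of_subset ?_).2 ⟨W, hW, by simp [hT]⟩
      intro Y hY
      rw [hT] at hY ⊢
      refine ⟨hY.1, ?_, fun h => hY.2.2 (claim _ h)⟩
      rintro rfl
      exact hY.2.2 claim'
    have := hmin W ⟨hWU.1, X, (hT _ _).2 ⟨hX, hXW, hXa⟩⟩
    exact absurd (card_lt_card hss) (by omega)
  · intro W hW X hX hXU hXT hR
    rw [hT] at hW hXT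
    push Not at hXT
    exact hW.2.2 ((hXT hX hXU).head hR hW.1 hW.2.1)

/-- The coloring `φ` cannot be improved by moving vertices along a path of color classes: `S` is the
set of active vertices, `Q` the set of active colors, `A` the set of colors from which the small
class `c₀` is accessible. -/
structure Stuck (n k : ℕ) (E : ℕ → ℕ → Prop) (φ : ℕ → ℕ) (S Q A : Finset ℕ) (c₀ : ℕ) : Prop where
  symm : ∀ u < n, ∀ v < n, E u v → E v u
  lt : ∀ v ∈ S, v < n
  sub : A ⊆ Q
  mem : ∀ v < n, φ v ∈ A → v ∈ S
  size : ∀ c ∈ A, #(cls n φ c) ≤ k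
  root : c₀ ∈ A
  small : #(cls n φ c₀) < k
  deg : ∀ v ∈ S, ∀ [DecidablePred (E v)], #{u ∈ S | E v u} < #Q
  large : #Q * k ≤ #S
  nbr : ∀ y ∈ S, φ y ∉ A → ∀ c ∈ A, ∃ u < n, E y u ∧ φ u = c
  reach : ∀ c ∈ A, ReflTransGen (fun a b => Move n E φ a b ∧ a ∈ A ∧ b ∈ A) c c₀

/-- Applied with adjacency to a vertex, to split a degree into its parts outside and inside `A`, and
with the trivial predicate, to count `S`. -/
theorem card_filter_eq_add_sum {n : ℕ} {φ : ℕ → ℕ} {S A : Finset ℕ} (P : ℕ → Prop)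
    [DecidablePred P]
    (hS : ∀ v ∈ S, v < n) (hA : ∀ v < n, φ v ∈ A → v ∈ S) :
    #{u ∈ S | P u} = #{u ∈ {u ∈ S | φ u ∉ A} | P u} + ∑ c ∈ A, #{u ∈ cls n φ c | P u} := by
  rw [← card_filter_add_card_filter_not (s := {u ∈ S | P u}) (fun u => φ u ∉ A), filter_comm]
  congr 1
  rw [card_eq_sum_card_fiberwise (f := φ) (t := A)]
  · refine sum_congr rfl fun c hc => congrArg card ?_
    ext u
    simp only [mem_filter, mem_cls]
    constructor
    · rintro ⟨⟨⟨h1, h2⟩, -⟩, h3⟩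
      exact ⟨⟨hS u h1, h3⟩, h2⟩
    · rintro ⟨⟨h1, h2⟩, h3⟩
      have : φ u ∈ A := h2 ▸ hc
      exact ⟨⟨⟨hA u h1 this, h3⟩, not_not.2 this⟩, h2⟩
  · intro u hu
    simpa using (mem_filter.1 hu).2

open Classical in
theorem sum_sum_nbr {E : ℕ → ℕ → Prop} {X B : Finset ℕ} (hE : ∀ x ∈ X, ∀ y ∈ B, E x y ↔ E y x)
    (f : ℕ → ℕ) : ∑ y ∈ B, ∑ x ∈ X with E y x, f x = ∑ x ∈ X, f x * #{y ∈ B | E x y} := by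
  simp only [sum_filter]
  rw [sum_comm]
  refine sum_congr rfl fun x hx => ?_
  rw [mul_comm, card_filter, sum_mul]
  refine sum_congr rfl fun y hy => ?_
  rw [hE x hx y hy]
  split_ifs <;> simp

theorem exists_solo_of_card_eq_one {n : ℕ} {E : ℕ → ℕ → Prop} {φ : ℕ → ℕ} {y c : ℕ}
    [DecidablePred (E y)] (h : #{u ∈ cls n φ c | E y u} = 1) :
    ∃ z < n, φ z = c ∧ Solo n E φ y z := by
  obtain ⟨z, hz⟩ := card_eq_one.1 h
  have key : ∀ u, (u < n ∧ φ u = c) ∧ E y u ↔ u = z := fun u => by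
    rw [← mem_cls, ← mem_filter, hz, mem_singleton]
  obtain ⟨⟨h1, h2⟩, h3⟩ := (key z).2 rfl
  exact ⟨z, h1, h2, h3, fun u hu hE hφ => (key u).1 ⟨⟨hu, hφ.trans h2⟩, hE⟩⟩

/-! ### Counting arguments in a stuck configuration -/

namespace Stuck

variable {n k : ℕ} {E : ℕ → ℕ → Prop} {φ : ℕ → ℕ} {S Q A : Finset ℕ} {c₀ : ℕ}

open Classical in
theorem deg_split (h : Stuck n k E φ S Q A c₀) {v : ℕ} (hv : v ∈ S) :
    #{u ∈ {u ∈ S | φ u ∉ A} | E v u} + ∑ c ∈ A, #{u ∈ cls n φ c | E v u} < #Q := by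
  rw [← card_filter_eq_add_sum (E v) h.lt h.mem]
  exact h.deg v hv

open Classical in
-- The root class falls short of `k`, so the accessible classes contain fewer than `#A * k` of the
-- at least `#Q * k` vertices of `S`.
theorem card_outside (h : Stuck n k E φ S Q A c₀) : (#Q - #A) * k + 1 ≤ #{u ∈ S | φ u ∉ A} := by
  have h1 := card_filter_eq_add_sum (fun _ => True) h.lt h.mem
  simp only [filter_true] at h1
  have h2 : ∑ c ∈ A, #(cls n φ c) < ∑ c ∈ A, k :=
    sum_lt_sum (fun c hc => h.size c hc) ⟨c₀, h.root, h.small⟩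
  rw [sum_const, smul_eq_mul] at h2
  have h3 := h.large
  have h4 := card_le_card h.sub
  rw [Nat.sub_mul]
  have := Nat.mul_le_mul_right k h4
  omega

open Classical in
-- If `c₀` alone were accessible, each of the more than `(#Q - 1) * k` outside vertices would have a
-- neighbor in a class of fewer than `k` vertices, each of degree at most `#Q - 1`.
theorem exists_ne_root (h : Stuck n k E φ S Q A c₀) : ∃ c ∈ A, c ≠ c₀ := by
  by_contra! hcon
  have hA : A = {c₀} := by
    ext c; rw [mem_singleton]; exact ⟨hcon c, fun hc => hc ▸ h.root⟩
  have hB := h.card_outside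
  have hcount := sum_sum_nbr (E := E) (X := cls n φ c₀) (B := {u ∈ S | φ u ∉ A})
    (fun x hx y hy => by
      have hx := (mem_cls.1 hx).1
      have hy := h.lt y (mem_filter.1 hy).1
      exact ⟨h.symm x hx y hy, h.symm y hy x hx⟩) (fun _ => 1)
  have h1 : #{u ∈ S | φ u ∉ A} ≤
      ∑ y ∈ {u ∈ S | φ u ∉ A}, ∑ x ∈ cls n φ c₀ with E y x, 1 := by
    rw [card_eq_sum_ones]
    refine sum_le_sum fun y hy => ?_
    obtain ⟨u, hu, hE, hφ⟩ := h.nbr y (mem_filter.1 hy).1 (mem_filter.1 hy).2 c₀ h.root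
    rw [← card_eq_sum_ones, Nat.one_le_iff_ne_zero, card_ne_zero]
    exact ⟨u, by simp [hu, hE, hφ]⟩
  have h2 : ∑ x ∈ cls n φ c₀, 1 * #{y ∈ {u ∈ S | φ u ∉ A} | E x y} ≤
      ∑ x ∈ cls n φ c₀, (#Q - #A) := by
    refine sum_le_sum fun x hx => ?_
    rw [mem_cls] at hx
    have := h.deg_split (h.mem x hx.1 (hx.2 ▸ h.root))
    rw [hA, card_singleton] at *
    omega
  rw [sum_const, smul_eq_mul] at h2
  have h3 := Nat.mul_le_mul_right (#Q - #A) h.small.le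
  rw [mul_comm k] at h3
  omega

open Classical in
/-- The configuration at which the search along paths succeeds after recoloring a solo neighbor. -/
theorem exists_swap (h : Stuck n k E φ S Q A c₀)
    (hno : ∀ W ∈ A, W ≠ c₀ → ∀ z < n, φ z = W → ∀ c, Avoid (Move n E φ) A c₀ W c →
      Free n E φ z c → ∀ y ∈ S, φ y ∉ A → ¬ Solo n E φ y z) :
    2 * (#Q - #A) + 1 ≤ #Q ∧
    ∃ W ∈ A, W ≠ c₀ ∧ ∃ z < n, φ z = W ∧ ∃ y₁ ∈ S, φ y₁ ∉ A ∧ ∃ y₂ ∈ S, φ y₂ ∉ A ∧ y₁ ≠ y₂ ∧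
      ¬ E y₁ y₂ ∧ Solo n E φ y₁ z ∧ Solo n E φ y₂ z ∧ ∃ w < n, φ w = W ∧ w ≠ z ∧ ∃ c,
      Avoid (Move n E φ) A c₀ W c ∧ Free n E φ w c := by
  obtain ⟨U, hU, T, hTA, hTne, hcT, hUT, hterm, hblock⟩ :=
    exists_terminal h.root h.reach h.exists_ne_root
  obtain ⟨q, hq⟩ : ∃ q, #Q = #A + q := ⟨_, (Nat.add_sub_cancel' (card_le_card h.sub)).symm⟩
  set B := ({u ∈ S | φ u ∉ A} : Finset ℕ) with hBdef
  have hB : q * k + 1 ≤ #B := by simpa [hq] using h.card_outside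
  have hBS : ∀ y ∈ B, y ∈ S ∧ φ y ∉ A := fun y hy => mem_filter.1 hy
  have hdeg : ∀ v ∈ S, #{u ∈ B | E v u} + ∑ c ∈ A, #{u ∈ cls n φ c | E v u} < #Q :=
    fun v hv => h.deg_split hv
  have hsymm : ∀ c, ∀ x ∈ cls n φ c, ∀ y ∈ B, E x y ↔ E y x := fun c x hx y hy => by
    have hx := (mem_cls.1 hx).1
    have hy := h.lt y (hBS y hy).1
    exact ⟨h.symm x hx y hy, h.symm y hy x hx⟩
  have hnpos : ∀ v c, ¬ Free n E φ v c → 1 ≤ #{u ∈ cls n φ c | E v u} := by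
    intro v c hv
    simp only [Free, not_forall, not_not] at hv
    obtain ⟨u, hu, hE, hφ⟩ := hv
    rw [Nat.one_le_iff_ne_zero, card_ne_zero]
    exact ⟨u, by simp [hu, hE, hφ]⟩
  have hyfree : ∀ y ∈ B, ∀ c ∈ A, ¬ Free n E φ y c := by
    intro y hy c hc hF
    obtain ⟨u, hu, hE, hφ⟩ := h.nbr y (hBS y hy).1 (hBS y hy).2 c hc
    exact hF u hu hE hφ
  -- a solo vertex in a terminal class has neighbors in all other accessible classes
  have hsolo : ∀ z < n, φ z ∈ T → (∃ y ∈ B, Solo n E φ y z) → #{y ∈ B | E z y} ≤ q := by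
    rintro z hz hzT ⟨y, hy, hs⟩
    have hzA := hTA hzT
    have h1 := hdeg _ (h.mem z hz hzA)
    -- If `z` could move to another accessible class `c`, then `c` reaches the root without the
    -- terminal class of `z`, and this is the exchange excluded by `hno`.
    have h2 : #(A.erase (φ z)) ≤ ∑ c ∈ A, #{u ∈ cls n φ c | E z u} := by
      rw [card_eq_sum_ones]
      refine (sum_le_sum fun c hc => ?_).trans (sum_le_sum_of_subset (erase_subset (φ z) A))
      rw [mem_erase] at hc
      refine hnpos z c fun hF => ?_
      exact hno (φ z) hzA (fun he => hcT (he ▸ hzT)) z hz rfl c (hterm _ hzT c hc.2 hc.1) hF y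
        (hBS y hy).1 (hBS y hy).2 hs
    rw [card_erase_of_mem hzA] at h2
    omega
  have hcard : #(A \ T) = #A - #T := card_sdiff_of_subset hTA
  have hTle : #T + 1 ≤ #A := by
    rw [← card_insert_of_notMem hUT]
    exact card_le_card (insert_subset hU hTA)
  have hter : ∀ x < n, φ x ∈ T → #{y ∈ B | E x y} ≤ q + #T := by
    intro x hx hxT
    have hxA := hTA hxT
    have h1 := hdeg _ (h.mem x hx hxA)
    -- By `hblock`, a vertex of a class in `T` cannot move to a class outside `T` other than `U`, so
    -- it has a neighbor in each of these.
    have h2 : #((A \ T).erase U) ≤ ∑ c ∈ A, #{u ∈ cls n φ c | E x u} := by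
      rw [card_eq_sum_ones]
      refine (sum_le_sum fun c hc => ?_).trans
        (sum_le_sum_of_subset ((erase_subset U _).trans sdiff_subset))
      rw [mem_erase, mem_sdiff] at hc
      refine hnpos x c fun hF => hblock _ hxT c hc.2.1 hc.1 hc.2.2 ⟨x, hx, rfl, hF⟩
    rw [card_erase_of_mem (mem_sdiff.2 ⟨hU, hUT⟩)] at h2
    omega
  -- the terminal set is large
  have hTq : q + 1 ≤ #T := by
    by_contra hlt
    obtain ⟨W, hW⟩ := hTne
    -- With weight `2` on solo vertices, each `y ∈ B` collects at least `2` from `W`, from two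
    -- neighbors or from one solo neighbor. If `#T ≤ q`, each of the at most `k` vertices of `W`
    -- gives away at most `2 * q`, too little for `#B > q * k`.
    let f : ℕ → ℕ := fun x => if ∃ y ∈ B, Solo n E φ y x then 2 else 1
    have h1 := sum_sum_nbr (hsymm W) f
    have h2 : ∑ y ∈ B, 2 ≤ ∑ y ∈ B, ∑ x ∈ cls n φ W with E y x, f x := by
      refine sum_le_sum fun y hy => ?_
      have hp := hnpos y W (hyfree y hy W (hTA hW))
      rcases eq_or_lt_of_le hp with he | hlt
      · obtain ⟨z, hz, hzW, hs⟩ := exists_solo_of_card_eq_one he.symm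
        have hmem : z ∈ ({x ∈ cls n φ W | E y x} : Finset ℕ) := by simp [hz, hzW, hs.1]
        have : f z = 2 := if_pos ⟨y, hy, hs⟩
        rw [← this]
        exact single_le_sum (f := f) (fun _ _ => Nat.zero_le _) hmem
      · calc 2 ≤ ∑ x ∈ cls n φ W with E y x, 1 := by rw [← card_eq_sum_ones]; exact hlt
          _ ≤ _ := sum_le_sum fun x _ => by simp only [f]; split_ifs <;> omega
    have h3 : ∑ x ∈ cls n φ W, f x * #{y ∈ B | E x y} ≤ ∑ x ∈ cls n φ W, 2 * q := by
      refine sum_le_sum fun x hx => ?_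
      obtain ⟨hx, hxW⟩ := mem_cls.1 hx
      simp only [f]
      split_ifs with hs
      · exact Nat.mul_le_mul_left _ (hsolo x hx (hxW ▸ hW) hs)
      · have := hter x hx (hxW ▸ hW)
        omega
    rw [sum_const, smul_eq_mul] at h2 h3
    have h4 := Nat.mul_le_mul_right (2 * q) (h.size W (hTA hW))
    have h5 : k * (2 * q) = 2 * (q * k) := by ring
    omega
  refine ⟨by omega, ?_⟩
  by_contra hcon
  -- otherwise the solo neighbors of a vertex form a clique
  have hclique : ∀ z < n, φ z ∈ T → ∀ y₁ ∈ B, ∀ y₂ ∈ B, Solo n E φ y₁ z → Solo n E φ y₂ z →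
      y₁ ≠ y₂ → E y₁ y₂ := by
    intro z hz hzT y₁ hy₁ y₂ hy₂ hs₁ hs₂ hne
    by_contra hE
    apply hcon
    have hW := hTA hzT
    have hWc : φ z ≠ c₀ := fun he => hcT (he ▸ hzT)
    refine ⟨φ z, hW, hWc, z, hz, rfl, y₁, (hBS _ hy₁).1, (hBS _ hy₁).2, y₂, (hBS _ hy₂).1,
      (hBS _ hy₂).2, hne, hE, hs₁, hs₂, ?_⟩
    -- The path from the class of `z` to the root has to leave this class, which supplies the
    -- movable vertex `w`. It differs from `z`, since moving `z` would be an exchange excluded by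
    -- `hno`.
    have hex : ∃ c ∈ A, c ≠ φ z ∧ Move n E φ (φ z) c := by
      have : ∀ c, ReflTransGen (fun a b => Move n E φ a b ∧ a ∈ A ∧ b ∈ A) c c₀ → c = φ z →
          ∃ c ∈ A, c ≠ φ z ∧ Move n E φ (φ z) c := by
        intro c hc
        induction hc using ReflTransGen.head_induction_on with
        | refl => exact fun he => absurd he.symm hWc
        | @head a b h' _ ih =>
          rintro rfl
          by_cases hb : b = φ z
          · exact ih hb
          · exact ⟨b, h'.2.2, hb, h'.1⟩
      exact this _ (h.reach _ hW) rfl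
    obtain ⟨c, hc, hcz, w, hw, hwz, hF⟩ := hex
    have hav := hterm _ hzT c hc hcz
    refine ⟨w, hw, hwz, ?_, c, hav, hF⟩
    rintro rfl
    exact hno _ hW hWc w hw rfl c hav hF y₁ (hBS _ hy₁).1 (hBS _ hy₁).2 hs₁
  let X : Finset ℕ := {x ∈ range n | φ x ∈ T}
  have hX : ∀ x, x ∈ X ↔ x < n ∧ φ x ∈ T := fun x => by simp [X]
  let d : ℕ → ℕ := fun v => #{u ∈ B | E v u}
  let s : ℕ → ℕ := fun z => #{y ∈ B | Solo n E φ y z}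
  -- Each class of `T` contains two neighbors of `y` or a solo one, and each other accessible class
  -- at least one neighbor. The degree bound then forces at least `#T - q + d y + 1` solo neighbors.
  have hsig : ∀ y ∈ B, #T + 1 + d y ≤ #{z ∈ X | Solo n E φ y z} + q ∧ d y + 1 ≤ q := by
    intro y hy
    have h1 := hdeg _ (hBS y hy).1
    have h0 : ∀ c ∈ A, 1 ≤ #{u ∈ cls n φ c | E y u} := fun c hc => hnpos y c (hyfree y hy c hc)
    have h2 : ∑ c ∈ A, #{u ∈ cls n φ c | E y u} =
        ∑ c ∈ A \ T, #{u ∈ cls n φ c | E y u} + ∑ c ∈ T, #{u ∈ cls n φ c | E y u} :=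
      (sum_sdiff hTA).symm
    have h3 : #(A \ T) ≤ ∑ c ∈ A \ T, #{u ∈ cls n φ c | E y u} := by
      rw [card_eq_sum_ones]
      exact sum_le_sum fun c hc => h0 c (mem_sdiff.1 hc).1
    have h4 : ∑ c ∈ T, 2 ≤ ∑ c ∈ T, (#{u ∈ cls n φ c | E y u} +
        #{z ∈ {z ∈ X | Solo n E φ y z} | φ z = c}) := by
      refine sum_le_sum fun c hc => ?_
      have hp := h0 c (hTA hc)
      rcases eq_or_lt_of_le hp with he | hlt
      · obtain ⟨z, hz, hzc, hs⟩ := exists_solo_of_card_eq_one he.symm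
        have : 1 ≤ #{z ∈ {z ∈ X | Solo n E φ y z} | φ z = c} := by
          rw [Nat.one_le_iff_ne_zero, card_ne_zero]
          refine ⟨z, ?_⟩
          rw [mem_filter, mem_filter, hX]
          exact ⟨⟨⟨hz, hzc ▸ hc⟩, hs⟩, hzc⟩
        omega
      · omega
    rw [sum_add_distrib, sum_const, smul_eq_mul, ← card_eq_sum_card_fiberwise (f := φ) (t := T)
      (fun z hz => ((hX z).1 (mem_filter.1 hz).1).2)] at h4
    have h5 : #A ≤ ∑ c ∈ A, #{u ∈ cls n φ c | E y u} := by
      rw [card_eq_sum_ones]; exact sum_le_sum h0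
    simp only [d]
    omega
  have hsz : ∀ z ∈ X, ∀ y ∈ B, Solo n E φ y z → s z ≤ d y + 1 := by
    intro z hz y hy hs
    rw [hX] at hz
    have : ({y ∈ B | Solo n E φ y z} : Finset ℕ) ⊆ insert y {u ∈ B | E y u} := by
      intro u hu
      rw [mem_filter] at hu
      rw [mem_insert, mem_filter]
      by_cases he : u = y
      · exact Or.inl he
      · exact Or.inr ⟨hu.1, hclique z hz.1 hz.2 y hy u hu.1 hs hu.2 (Ne.symm he)⟩
    exact (card_le_card this).trans (card_insert_le _ _)
  -- Discharging: every solo pair `(y, z)` carries the charge `q / s z`. As `s z ≤ d y + 1 ≤ q ≤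
  -- #T`, the vertex `y` receives at least `q * (#T - q + d y + 1) / (d y + 1)`, which is at least
  -- `#T`.
  have hlow : ∀ y ∈ B, (#T : ℚ) ≤ ∑ z ∈ X with Solo n E φ y z, (q : ℚ) / s z := by
    intro y hy
    obtain ⟨h1, h2⟩ := hsig y hy
    have hstep : ∑ z ∈ X with Solo n E φ y z, (q : ℚ) / (d y + 1 : ℕ) ≤
        ∑ z ∈ X with Solo n E φ y z, (q : ℚ) / s z := by
      refine sum_le_sum fun z hz => ?_
      rw [mem_filter] at hz
      have hpos : 0 < s z := card_pos.2 ⟨y, by simp [hy, hz.2]⟩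
      have hle := hsz z hz.1 y hy hz.2
      gcongr
    refine le_trans ?_ hstep
    rw [sum_const, nsmul_eq_mul]
    have hD : (0 : ℚ) < (d y + 1 : ℕ) := by positivity
    rw [← mul_div_assoc, le_div_iff₀ hD]
    have h1' : (#T : ℚ) + (d y + 1 : ℕ) ≤ #{z ∈ X | Solo n E φ y z} + q := by
      exact_mod_cast (by omega : #T + (d y + 1) ≤ _)
    have h2' : ((d y + 1 : ℕ) : ℚ) ≤ q := by exact_mod_cast h2
    have h3' : (q : ℚ) ≤ #T := by exact_mod_cast (by omega : q ≤ #T)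
    nlinarith
  have hup : ∀ z ∈ X, ∑ y ∈ B with Solo n E φ y z, (q : ℚ) / s z ≤ q := by
    intro z hz
    rw [sum_const, nsmul_eq_mul]
    by_cases h0 : #{y ∈ B | Solo n E φ y z} = 0
    · rw [h0]; simp
    · have : (#{y ∈ B | Solo n E φ y z} : ℚ) ≠ 0 := by exact_mod_cast h0
      simp only [s]
      rw [mul_div_cancel₀ _ this]
  have hXcard : #X ≤ #T * k := by
    rw [card_eq_sum_card_fiberwise (f := φ) (t := T) (fun z hz => ((hX z).1 hz).2), ← smul_eq_mul,
      ← sum_const]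
    refine sum_le_sum fun c hc => (card_le_card fun v hv => ?_).trans (h.size c (hTA hc))
    rw [mem_filter, hX] at hv
    exact mem_cls.2 ⟨hv.1.1, hv.2⟩
  have hsum : ∑ y ∈ B, ∑ z ∈ X with Solo n E φ y z, (q : ℚ) / s z =
      ∑ z ∈ X, ∑ y ∈ B with Solo n E φ y z, (q : ℚ) / s z := by
    simp only [sum_filter]
    exact sum_comm
  have h1 := sum_le_sum hlow
  have h2 := sum_le_sum hup
  rw [hsum] at h1
  have h3 := h1.trans h2
  rw [sum_const, sum_const, nsmul_eq_mul, nsmul_eq_mul] at h3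
  -- Together with `#X ≤ #T * k` this contradicts `#B ≥ q * k + 1`, since `T` is nonempty.
  have h4 : #B * #T ≤ #X * q := by exact_mod_cast h3
  have h5 : (q * k + 1) * #T ≤ #B * #T := Nat.mul_le_mul_right _ hB
  have h6 : #X * q ≤ #T * k * q := Nat.mul_le_mul_right _ hXcard
  have h7 : (q * k + 1) * #T = #T * k * q + #T := by ring
  omega

end Stuck

end MaxMin

namespace MaxMin

open Finset Relation

/-! ## Search trees of color classes and augmentation -/

/-- A search tree of color classes: `acc c` is nonzero when the class `c` is found, and then the
vertex `wit c` of color `c` can be recolored with `nxt c`, which is closer to the root. -/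
structure Tree (n : ℕ) (E : ℕ → ℕ → Prop) (φ al acc nxt wit : ℕ → ℕ) (root : ℕ) : Prop where
  root_lt : root < n
  root_mem : acc root ≠ 0
  mem : ∀ c < n, acc c ≠ 0 → al c ≠ 0
  le : ∀ c < n, acc c ≤ #{c ∈ range n | acc c ≠ 0}
  step : ∀ c < n, acc c ≠ 0 → c ≠ root → nxt c < n ∧ acc (nxt c) ≠ 0 ∧ acc (nxt c) < acc c ∧
    wit c < n ∧ φ (wit c) = c ∧ Free n E φ (wit c) (nxt c)

/-- The set of classes found by a search. -/
def found (n : ℕ) (acc : ℕ → ℕ) : Finset ℕ := {c ∈ range n | acc c ≠ 0}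

@[simp] theorem mem_found {n : ℕ} {acc : ℕ → ℕ} {c : ℕ} : c ∈ found n acc ↔ c < n ∧ acc c ≠ 0 := by
  simp [found]

/-- The search cannot be continued. -/
def Closed (n : ℕ) (E : ℕ → ℕ → Prop) (φ al acc : ℕ → ℕ) : Prop :=
  ∀ c < n, al c ≠ 0 → ∀ d < n, acc d ≠ 0 → ∀ v < n, φ v = c → Free n E φ v d → acc c ≠ 0

theorem Tree.init {n : ℕ} {E : ℕ → ℕ → Prop} {φ al acc nxt wit : ℕ → ℕ} {root : ℕ} (h : root < n)
    (hal : al root ≠ 0) (hacc : ∀ c < n, acc c = if c = root then 1 else 0) :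
    Tree n E φ al acc nxt wit root := by
  have hroot : acc root ≠ 0 := by simp [hacc root h]
  refine ⟨h, hroot, ?_, ?_, ?_⟩
  · intro c hc h0
    rw [hacc c hc] at h0
    split_ifs at h0 with he
    · rwa [he]
    · simp at h0
  · intro c hc
    have : 0 < #{c ∈ range n | acc c ≠ 0} := card_pos.2 ⟨root, by simp [h, hroot]⟩
    rw [hacc c hc]
    split_ifs <;> omega
  · intro c hc h0 hne
    rw [hacc c hc, if_neg hne] at h0
    simp at h0

theorem Tree.add {n : ℕ} {E : ℕ → ℕ → Prop} {φ al acc nxt wit : ℕ → ℕ} {root : ℕ}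
    (h : Tree n E φ al acc nxt wit root) {c d v : ℕ} (hc : c < n) (hal : al c ≠ 0)
    (hacc : acc c = 0) (hd : d < n) (haccd : acc d ≠ 0) (hv : v < n) (hφ : φ v = c)
    (hF : Free n E φ v d) :
    Tree n E φ al (Function.update acc c (acc d + 1)) (Function.update nxt c d)
      (Function.update wit c v) root := by
  have hne : ∀ b, acc b ≠ 0 → b ≠ c := by rintro b hb rfl; exact hb hacc
  have hup : ∀ b, acc b ≠ 0 → Function.update acc c (acc d + 1) b = acc b := fun b hb =>
    Function.update_of_ne (hne b hb) _ _
  refine ⟨h.root_lt, ?_, ?_, ?_, ?_⟩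
  · rw [hup _ h.root_mem]; exact h.root_mem
  · intro b hb hb0
    by_cases hbc : b = c
    · rwa [hbc]
    · rw [Function.update_of_ne hbc] at hb0; exact h.mem b hb hb0
  · have hset : ({b ∈ range n | Function.update acc c (acc d + 1) b ≠ 0} : Finset ℕ) =
        insert c {b ∈ range n | acc b ≠ 0} := by
      ext b
      simp only [mem_filter, mem_insert, mem_range]
      by_cases hbc : b = c
      · subst hbc; simp [hc]
      · simp [hbc]
    rw [hset, card_insert_of_notMem (by simp [hacc])]
    intro b hb
    by_cases hbc : b = c
    · subst hbc
      rw [Function.update_self]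
      have := h.le d hd
      omega
    · rw [Function.update_of_ne hbc]
      have := h.le b hb
      omega
  · intro b hb hb0 hbr
    by_cases hbc : b = c
    · subst hbc
      simp only [Function.update_self]
      rw [hup d haccd]
      exact ⟨hd, haccd, by omega, hv, hφ, hF⟩
    · rw [Function.update_of_ne hbc] at hb0
      simp only [Function.update_of_ne hbc]
      obtain ⟨h1, h2, h3, h4⟩ := h.step b hb hb0 hbr
      rw [hup _ h2]
      exact ⟨h1, h2, h3, h4⟩

theorem Tree.induction {n : ℕ} {E : ℕ → ℕ → Prop} {φ al acc nxt wit : ℕ → ℕ} {root : ℕ}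
    (h : Tree n E φ al acc nxt wit root) {P : ℕ → Prop} (h0 : P root)
    (hs : ∀ c < n, acc c ≠ 0 → ∀ d < n, acc d ≠ 0 → Move n E φ c d → P d → P c) :
    ∀ c < n, acc c ≠ 0 → P c := by
  intro c
  induction hl : acc c using Nat.strong_induction_on generalizing c with
  | _ l ih =>
    rintro hc h0c
    by_cases hcr : c = root
    · rwa [hcr]
    · obtain ⟨h1, h2, h3, h4, h5, h6⟩ := h.step c hc (hl ▸ h0c) hcr
      exact hs c hc (hl ▸ h0c) _ h1 h2 ⟨_, h4, h5, h6⟩ (ih _ (hl ▸ h3) _ rfl h1 h2)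

theorem card_cls_eq {n : ℕ} (ψ : ℕ → ℕ) {x : ℕ} (hx : x < n) (d : ℕ) :
    #(cls n ψ d) = #{u ∈ range n | u ≠ x ∧ ψ u = d} + if ψ x = d then 1 else 0 := by
  have : ({u ∈ range n | u ≠ x ∧ ψ u = d} : Finset ℕ) = (cls n ψ d).erase x := by
    ext u; simp only [mem_filter, mem_erase, mem_cls, mem_range]; tauto
  rw [this]
  split_ifs with h
  · rw [card_erase_add_one (mem_cls.2 ⟨hx, h⟩)]
  · rw [erase_eq_of_notMem (by simp [h]), add_zero]

/-- The coloring `ψ` arises from `φ` by recoloring along a path of classes in `T`, so that the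
vertex `x` enters, and the size of the class `root` goes up by one. -/
structure Augmented (n r : ℕ) (E : ℕ → ℕ → Prop) (φ : ℕ → ℕ) (x : ℕ) (T : Finset ℕ) (root : ℕ)
    (ψ : ℕ → ℕ) : Prop where
  proper : ∀ u < n, ∀ w < n, E u w → ψ u < r → ψ u ≠ ψ w
  card : ∀ c, #(cls n ψ c) = #{u ∈ range n | u ≠ x ∧ φ u = c} + if c = root then 1 else 0
  keep : ∀ u, u ≠ x → φ u ∉ T → ψ u = φ u
  into : ∀ u, u = x ∨ φ u ∈ T → ψ u ∈ T

/-- The intermediate stage of a recoloring along a path: `φ` is the initial coloring, `x₀` the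
entering vertex, `ψ` the present coloring, and `x` has to get the color `c`. -/
structure Pending (n r : ℕ) (E : ℕ → ℕ → Prop) (φ acc : ℕ → ℕ) (x₀ : ℕ) (ψ : ℕ → ℕ)
    (x c : ℕ) : Prop where
  mem : c ∈ found n acc
  lt : x < n
  proper : ∀ u < n, ∀ w < n, u ≠ x → w ≠ x → E u w → ψ u < r → ψ u ≠ ψ w
  free : Free n E ψ x c
  card : ∀ d, #{u ∈ range n | u ≠ x ∧ ψ u = d} = #{u ∈ range n | u ≠ x₀ ∧ φ u = d}
  keep : ∀ u, u ≠ x₀ → φ u ∉ found n acc → ψ u = φ u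
  into : ∀ u, u = x₀ ∨ φ u ∈ found n acc → u ≠ x → ψ u ∈ found n acc
  orig : x = x₀ ∨ φ x ∈ found n acc
  low : ∀ d < n, acc d ≠ 0 → acc d ≤ acc c → φ x ≠ d ∧ ∀ u < n, ψ u = d ↔ φ u = d

theorem Pending.init {n r : ℕ} {E : ℕ → ℕ → Prop} {φ acc : ℕ → ℕ} {x c : ℕ} (hc : c ∈ found n acc)
    (hx : x < n) (hφ : φ x ∉ found n acc)
    (hproper : ∀ u < n, ∀ w < n, u ≠ x → w ≠ x → E u w → φ u < r → φ u ≠ φ w)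
    (hF : Free n E φ x c) : Pending n r E φ acc x φ x c where
  mem := hc
  lt := hx
  proper := hproper
  free := hF
  card _ := rfl
  keep _ _ _ := rfl
  into _ h h' := h.resolve_left h'
  orig := Or.inl rfl
  low _ hd hacc _ := ⟨fun h => hφ (h ▸ mem_found.2 ⟨hd, hacc⟩), fun _ _ => Iff.rfl⟩

/-! ### Passing a vertex along a path of classes -/

section

variable {n r : ℕ} {E : ℕ → ℕ → Prop} {φ al acc nxt wit : ℕ → ℕ} {root x₀ : ℕ} {ψ : ℕ → ℕ}
  {x c : ℕ}

theorem Pending.proper_update (h : Pending n r E φ acc x₀ ψ x c)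
    (hsymm : ∀ u < n, ∀ v < n, E u v → E v u) (hirr : ∀ u < n, ¬ E u u) :
    ∀ u < n, ∀ w < n, E u w → Function.update ψ x c u < r →
      Function.update ψ x c u ≠ Function.update ψ x c w := by
  intro u hu w hw hE hr
  by_cases hux : u = x
  · subst hux
    have hwu : w ≠ u := by rintro rfl; exact hirr _ hu hE
    rw [Function.update_self, Function.update_of_ne hwu]
    exact (h.free w hw hE).symm
  · by_cases hwx : w = x
    · subst hwx
      rw [Function.update_self, Function.update_of_ne hux]
      exact h.free u hu (hsymm _ hu _ hw hE)
    · rw [Function.update_of_ne hux] at hr ⊢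
      rw [Function.update_of_ne hwx]
      exact h.proper u hu w hw hux hwx hE hr

theorem Pending.card_update (h : Pending n r E φ acc x₀ ψ x c) (d : ℕ) :
    #(cls n (Function.update ψ x c) d) =
      #{u ∈ range n | u ≠ x₀ ∧ φ u = d} + if c = d then 1 else 0 := by
  rw [card_cls_eq _ h.lt, ← h.card, Function.update_self]
  congr 2
  refine filter_congr fun u _ => and_congr_right fun hu => ?_
  rw [Function.update_of_ne hu]

theorem Pending.keep_update (h : Pending n r E φ acc x₀ ψ x c) :
    ∀ u, u ≠ x₀ → φ u ∉ found n acc → Function.update ψ x c u = φ u := by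
  intro u hu hφ
  rw [Function.update_of_ne]
  · exact h.keep u hu hφ
  · rintro rfl
    exact h.orig.elim hu hφ

theorem Pending.into_update (h : Pending n r E φ acc x₀ ψ x c) :
    ∀ u, u = x₀ ∨ φ u ∈ found n acc → Function.update ψ x c u ∈ found n acc := by
  intro u hu
  by_cases hux : u = x
  · rw [hux, Function.update_self]; exact h.mem
  · rw [Function.update_of_ne hux]; exact h.into u hu hux

theorem Pending.finish (h : Pending n r E φ acc x₀ ψ x root)
    (hsymm : ∀ u < n, ∀ v < n, E u v → E v u) (hirr : ∀ u < n, ¬ E u u) :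
    Augmented n r E φ x₀ (found n acc) root (Function.update ψ x root) where
  proper := h.proper_update hsymm hirr
  card d := by rw [h.card_update]; simp [eq_comm]
  keep := h.keep_update
  into := h.into_update

/-- When `x` gets the color `c`, the witness of `c` becomes the vertex to be recolored. Its move is
still legal: `acc` decreases along the path, so the classes at or below the next one are the same as
in `φ`. -/
theorem Pending.step (h : Pending n r E φ acc x₀ ψ x c) (hT : Tree n E φ al acc nxt wit root)
    (hsymm : ∀ u < n, ∀ v < n, E u v → E v u) (hirr : ∀ u < n, ¬ E u u) (hc : c ≠ root) :
    Pending n r E φ acc x₀ (Function.update ψ x c) (wit c) (nxt c) ∧ acc (nxt c) < acc c := by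
  have hcm := mem_found.1 h.mem
  obtain ⟨h1, h2, h3, h4, h5, h6⟩ := hT.step c hcm.1 hcm.2 hc
  have hlow := h.low c hcm.1 hcm.2 le_rfl
  have hwx : wit c ≠ x := by
    intro he
    exact hlow.1 (he ▸ h5)
  have hlow' : ∀ d < n, acc d ≠ 0 → acc d ≤ acc (nxt c) → φ (wit c) ≠ d ∧
      ∀ u < n, Function.update ψ x c u = d ↔ φ u = d := by
    intro d hd hd0 hle
    have hdc : c ≠ d := by rintro rfl; omega
    refine ⟨by rwa [h5], fun u hu => ?_⟩
    have hl := h.low d hd hd0 (by omega)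
    by_cases hux : u = x
    · subst hux
      rw [Function.update_self]
      exact ⟨fun he => absurd he hdc, fun he => absurd he hl.1⟩
    · rw [Function.update_of_ne hux]
      exact hl.2 u hu
  refine ⟨?_, h3⟩
  constructor
  · exact mem_found.2 ⟨h1, h2⟩
  · exact h4
  · intro u hu w hw _ _ hE
    exact h.proper_update hsymm hirr u hu w hw hE
  · intro u hu hE he
    exact h6 u hu hE (((hlow' _ h1 h2 le_rfl).2 u hu).1 he)
  · intro d
    have e1 := h.card_update d
    rw [card_cls_eq _ h4, Function.update_of_ne hwx, (hlow.2 _ h4).2 h5] at e1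
    exact Nat.add_right_cancel e1
  · exact h.keep_update
  · intro u hu _
    exact h.into_update u hu
  · right; rw [h5]; exact h.mem
  · exact hlow'

end

/-! ## The invariant of the recoloring algorithm -/

/-- The active vertices at level `i`. -/
def verts (n : ℕ) (vl : ℕ → ℕ) (i : ℕ) : Finset ℕ := {v ∈ range n | i ≤ vl v}

/-- The active colors at level `i`. -/
def cols (r : ℕ) (cl : ℕ → ℕ) (i : ℕ) : Finset ℕ := {c ∈ range r | i ≤ cl c}

@[simp] theorem mem_verts {n : ℕ} {vl : ℕ → ℕ} {i v : ℕ} : v ∈ verts n vl i ↔ v < n ∧ i ≤ vl v := by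
  simp [verts]

@[simp] theorem mem_cols {r : ℕ} {cl : ℕ → ℕ} {i c : ℕ} : c ∈ cols r cl i ↔ c < r ∧ i ≤ cl c := by
  simp [cols]

/-- The colors below `r` form a partial proper coloring with classes of size at most `k`; for each
level up to `m`, the active colors of that level are used by active vertices only, and these
vertices have few active neighbors. -/
structure Inv (n r k : ℕ) (E : ℕ → ℕ → Prop) (φ vl cl : ℕ → ℕ) (m : ℕ) : Prop where
  proper : ∀ u < n, ∀ v < n, E u v → φ u < r → φ u ≠ φ v
  size : ∀ c < r, #(cls n φ c) ≤ k
  act : ∀ v < n, φ v < r → ∀ i ≤ m, (i ≤ vl v ↔ i ≤ cl (φ v))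
  deg : ∀ i ≤ m, ∀ v ∈ verts n vl i, ∀ [DecidablePred (E v)],
    #{u ∈ verts n vl i | E v u} < #(cols r cl i)
  large : ∀ i ≤ m, #(cols r cl i) * (k + 1) ≤ #(verts n vl i)

/-- The potential: every missing vertex of a class counts with the number of active colors at the
level of the class. -/
def pot (n r k : ℕ) (φ cl : ℕ → ℕ) (m : ℕ) : ℕ :=
  ∑ c ∈ range r, #(cols r cl (min (cl c) m)) * (k - #(cls n φ c))

theorem Inv.pop {n r k : ℕ} {E : ℕ → ℕ → Prop} {φ vl cl : ℕ → ℕ} {m : ℕ}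
    (h : Inv n r k E φ vl cl m) : Inv n r k E φ vl cl (m - 1) where
  proper := h.proper
  size := h.size
  act v hv hφ i hi := h.act v hv hφ i (by omega)
  deg i hi := h.deg i (by omega)
  large i hi := h.large i (by omega)

/-- The weight changes only for colors of level at least `m`, and by assumption their classes miss
no vertex. -/
theorem pot_pop {n r k : ℕ} {φ cl : ℕ → ℕ} {m : ℕ}
    (hm : ∀ c ∈ cols r cl m, k ≤ #(cls n φ c)) : pot n r k φ cl (m - 1) = pot n r k φ cl m := by
  refine sum_congr rfl fun c hc => ?_
  by_cases hcm : m ≤ cl c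
  · rw [Nat.sub_eq_zero_of_le (hm c (mem_cols.2 ⟨mem_range.1 hc, hcm⟩)), mul_zero, mul_zero]
  · rw [min_eq_left (by omega : cl c ≤ m - 1), min_eq_left (by omega : cl c ≤ m)]

theorem pot_eq_zero {n r k : ℕ} {φ cl : ℕ → ℕ}
    (hm : ∀ c ∈ cols r cl 0, k ≤ #(cls n φ c)) : pot n r k φ cl 0 = 0 := by
  refine sum_eq_zero fun c hc => ?_
  rw [Nat.sub_eq_zero_of_le (hm c (mem_cols.2 ⟨mem_range.1 hc, Nat.zero_le _⟩)), mul_zero]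

/-- All weights are positive, because a color is active at its own level. -/
theorem le_card_of_pot_eq_zero {n r k : ℕ} {φ cl : ℕ → ℕ} {m : ℕ} (h : pot n r k φ cl m = 0) :
    ∀ c < r, k ≤ #(cls n φ c) := by
  intro c hc
  have := (sum_eq_zero_iff.1 h) c (mem_range.2 hc)
  rw [mul_eq_zero] at this
  rcases this with h | h
  · rw [card_eq_zero] at h
    have : c ∈ cols r cl (min (cl c) m) := mem_cols.2 ⟨hc, min_le_left _ _⟩
    rw [h] at this
    simp at this
  · omega

/-- The coloring `ψ` differs from `φ` at active vertices only. -/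
structure Recolored (n r k : ℕ) (E : ℕ → ℕ → Prop) (φ vl cl : ℕ → ℕ) (m : ℕ) (ψ : ℕ → ℕ) :
    Prop where
  proper : ∀ u < n, ∀ v < n, E u v → ψ u < r → ψ u ≠ ψ v
  size : ∀ c < r, #(cls n ψ c) ≤ k
  off : ∀ v < n, ¬ m ≤ vl v → ψ v = φ v
  on : ∀ v < n, m ≤ vl v → ψ v < r → m ≤ cl (ψ v)

/-! ### Effect of recolorings on the invariant and the potential -/

section

variable {n r k : ℕ} {E : ℕ → ℕ → Prop} {φ vl cl : ℕ → ℕ} {m : ℕ} {ψ : ℕ → ℕ}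

theorem Recolored.inv (h : Recolored n r k E φ vl cl m ψ) (hI : Inv n r k E φ vl cl m) :
    Inv n r k E ψ vl cl m where
  proper := h.proper
  size := h.size
  act v hv hψ i hi := by
    by_cases hvm : m ≤ vl v
    · have := h.on v hv hvm hψ
      omega
    · rw [h.off v hv hvm] at hψ ⊢
      exact hI.act v hv hψ i hi
  deg := hI.deg
  large := hI.large

theorem Recolored.cls_eq (h : Recolored n r k E φ vl cl m ψ) (hI : Inv n r k E φ vl cl m) {c : ℕ}
    (hc : c < r) (hcm : ¬ m ≤ cl c) : cls n ψ c = cls n φ c := by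
  ext v
  simp only [mem_cls]
  refine and_congr_right fun hv => ?_
  by_cases hvm : m ≤ vl v
  · constructor
    · rintro rfl
      exact absurd (h.on v hv hvm hc) hcm
    · rintro rfl
      exact absurd ((hI.act v hv hc m le_rfl).1 hvm) hcm
  · rw [h.off v hv hvm]

/-- The recolored vertices after an augmentation. -/
theorem Augmented.recolored {φ' : ℕ → ℕ} {x root : ℕ} {T : Finset ℕ}
    (h : Augmented n r E φ' x T root ψ) (hI : Inv n r k E φ vl cl m)
    (hoff : ∀ v < n, ¬ m ≤ vl v → φ' v = φ v) (hon : ∀ v < n, m ≤ vl v → φ' v < r → m ≤ cl (φ' v))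
    (hx : m ≤ vl x) (hT : T ⊆ cols r cl m)
    (hsize : ∀ c < r, #{u ∈ range n | u ≠ x ∧ φ' u = c} ≤ k)
    (hroot : #{u ∈ range n | u ≠ x ∧ φ' u = root} < k) :
    Recolored n r k E φ vl cl m ψ where
  proper := h.proper
  size c hc := by
    rw [h.card]
    split_ifs with he
    · rw [he]; exact hroot
    · exact hsize c hc
  off v hv hvm := by
    rw [h.keep v (by rintro rfl; exact hvm hx), hoff v hv hvm]
    rw [hoff v hv hvm]
    intro hφ
    have := mem_cols.1 (hT hφ)
    exact hvm ((hI.act v hv this.1 m le_rfl).2 this.2)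
  on v hv hvm hψ := by
    by_cases hvT : v = x ∨ φ' v ∈ T
    · exact (mem_cols.1 (hT (h.into v hvT))).2
    · push Not at hvT
      rw [h.keep v hvT.1 hvT.2] at hψ ⊢
      exact hon v hv hvm hψ

/-- An augmentation at an uncolored active vertex lowers the potential. -/
theorem Augmented.grow {x root : ℕ} {T : Finset ℕ} (h : Augmented n r E φ x T root ψ)
    (hI : Inv n r k E φ vl cl m) (hxn : x < n) (hx : m ≤ vl x) (hφ : r ≤ φ x)
    (hT : T ⊆ cols r cl m) (hr : root ∈ T) (hroot : #(cls n φ root) < k) :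
    Inv n r k E ψ vl cl m ∧ pot n r k ψ cl m < pot n r k φ cl m := by
  have hcls : ∀ c < r, #{u ∈ range n | u ≠ x ∧ φ u = c} = #(cls n φ c) := fun c hc => by
    rw [card_cls_eq φ hxn, if_neg (by omega), add_zero]
  have hrootr := mem_cols.1 (hT hr)
  have hR : Recolored n r k E φ vl cl m ψ := by
    refine h.recolored hI (fun _ _ _ => rfl) (fun v hv hvm hr => (hI.act v hv hr m le_rfl).1 hvm)
      hx hT (fun c hc => ?_) ?_
    · rw [hcls c hc]; exact hI.size c hc
    · rwa [hcls _ hrootr.1]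
  refine ⟨hR.inv hI, sum_lt_sum (fun c hc => ?_) ⟨root, mem_range.2 hrootr.1, ?_⟩⟩
  · rw [h.card, hcls c (mem_range.1 hc)]
    exact Nat.mul_le_mul_left _ (by omega)
  · rw [h.card, hcls _ hrootr.1, if_pos rfl]
    refine Nat.mul_lt_mul_of_pos_left (by omega) (card_pos.2 ⟨root, ?_⟩)
    exact mem_cols.2 ⟨hrootr.1, min_le_left _ _⟩

/-- The number of vertices with a color in `D`. -/
def cov (n : ℕ) (φ : ℕ → ℕ) (D : Finset ℕ) : ℕ := #{v ∈ range n | φ v ∈ D}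

theorem cov_eq_sum (D : Finset ℕ) : cov n φ D = ∑ c ∈ D, #(cls n φ c) := by
  rw [cov, card_eq_sum_card_fiberwise (f := φ) (t := D) (s := {v ∈ range n | φ v ∈ D})
    (fun v hv => (mem_filter.1 hv).2)]
  refine sum_congr rfl fun c hc => congrArg card ?_
  ext v
  simp only [mem_filter, mem_range, mem_cls]
  constructor
  · rintro ⟨⟨h1, -⟩, h2⟩; exact ⟨h1, h2⟩
  · rintro ⟨h1, h2⟩; exact ⟨⟨h1, h2 ▸ hc⟩, h2⟩

theorem sum_deficit_add_cov {D : Finset ℕ} (h : ∀ c ∈ D, #(cls n φ c) ≤ k) :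
    ∑ c ∈ D, (k - #(cls n φ c)) + cov n φ D = #D * k := by
  rw [cov_eq_sum, ← sum_add_distrib, ← smul_eq_mul, ← sum_const]
  exact sum_congr rfl fun c hc => Nat.sub_add_cancel (h c hc)

/-- The levels after the classes in `A` are settled. -/
def pushLevel (cl : ℕ → ℕ) (m : ℕ) (P : ℕ → Prop) [DecidablePred P] (c : ℕ) : ℕ :=
  if m ≤ cl c then (if P c then m else m + 1) else cl c

theorem le_pushLevel {P : ℕ → Prop} [DecidablePred P] {i c : ℕ} (hi : i ≤ m) :
    i ≤ pushLevel cl m P c ↔ i ≤ cl c := by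
  rw [pushLevel]; split_ifs <;> omega

theorem succ_le_pushLevel {P : ℕ → Prop} [DecidablePred P] {c : ℕ} :
    m + 1 ≤ pushLevel cl m P c ↔ m ≤ cl c ∧ ¬ P c := by
  rw [pushLevel]; split_ifs <;> simp_all; omega

/-- A vertex that remains active lies outside `A` already under `φ`, so discarding the classes of
`A` removes at least `#A` of its neighbors, as many as there are colors removed. The vertex `z` is
hidden because in an exchange of two vertices it leaves `A` uncolored, and `hnbr` tells nothing
about it. In the potential, the vertex gained by `A` weighs `#Q`, whereas the `e` vertices lost by
the other classes weigh `#Q - #A` each at the new level. -/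
theorem Inv.push {A : Finset ℕ} {z e : ℕ} {c₀ : ℕ} (hI : Inv n r k E φ vl cl m)
    (hR : Recolored n r k E φ vl cl m ψ) (hA : A ⊆ cols r cl m) (hc₀ : c₀ ∈ A)
    (hcard : cov n ψ A = cov n φ A + 1)
    (he : cov n φ (cols r cl m \ A) ≤ cov n ψ (cols r cl m \ A) + e)
    (he' : e ≤ 1 ∨ e ≤ 2 ∧ 2 * (#(cols r cl m) - #A) + 1 ≤ #(cols r cl m))
    (hz : ψ z < r → ψ z ∈ A)
    (hB : ∀ v < n, m ≤ vl v → v ≠ z → ψ v ∉ A → φ v ∉ A)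
    (hnbr : ∀ y ∈ verts n vl m, φ y ∉ A → ∀ c ∈ A, ∃ u < n, E y u ∧ φ u = c) :
    Inv n r k E ψ (pushLevel vl m fun v => ψ v ∈ A ∨ v = z) (pushLevel cl m (· ∈ A)) (m + 1) ∧
      pot n r k ψ (pushLevel cl m (· ∈ A)) (m + 1) < pot n r k φ cl m := by
  classical
  have hI' := hR.inv hI
  set Q := cols r cl m with hQ
  have hAQ : #A ≤ #Q := card_le_card hA
  have hApos : 0 < #A := card_pos.2 ⟨c₀, hc₀⟩
  have hcols : ∀ i ≤ m, cols r (pushLevel cl m (· ∈ A)) i = cols r cl i := fun i hi => by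
    ext c; simp only [mem_cols, le_pushLevel hi]
  have hverts : ∀ i ≤ m, verts n (pushLevel vl m fun v => ψ v ∈ A ∨ v = z) i = verts n vl i :=
    fun i hi => by ext c; simp only [mem_verts, le_pushLevel hi]
  have hcols' : cols r (pushLevel cl m (· ∈ A)) (m + 1) = Q \ A := by
    ext c; simp only [mem_cols, succ_le_pushLevel, hQ, mem_sdiff]; tauto
  have hverts' : ∀ v, v ∈ verts n (pushLevel vl m fun v => ψ v ∈ A ∨ v = z) (m + 1) ↔
      v ∈ verts n vl m ∧ ψ v ∉ A ∧ v ≠ z := fun v => by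
    simp only [mem_verts, succ_le_pushLevel]; tauto
  have hQA : #(Q \ A) = #Q - #A := card_sdiff_of_subset hA
  have hsize : ∀ c ∈ Q, #(cls n φ c) ≤ k ∧ #(cls n ψ c) ≤ k := fun c hc =>
    ⟨hI.size c (mem_cols.1 hc).1, hR.size c (mem_cols.1 hc).1⟩
  have hact : ∀ v < n, φ v ∈ A → v ∈ verts n vl m := fun v hv hφ => by
    have := mem_cols.1 (hA hφ)
    exact mem_verts.2 ⟨hv, (hI.act v hv this.1 m le_rfl).2 this.2⟩
  constructor
  · refine ⟨hR.proper, hR.size, ?_, ?_, ?_⟩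
    · intro v hv hψ i hi
      rcases Nat.lt_or_ge m i with h | h
      · obtain rfl : i = m + 1 := by omega
        rw [succ_le_pushLevel, succ_le_pushLevel, ← hI'.act v hv hψ m le_rfl]
        refine and_congr_right fun _ => not_congr (or_iff_left_of_imp ?_)
        rintro rfl
        exact hz hψ
      · rw [le_pushLevel h, le_pushLevel h]
        exact hI'.act v hv hψ i h
    · intro i hi
      rcases Nat.lt_or_ge m i with h | h
      · obtain rfl : i = m + 1 := by omega
        intro v hv _
        rw [hverts'] at hv
        have hvn := mem_verts.1 hv.1
        have hφv : φ v ∉ A := hB v hvn.1 hvn.2 hv.2.2 hv.2.1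
        rw [hcols', hQA]
        have h1 := hI.deg m le_rfl v hv.1
        rw [← hQ] at h1
        rw [card_filter_eq_add_sum (φ := φ) (A := A) (E v) (fun v hv => (mem_verts.1 hv).1)
          hact] at h1
        have h2 : #A ≤ ∑ c ∈ A, #{u ∈ cls n φ c | E v u} := by
          rw [card_eq_sum_ones]
          refine sum_le_sum fun c hc => ?_
          obtain ⟨u, hu, hE, hφ⟩ := hnbr v hv.1 hφv c hc
          rw [Nat.one_le_iff_ne_zero, card_ne_zero]
          exact ⟨u, by simp [hu, hE, hφ]⟩
        have h3 : #{u ∈ verts n (pushLevel vl m fun v => ψ v ∈ A ∨ v = z) (m + 1) | E v u} ≤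
            #{u ∈ {u ∈ verts n vl m | φ u ∉ A} | E v u} := by
          refine card_le_card fun u hu => ?_
          rw [mem_filter, hverts'] at hu
          have hun := mem_verts.1 hu.1.1
          rw [mem_filter, mem_filter]
          exact ⟨⟨hu.1.1, hB u hun.1 hun.2 hu.1.2.2 hu.1.2.1⟩, hu.2⟩
        omega
      · rw [hcols i h, hverts i h]
        exact hI.deg i h
    · intro i hi
      rcases Nat.lt_or_ge m i with h | h
      · obtain rfl : i = m + 1 := by omega
        rw [hcols', hQA]
        -- `large` provides `k + 1` vertices per color, but a settled class takes at most `k`. As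
        -- `A` is nonempty, at least one vertex is to spare, and it pays for `z`.
        have h1 : verts n vl m ⊆ insert z (verts n (pushLevel vl m fun v => ψ v ∈ A ∨ v = z) (m + 1)
            ∪ {v ∈ range n | ψ v ∈ A}) := by
          intro v hv
          rw [mem_insert, mem_union, hverts', mem_filter, mem_range]
          have := (mem_verts.1 hv).1
          tauto
        have h2 := (card_le_card h1).trans (card_insert_le _ _)
        have h3 := h2.trans (Nat.succ_le_succ (card_union_le _ _))
        have h4 : cov n ψ A ≤ #A * k := by
          have := sum_deficit_add_cov (n := n) (φ := ψ) (k := k) (D := A)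
            fun c hc => (hsize c (hA hc)).2
          omega
        have h5 := hI.large m le_rfl
        rw [cov] at h4
        rw [Nat.sub_mul]
        have h6 : #A * (k + 1) = #A * k + #A := by ring
        have h7 := Nat.mul_le_mul_right (k + 1) hAQ
        rw [← hQ] at h5
        omega
      · rw [hcols i h, hverts i h]
        exact hI.large i h
  · have hQr : Q ⊆ range r := filter_subset _ _
    have hsplit : ∀ f : ℕ → ℕ, ∑ c ∈ range r, f c =
        ∑ c ∈ range r \ Q, f c + (∑ c ∈ A, f c + ∑ c ∈ Q \ A, f c) := fun f => by
      rw [add_comm (∑ c ∈ A, f c), sum_sdiff hA, 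
        sum_sdiff hQr]
    rw [pot, pot, hsplit, hsplit]
    have e0 : ∑ c ∈ range r \ Q, #(cols r (pushLevel cl m (· ∈ A))
        (min (pushLevel cl m (· ∈ A) c) (m + 1))) * (k - #(cls n ψ c)) =
        ∑ c ∈ range r \ Q, #(cols r cl (min (cl c) m)) * (k - #(cls n φ c)) := by
      refine sum_congr rfl fun c hc => ?_
      rw [mem_sdiff, mem_range, hQ, mem_cols] at hc
      have hcm : ¬ m ≤ cl c := fun h => hc.2 ⟨hc.1, h⟩
      rw [pushLevel, if_neg hcm, min_eq_left (by omega), min_eq_left (by omega),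
        hcols _ (by omega), hR.cls_eq hI hc.1 hcm]
    have e1 : ∑ c ∈ A, #(cols r (pushLevel cl m (· ∈ A))
        (min (pushLevel cl m (· ∈ A) c) (m + 1))) * (k - #(cls n ψ c)) =
        #Q * ∑ c ∈ A, (k - #(cls n ψ c)) := by
      rw [mul_sum]
      refine sum_congr rfl fun c hc => ?_
      rw [pushLevel, if_pos (mem_cols.1 (hA hc)).2, if_pos hc, min_eq_left (by omega),
        hcols m le_rfl]
    have e2 : ∑ c ∈ Q \ A, #(cols r (pushLevel cl m (· ∈ A))
        (min (pushLevel cl m (· ∈ A) c) (m + 1))) * (k - #(cls n ψ c)) =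
        (#Q - #A) * ∑ c ∈ Q \ A, (k - #(cls n ψ c)) := by
      rw [mul_sum]
      refine sum_congr rfl fun c hc => ?_
      rw [mem_sdiff] at hc
      rw [pushLevel, if_pos (mem_cols.1 hc.1).2, if_neg hc.2, min_self, hcols', hQA]
    have e3 : ∀ D ⊆ Q, ∑ c ∈ D, #(cols r cl (min (cl c) m)) * (k - #(cls n φ c)) =
        #Q * ∑ c ∈ D, (k - #(cls n φ c)) := by
      intro D hD
      rw [mul_sum]
      refine sum_congr rfl fun c hc => ?_
      rw [min_eq_right (mem_cols.1 (hD hc)).2]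
    rw [e0, e1, e2, e3 A hA, e3 _ sdiff_subset]
    have d1 := sum_deficit_add_cov (n := n) (φ := φ) (k := k) fun c hc => (hsize c (hA hc)).1
    have d2 := sum_deficit_add_cov (n := n) (φ := ψ) (k := k) fun c hc => (hsize c (hA hc)).2
    have d3 := sum_deficit_add_cov (n := n) (φ := φ) (k := k) (D := Q \ A)
      fun c hc => (hsize c (mem_sdiff.1 hc).1).1
    have d4 := sum_deficit_add_cov (n := n) (φ := ψ) (k := k) (D := Q \ A)
      fun c hc => (hsize c (mem_sdiff.1 hc).1).2
    generalize ∑ c ∈ A, (k - #(cls n φ c)) = a at *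
    generalize ∑ c ∈ A, (k - #(cls n ψ c)) = a' at *
    generalize ∑ c ∈ Q \ A, (k - #(cls n φ c)) = b at *
    generalize ∑ c ∈ Q \ A, (k - #(cls n ψ c)) = b' at *
    obtain ⟨q, hq⟩ : ∃ q, #Q - #A = q := ⟨_, rfl⟩
    rw [hq] at he' ⊢
    have ha : a = a' + 1 := by omega
    have hb : b' ≤ b + e := by omega
    have hqQ : q < #Q := by omega
    refine Nat.add_lt_add_left ?_ _
    have f1 : q * b' ≤ q * (b + e) := Nat.mul_le_mul_left _ hb
    have f2 : q * b ≤ #Q * b := Nat.mul_le_mul_right _ hqQ.le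
    have f3 : q * e < #Q := by
      rcases he' with h | ⟨h, h'⟩
      · calc q * e ≤ q * 1 := Nat.mul_le_mul_left _ h
          _ < #Q := by omega
      · calc q * e ≤ q * 2 := Nat.mul_le_mul_left _ h
          _ < #Q := by omega
    rw [ha]
    rw [mul_add] at f1 ⊢
    omega

end

end MaxMin

/-! ### Exchanges between accessible classes and the outside -/

namespace MaxMin

open Finset Relation

theorem Tree.congr {n : ℕ} {E : ℕ → ℕ → Prop} {φ φ' al acc nxt wit : ℕ → ℕ} {root : ℕ}
    (h : Tree n E φ al acc nxt wit root)
    (hφ : ∀ c < n, acc c ≠ 0 → ∀ u < n, φ' u = c ↔ φ u = c) :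
    Tree n E φ' al acc nxt wit root where
  root_lt := h.root_lt
  root_mem := h.root_mem
  mem := h.mem
  le := h.le
  step c hc h0 hr := by
    obtain ⟨h1, h2, h3, h4, h5, h6⟩ := h.step c hc h0 hr
    exact ⟨h1, h2, h3, h4, (hφ c hc h0 _ h4).2 h5, fun u hu hE he =>
      h6 u hu hE ((hφ _ h1 h2 u hu).1 he)⟩

/-- The coloring `ψ` completes a step in which the classes in `A` gain a vertex. -/
structure Ready (n r k : ℕ) (E : ℕ → ℕ → Prop) (φ vl cl : ℕ → ℕ) (m : ℕ) (A : Finset ℕ) (z : ℕ)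
    (ψ : ℕ → ℕ) : Prop where
  recolored : Recolored n r k E φ vl cl m ψ
  cov_eq : cov n ψ A = cov n φ A + 1
  cov_le : ∃ e, cov n φ (cols r cl m \ A) ≤ cov n ψ (cols r cl m \ A) + e ∧
    (e ≤ 1 ∨ e ≤ 2 ∧ 2 * (#(cols r cl m) - #A) + 1 ≤ #(cols r cl m))
  hidden : ψ z < r → ψ z ∈ A
  outside : ∀ v < n, m ≤ vl v → v ≠ z → ψ v ∉ A → φ v ∉ A

/-- The coloring `φ'` arises from `φ` by giving the color `W` of `z` to solo neighbors `Y` of `z`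
and removing `z` and `x` from this class; the vertex `x` is to be recolored next. -/
structure Swap (n r : ℕ) (E : ℕ → ℕ → Prop) (φ : ℕ → ℕ) (S A : Finset ℕ) (W z x : ℕ) (Y : Finset ℕ)
    (φ' : ℕ → ℕ) : Prop where
  mem : W ∈ A
  z_lt : z < n
  z_col : φ z = W
  x_lt : x < n
  x_col : φ x = W
  solo : ∀ y ∈ Y, y ∈ S ∧ φ y ∉ A ∧ Solo n E φ y z
  indep : ∀ y ∈ Y, ∀ y' ∈ Y, ¬ E y y'
  card : #Y = #{z, x}
  new : ∀ y ∈ Y, φ' y = W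
  old : ∀ u, u ∉ Y → u ≠ z → φ' u = φ u
  z_new : z = x ∧ φ' z = W ∨ r ≤ φ' z

section

variable {n r k : ℕ} {E : ℕ → ℕ → Prop} {φ vl cl : ℕ → ℕ} {m : ℕ} {S A : Finset ℕ} {W z x : ℕ}
  {Y : Finset ℕ} {φ' : ℕ → ℕ}

theorem Swap.notMem (h : Swap n r E φ S A W z x Y φ') {u : ℕ} (hu : φ u ∈ A) : u ∉ Y :=
  fun hY => (h.solo u hY).2.1 hu

/-- The only neighbor of `y ∈ Y` in `W` is `z`, and `z` is either the exempted vertex `x` or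
uncolored. The vertices of `Y` are independent of each other. -/
theorem Swap.proper (h : Swap n r E φ S A W z x Y φ')
    (hsymm : ∀ u < n, ∀ v < n, E u v → E v u)
    (hφ : ∀ u < n, ∀ v < n, E u v → φ u < r → φ u ≠ φ v) :
    ∀ u < n, ∀ w < n, u ≠ x → w ≠ x → E u w → φ' u < r → φ' u ≠ φ' w := by
  intro u hu w hw hux hwx hE hr he
  have hzr : z ≠ x → r ≤ φ' z := fun hz => h.z_new.resolve_left fun h => hz h.1
  by_cases huz : u = z
  · subst huz
    have := hzr hux
    omega
  by_cases hwz : w = z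
  · subst hwz
    have := hzr hwx
    omega
  by_cases huY : u ∈ Y
  · by_cases hwY : w ∈ Y
    · exact h.indep u huY w hwY hE
    · rw [h.new u huY, h.old w hwY hwz] at he
      exact hwz ((h.solo u huY).2.2.2 w hw hE (he.symm.trans h.z_col.symm))
  · by_cases hwY : w ∈ Y
    · rw [h.new w hwY, h.old u huY huz] at he
      exact huz ((h.solo w hwY).2.2.2 u hu (hsymm u hu w hw hE) (he.trans h.z_col.symm))
    · rw [h.old u huY huz] at he hr
      rw [h.old w hwY hwz] at he
      exact hφ u hu w hw hE hr he

theorem Swap.of_eq (h : Swap n r E φ S A W z x Y φ') {c u : ℕ} (hc : c < r) (hcW : c ≠ W)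
    (hu : φ' u = c) : φ u = c := by
  by_cases huY : u ∈ Y
  · exact absurd (hu.symm.trans (h.new u huY)) hcW
  · by_cases huz : u = z
    · subst huz
      rcases h.z_new with h | h
      · exact absurd (hu.symm.trans h.2) hcW
      · omega
    · rwa [h.old u huY huz] at hu

theorem Swap.eq_iff (h : Swap n r E φ S A W z x Y φ') (hA : A ⊆ cols r cl m) {c u : ℕ} (hc : c ∈ A)
    (hcW : c ≠ W) : φ' u = c ↔ φ u = c := by
  refine ⟨h.of_eq (mem_cols.1 (hA hc)).1 hcW, fun hu => ?_⟩
  rw [h.old u (h.notMem (hu ▸ hc))]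
  · exact hu
  · rintro rfl
    exact hcW (hu.symm.trans h.z_col)

/-- The vertices of `Y` replace `z` and `x` one for one, so the count is balanced before `x` is
placed again. -/
theorem Swap.card_filter (h : Swap n r E φ S A W z x Y φ') (hS : ∀ v ∈ S, v < n)
    (hA : A ⊆ cols r cl m) {D : Finset ℕ} (hD : D ⊆ A) (hW : W ∈ D) :
    #{u ∈ range n | u ≠ x ∧ φ' u ∈ D} = #{u ∈ range n | φ u ∈ D} := by
  have hset : ({u ∈ range n | u ≠ x ∧ φ' u ∈ D} : Finset ℕ) =
      ({u ∈ range n | φ u ∈ D} \ {z, x}) ∪ Y := by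
    ext u
    simp only [mem_filter, mem_union, mem_sdiff, mem_insert, mem_singleton, mem_range]
    by_cases huY : u ∈ Y
    · have hs := h.solo u huY
      have hux : u ≠ x := by
        rintro rfl
        exact hs.2.1 (h.x_col ▸ h.mem)
      simp [huY, hS u hs.1, hux, h.new u huY, hW]
    · by_cases huz : u = z
      · subst huz
        simp only [huY, true_or, not_true, and_false, or_false, iff_false]
        rintro ⟨-, hux, hu⟩
        have := h.z_new.resolve_left fun h => hux h.1
        have := (mem_cols.1 (hA (hD hu))).1
        omega
      · simp only [huY, huz, h.old u huY huz]
        tauto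
  rw [hset, card_union_of_disjoint, card_sdiff_of_subset, h.card]
  · apply Nat.sub_add_cancel
    apply card_le_card
    intro u hu
    rw [mem_insert, mem_singleton] at hu
    rcases hu with rfl | rfl
    · simp [h.z_lt, h.z_col, hW]
    · simp [h.x_lt, h.x_col, hW]
  · intro u hu
    rw [mem_insert, mem_singleton] at hu
    rcases hu with rfl | rfl
    · simp [h.z_lt, h.z_col, hW]
    · simp [h.x_lt, h.x_col, hW]
  · rw [disjoint_left]
    intro u hu huY
    rw [mem_sdiff, mem_filter] at hu
    exact h.notMem (hD hu.1.2) huY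

theorem Swap.ready {T : Finset ℕ} {root : ℕ} {ψ : ℕ → ℕ}
    (h : Swap n r E φ (verts n vl m) A W z x Y φ') (hI : Inv n r k E φ vl cl m)
    (hψ : Augmented n r E φ' x T root ψ) (hA : A ⊆ cols r cl m) (hT : T ⊆ A) (hWT : W ∉ T)
    (hroot : root ∈ T) (hsmall : #(cls n φ root) < k)
    (hY : #Y ≤ 1 ∨ 2 * (#(cols r cl m) - #A) + 1 ≤ #(cols r cl m)) :
    Ready n r k E φ vl cl m A z ψ := by
  have hlt : ∀ v ∈ verts n vl m, v < n := fun v hv => (mem_verts.1 hv).1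
  have hactive : ∀ u < n, φ u ∈ A → m ≤ vl u := fun u hu hφ => by
    have := mem_cols.1 (hA hφ)
    exact (hI.act u hu this.1 m le_rfl).2 this.2
  have hzm := hactive z h.z_lt (h.z_col ▸ h.mem)
  have hxm := hactive x h.x_lt (h.x_col ▸ h.mem)
  have hWQ := mem_cols.1 (hA h.mem)
  have hle : ∀ c < r, c ≠ W → #{u ∈ range n | u ≠ x ∧ φ' u = c} ≤ #(cls n φ c) := by
    intro c hc hcW
    refine card_le_card fun u hu => ?_
    rw [mem_filter, mem_range] at hu
    exact mem_cls.2 ⟨hu.1, h.of_eq hc hcW hu.2.2⟩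
  have hrec : Recolored n r k E φ vl cl m ψ := by
    refine hψ.recolored hI ?_ ?_ hxm (hT.trans hA) ?_ ?_
    · intro v hv hvm
      refine h.old v (fun hY => hvm (mem_verts.1 (h.solo v hY).1).2) ?_
      rintro rfl
      exact hvm hzm
    · intro v hv hvm hr
      by_cases hvY : v ∈ Y
      · rw [h.new v hvY]; exact hWQ.2
      · by_cases hvz : v = z
        · subst hvz
          rcases h.z_new with h | h
          · rw [h.2]; exact hWQ.2
          · omega
        · rw [h.old v hvY hvz] at hr ⊢
          exact (hI.act v hv hr m le_rfl).1 hvm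
    · intro c hc
      by_cases hcW : c = W
      · have := h.card_filter hlt hA (singleton_subset_iff.2 h.mem) (mem_singleton_self W)
        simp only [mem_singleton] at this
        rw [hcW, this]
        exact hI.size W hWQ.1
      · exact (hle c hc hcW).trans (hI.size c hc)
    · refine (hle root (mem_cols.1 (hA (hT hroot))).1 ?_).trans_lt hsmall
      rintro rfl
      exact hWT hroot
  have hkeep : ∀ u, u ≠ x → φ' u ∉ A → ψ u = φ' u := fun u hux hu =>
    hψ.keep u hux fun h => hu (hT h)
  have hiff : ∀ u, ψ u ∈ A ↔ u = x ∨ φ' u ∈ A := by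
    intro u
    by_cases huT : u = x ∨ φ' u ∈ T
    · simp only [hT (hψ.into u huT), true_iff]
      exact huT.imp id fun h => hT h
    · push Not at huT
      simp only [hψ.keep u huT.1 huT.2, huT.1, false_or]
  -- Placing `x` again gives `A` its additional vertex. Only members of `Y` leave the classes
  -- outside `A`, so the loss is at most `#Y`.
  refine ⟨hrec, ?_, ⟨#Y, ?_, ?_⟩, ?_, ?_⟩
  · have h1 := h.card_filter hlt hA subset_rfl h.mem
    rw [cov, cov, ← h1]
    have : ({v ∈ range n | ψ v ∈ A} : Finset ℕ) =
        insert x {u ∈ range n | u ≠ x ∧ φ' u ∈ A} := by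
      ext u
      rw [mem_insert, mem_filter, mem_filter, hiff, mem_range]
      by_cases hux : u = x
      · subst hux; simp [h.x_lt]
      · simp [hux]
    rw [this, card_insert_of_notMem (by simp)]
  · rw [cov, cov]
    refine (card_le_card fun u hu => ?_).trans (card_union_le _ _)
    rw [mem_filter, mem_sdiff] at hu
    rw [mem_union, mem_filter, mem_sdiff]
    by_cases huY : u ∈ Y
    · exact Or.inr huY
    · left
      have huz : u ≠ z := by rintro rfl; exact hu.2.2 (h.z_col ▸ h.mem)
      have hux : u ≠ x := by rintro rfl; exact hu.2.2 (h.x_col ▸ h.mem)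
      have he := h.old u huY huz
      rw [hkeep u hux (by rw [he]; exact hu.2.2), he]
      exact hu
  · have : #Y ≤ 2 := h.card ▸ card_le_two
    tauto
  · intro hr
    rw [hiff]
    by_contra hcon
    push Not at hcon
    rw [hkeep z hcon.1 hcon.2] at hr
    rcases h.z_new with h | h
    · exact hcon.1 h.1
    · omega
  · intro v hv hvm hvz hvA hφA
    rw [hiff] at hvA
    push Not at hvA
    rw [h.old v (h.notMem hφA) hvz] at hvA
    exact hvA.2 hφA

/-- The search avoided `W`, and the exchange alters no other accessible class. Hence the search tree
found for `φ` is still valid for `φ'`. -/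
theorem Swap.pending {acc al nxt wit : ℕ → ℕ} {root c : ℕ}
    (h : Swap n r E φ (verts n vl m) A W z x Y φ') (hI : Inv n r k E φ vl cl m)
    (hsymm : ∀ u < n, ∀ v < n, E u v → E v u) (hA : A ⊆ cols r cl m) (hT : found n acc ⊆ A)
    (hWT : W ∉ found n acc) (htree : Tree n E φ al acc nxt wit root) (hc : c ∈ found n acc)
    (hF : Free n E φ x c) :
    Tree n E φ' al acc nxt wit root ∧ Pending n r E φ' acc x φ' x c := by
  have hne : ∀ d ∈ found n acc, d ≠ W := by rintro d hd rfl; exact hWT hd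
  refine ⟨htree.congr fun d hd hd0 u hu => ?_, Pending.init hc h.x_lt ?_
    (h.proper hsymm hI.proper) ?_⟩
  · have hd := mem_found.2 ⟨hd, hd0⟩
    exact h.eq_iff hA (hT hd) (hne d hd)
  · by_cases hxz : x = z
    · rcases h.z_new with h' | h'
      · rw [hxz, h'.2]; exact hWT
      · intro hd
        have := (mem_cols.1 (hA (hT hd))).1
        rw [hxz] at this
        omega
    · rw [h.old x (h.notMem (h.x_col ▸ h.mem)) hxz, h.x_col]; exact hWT
  · intro u hu hE he
    exact hF u hu hE ((h.eq_iff hA (hT hc) (hne c hc)).1 he)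

end

/-- The search tree leads from every class that it contains to the root. -/
theorem Tree.reach {n : ℕ} {E : ℕ → ℕ → Prop} {φ al acc nxt wit : ℕ → ℕ} {root : ℕ}
    (h : Tree n E φ al acc nxt wit root) : ∀ c ∈ found n acc,
      ReflTransGen (fun a b => Move n E φ a b ∧ a ∈ found n acc ∧ b ∈ found n acc) c root := by
  intro c hc
  rw [mem_found] at hc
  exact h.induction (P := fun c =>
      ReflTransGen (fun a b => Move n E φ a b ∧ a ∈ found n acc ∧ b ∈ found n acc) c root) .refl
    (fun c hc h0 d hd hd0 hM hP => ReflTransGen.head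
      ⟨hM, mem_found.2 ⟨hc, h0⟩, mem_found.2 ⟨hd, hd0⟩⟩ hP) c hc.1 hc.2

theorem Closed.mem_of_avoid {n : ℕ} {E : ℕ → ℕ → Prop} {φ al acc : ℕ → ℕ} {root W : ℕ}
    {A : Finset ℕ} (h : Closed n E φ al acc) (hA : ∀ c ∈ A, c < n)
    (hal : ∀ c ∈ A, c ≠ W → al c ≠ 0) (hroot : acc root ≠ 0) {c : ℕ}
    (hc : Avoid (Move n E φ) A root W c) : acc c ≠ 0 := by
  obtain ⟨hc, -, -⟩ := hc
  induction hc using ReflTransGen.head_induction_on with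
  | refl => exact hroot
  | head h' _ ih =>
    obtain ⟨⟨v, hv, hφ, hF⟩, ⟨ha, haW⟩, hb, -⟩ := h'
    exact h _ (hA _ ha) (hal _ ha haW) _ (hA _ hb) ih v hv hφ hF

/-- A vertex outside that could take an accessible color is either colored, and then its class would
have been found by the closed search, or uncolored, and then `hno` excludes it. -/
theorem Inv.stuck {n r k : ℕ} {E : ℕ → ℕ → Prop} {φ vl cl : ℕ → ℕ} {m : ℕ}
    (hI : Inv n r k E φ vl cl m) (hsymm : ∀ u < n, ∀ v < n, E u v → E v u) (hrn : r ≤ n)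
    {al acc nxt wit : ℕ → ℕ} {root : ℕ} (hal : ∀ c < n, al c ≠ 0 ↔ c ∈ cols r cl m)
    (hsmall : #(cls n φ root) < k) (ht : Tree n E φ al acc nxt wit root)
    (hc : Closed n E φ al acc)
    (hno : ∀ x < n, m ≤ vl x → r ≤ φ x → ∀ c ∈ found n acc, ¬ Free n E φ x c) :
    Stuck n k E φ (verts n vl m) (cols r cl m) (found n acc) root := by
  have hsub : found n acc ⊆ cols r cl m := fun c hc => by
    rw [mem_found] at hc
    exact (hal c hc.1).1 (ht.mem c hc.1 hc.2)
  refine ⟨hsymm, fun v hv => (mem_verts.1 hv).1, hsub, ?_, ?_, ?_, hsmall,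
    hI.deg m le_rfl, ?_, ?_, ht.reach⟩
  · intro v hv hφ
    have := mem_cols.1 (hsub hφ)
    exact mem_verts.2 ⟨hv, (hI.act v hv this.1 m le_rfl).2 this.2⟩
  · intro c hc
    exact hI.size c (mem_cols.1 (hsub hc)).1
  · exact mem_found.2 ⟨ht.root_lt, ht.root_mem⟩
  · exact (Nat.mul_le_mul_left _ (Nat.le_succ k)).trans (hI.large m le_rfl)
  · intro y hy hφ c hc'
    rw [mem_verts] at hy
    by_contra! hcon
    have hF : Free n E φ y c := hcon
    rcases Nat.lt_or_ge (φ y) r with hr | hr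
    · have hQ : φ y ∈ cols r cl m := mem_cols.2 ⟨hr, (hI.act y hy.1 hr m le_rfl).1 hy.2⟩
      have hn : φ y < n := hr.trans_le hrn
      rw [mem_found] at hc' hφ
      exact hφ ⟨hn, hc _ hn ((hal _ hn).2 hQ) c hc'.1 hc'.2 y hy.1 rfl hF⟩
    · exact hno y hy.1 hy.2 hr c hc' hF

end MaxMin

namespace RAM

open MaxMin Finset

/-! ## Reasoning about bounded programs -/

/-- The registers that a program may change. -/
def LProg.regs : LProg → List ℕ
  | .skip => []
  | .assign x _ => [x]
  | .store _ _ _ => []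
  | .seq p q => p.regs ++ q.regs
  | .ite _ p q => p.regs ++ q.regs
  | .loop x p => x :: p.regs
  | .find x _ => [x]
  | .count t _ _ => [t]

/-- The arrays that a program may change. -/
def LProg.arrs : LProg → List ℕ
  | .skip => []
  | .assign _ _ => []
  | .store a _ _ => [a]
  | .seq p q => p.arrs ++ q.arrs
  | .ite _ p q => p.arrs ++ q.arrs
  | .loop _ p => p.arrs
  | .find _ _ => []
  | .count _ _ _ => []

theorem LProg.loop_inv {n x : ℕ} {p : LProg} (I : ℕ → State → Prop) {s : State} (h0 : I 0 s)
    (hs : ∀ i < n, ∀ s', I i s' → I (i + 1) (p.run n (s'.setReg x i))) :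
    I n ((LProg.loop x p).run n s) := by
  have : ∀ j ≤ n, I j ((List.range j).foldl (fun s i => p.run n (s.setReg x i)) s) := by
    intro j
    induction j with
    | zero => exact fun _ => h0
    | succ j ih =>
      intro hj
      rw [List.range_succ, List.foldl_append]
      exact hs j (by omega) _ (ih (by omega))
  exact this n le_rfl

theorem State.setArr_arr_ne (s : State) (a i v : ℕ) {b : ℕ} (h : b ≠ a) :
    (s.setArr a i v).arr b = s.arr b := by
  simp [State.setArr, h]

theorem State.setArr_arr_self (s : State) (a i v : ℕ) :
    (s.setArr a i v).arr a = Function.update (s.arr a) i v := by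
  simp [State.setArr]

theorem LProg.run_frame (n : ℕ) (p : LProg) (s : State) :
    (∀ x ∉ p.regs, (p.run n s).reg x = s.reg x) ∧ ∀ a ∉ p.arrs, (p.run n s).arr a = s.arr a := by
  induction p generalizing s with
  | skip => exact ⟨fun _ _ => rfl, fun _ _ => rfl⟩
  | assign x e =>
    refine ⟨fun y hy => ?_, fun _ _ => rfl⟩
    simp [LProg.regs] at hy
    simp [LProg.run, hy]
  | store a i e =>
    refine ⟨fun _ _ => rfl, fun b hb => ?_⟩
    simp [LProg.arrs] at hb
    exact State.setArr_arr_ne _ _ _ _ hb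
  | seq p q hp hq =>
    refine ⟨fun y hy => ?_, fun b hb => ?_⟩
    · simp [LProg.regs] at hy
      exact ((hq _).1 y hy.2).trans ((hp s).1 y hy.1)
    · simp [LProg.arrs] at hb
      exact ((hq _).2 b hb.2).trans ((hp s).2 b hb.1)
  | ite F p q hp hq =>
    refine ⟨fun y hy => ?_, fun b hb => ?_⟩
    · simp [LProg.regs] at hy
      rw [LProg.run]; split_ifs
      · exact (hp s).1 y hy.1
      · exact (hq s).1 y hy.2
    · simp [LProg.arrs] at hb
      rw [LProg.run]; split_ifs
      · exact (hp s).2 b hb.1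
      · exact (hq s).2 b hb.2
  | loop x p hp =>
    refine LProg.loop_inv (fun _ s' => (∀ y ∉ (LProg.loop x p).regs, s'.reg y = s.reg y) ∧
      ∀ a ∉ (LProg.loop x p).arrs, s'.arr a = s.arr a) ⟨fun _ _ => rfl, fun _ _ => rfl⟩ ?_
    rintro i - s' ⟨h1, h2⟩
    refine ⟨fun y hy => ?_, fun b hb => ?_⟩
    · have hy' := hy
      simp [LProg.regs] at hy'
      rw [(hp _).1 y hy'.2, State.setReg_reg, if_neg hy'.1, h1 y hy]
    · exact ((hp _).2 b hb).trans (h2 b hb)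
  | find x F =>
    refine ⟨fun y hy => ?_, fun _ _ => rfl⟩
    simp [LProg.regs] at hy
    simp [LProg.run, hy]
  | count t x F =>
    refine ⟨fun y hy => ?_, fun _ _ => rfl⟩
    simp [LProg.regs] at hy
    simp [LProg.run, hy]

theorem LProg.run_seq (n : ℕ) (p q : LProg) (s : State) :
    (LProg.seq p q).run n s = q.run n (p.run n s) := rfl

theorem LProg.run_ite_pos {n : ℕ} {F : Form} {p q : LProg} {s : State} (h : F.holds n s) :
    (LProg.ite F p q).run n s = p.run n s := if_pos h

theorem LProg.run_ite_neg {n : ℕ} {F : Form} {p q : LProg} {s : State} (h : ¬ F.holds n s) :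
    (LProg.ite F p q).run n s = q.run n s := if_neg h

theorem LProg.run_reg (n : ℕ) (p : LProg) (s : State) {x : ℕ} (hx : x ∉ p.regs) :
    (p.run n s).reg x = s.reg x :=
  (p.run_frame n s).1 x hx

theorem LProg.run_arr (n : ℕ) (p : LProg) (s : State) {a : ℕ} (ha : a ∉ p.arrs) :
    (p.run n s).arr a = s.arr a :=
  (p.run_frame n s).2 a ha

/-- The invariant rule for loops; what the loop does not change is available in the body. -/
theorem LProg.loop_inv' {n x : ℕ} {p : LProg} (I : ℕ → State → Prop) {s : State} (h0 : I 0 s)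
    (hs : ∀ i < n, ∀ s', (∀ y ∉ (LProg.loop x p).regs, s'.reg y = s.reg y) →
      (∀ a ∉ p.arrs, s'.arr a = s.arr a) → I i s' → I (i + 1) (p.run n (s'.setReg x i))) :
    I n ((LProg.loop x p).run n s) := by
  refine (LProg.loop_inv (fun i s' => ((∀ y ∉ (LProg.loop x p).regs, s'.reg y = s.reg y) ∧
      ∀ a ∉ p.arrs, s'.arr a = s.arr a) ∧ I i s') ⟨⟨fun _ _ => rfl, fun _ _ => rfl⟩, h0⟩ ?_).2
  rintro i hi s' ⟨⟨h1, h2⟩, h3⟩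
  refine ⟨⟨fun y hy => ?_, fun b hb => ?_⟩, hs i hi s' h1 h2 h3⟩
  · have hy' := hy
    simp [LProg.regs] at hy'
    rw [p.run_reg n _ hy'.2, State.setReg_reg, if_neg hy'.1, h1 y hy]
  · rw [p.run_arr n _ hb]; exact h2 b hb

theorem LProg.run_find {n x : ℕ} {F : Form} {s : State}
    (h : ∃ i < n, F.holds n (s.setReg x i)) :
    ∃ i < n, F.holds n (s.setReg x i) ∧ (LProg.find x F).run n s = s.setReg x i := by
  classical
  have key : ∀ j ≤ n, (∃ i < j, F.holds n (s.setReg x i)) →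
      ∃ i < j, F.holds n (s.setReg x i) ∧ (List.range j).foldl
        (fun b i => if F.holds n (s.setReg x i) then i else b) (s.reg x) = i := by
    intro j
    induction j with
    | zero => simp
    | succ j ih =>
      rintro hj ⟨i, hi, hF⟩
      simp only [List.range_succ, List.foldl_append, List.foldl_cons, List.foldl_nil]
      by_cases hFj : F.holds n (s.setReg x j)
      · exact ⟨j, by omega, hFj, if_pos hFj⟩
      · have hij : i ≠ j := by rintro rfl; exact hFj hF
        obtain ⟨l, hl, hFl, he⟩ := ih (by omega) ⟨i, by omega, hF⟩
        exact ⟨l, by omega, hFl, by rw [if_neg hFj, he]⟩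
  obtain ⟨i, hi, hF, he⟩ := key n le_rfl h
  refine ⟨i, hi, hF, ?_⟩
  rw [LProg.run]
  exact congrArg (s.setReg x) (by convert he)

/-- The condition `a < b`. -/
def Form.lt (a b : Expr) : Form := .atom (.sub b a)

/-- The condition `a = b`. -/
def Form.eq (a b : Expr) : Form := .and (.not (.lt a b)) (.not (.lt b a))

theorem Form.holds_atom {n : ℕ} {e : Expr} {s : State} :
    (Form.atom e).holds n s ↔ e.eval s ≠ 0 := Iff.rfl

theorem Form.holds_not {n : ℕ} {F : Form} {s : State} :
    (Form.not F).holds n s ↔ ¬ F.holds n s := Iff.rfl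

theorem Form.holds_and {n : ℕ} {F G : Form} {s : State} :
    (Form.and F G).holds n s ↔ F.holds n s ∧ G.holds n s := Iff.rfl

theorem Form.holds_lt {n : ℕ} {a b : Expr} {s : State} :
    (Form.lt a b).holds n s ↔ a.eval s < b.eval s := by
  simp only [Form.lt, Form.holds, Expr.eval]; omega

theorem Form.holds_eq {n : ℕ} {a b : Expr} {s : State} :
    (Form.eq a b).holds n s ↔ a.eval s = b.eval s := by
  simp only [Form.eq, Form.holds_and, Form.holds_not, Form.holds_lt]; omega

/-- The color of the vertex in register `x`. -/
abbrev Expr.col (x : ℕ) : Expr := .get 1 (.reg x)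

/-- The vertices in registers `x` and `y` are adjacent. -/
def Form.adj (x y : ℕ) : Form := .atom (.get 0 (.add (.get 2 (.reg x)) (.reg y)))

/-- The vertex in register `x` has no neighbor with the color in register `c`. -/
def Form.free (x c : ℕ) : Form :=
  .not (.ex 30 (.and (.adj x 30) (.eq (.col 30) (.reg c))))

/-- The vertex in register `z` is the only neighbor of the one in register `y` with its color. -/
def Form.solo (y z : ℕ) : Form :=
  .and (.adj y z) (.not (.ex 30 (.and (.adj y 30)
    (.and (.eq (.col 30) (.col z)) (.not (.eq (.reg 30) (.reg z)))))))

/-- The arrays `0` and `2` represent the relation `E`. -/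
def Represents (s : State) (E : ℕ → ℕ → Prop) : Prop :=
  ∀ u v, s.arr 0 (s.arr 2 u + v) ≠ 0 ↔ E u v

theorem Represents.congr {s s' : State} {E : ℕ → ℕ → Prop} (h : Represents s E)
    (h0 : s'.arr 0 = s.arr 0) (h2 : s'.arr 2 = s.arr 2) : Represents s' E := by
  intro u v
  rw [h0, h2]; exact h u v

theorem Represents.holds_adj {n : ℕ} {s : State} {E : ℕ → ℕ → Prop} (h : Represents s E)
    {x y : ℕ} : (Form.adj x y).holds n s ↔ E (s.reg x) (s.reg y) :=
  h _ _

theorem Represents.holds_free {n : ℕ} {s : State} {E : ℕ → ℕ → Prop} (h : Represents s E)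
    {x c : ℕ} (hx : x ≠ 30) (hc : c ≠ 30) :
    (Form.free x c).holds n s ↔ Free n E (s.arr 1) (s.reg x) (s.reg c) := by
  have h' : ∀ i, Represents (s.setReg 30 i) E := fun i => h
  rw [Form.free, Form.holds, Form.holds]
  simp only [not_exists, not_and]
  refine forall_congr' fun u => forall_congr' fun _ => ?_
  rw [Form.holds, (h' u).holds_adj, Form.holds_eq]
  simp [Expr.eval, hx, hc]

theorem Represents.holds_solo {n : ℕ} {s : State} {E : ℕ → ℕ → Prop} (h : Represents s E)
    {y z : ℕ} (hy : y ≠ 30) (hz : z ≠ 30) :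
    (Form.solo y z).holds n s ↔ Solo n E (s.arr 1) (s.reg y) (s.reg z) := by
  have h' : ∀ i, Represents (s.setReg 30 i) E := fun i => h
  rw [Form.solo, Form.holds, h.holds_adj, Solo]
  refine and_congr_right fun _ => ?_
  rw [Form.holds, Form.holds]
  simp only [not_exists, not_and]
  refine forall_congr' fun u => forall_congr' fun _ => ?_
  rw [Form.holds, (h' u).holds_adj, Form.holds, Form.holds_eq, Form.holds, Form.holds_eq]
  simp [Expr.eval, hy, hz]

/-! ### Filling an array -/

/-- Fill the array `a` with `e₁` where the condition holds and with `e₂` elsewhere; the index is in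
register `20`. -/
def setIf (a : ℕ) (F : Form) (e₁ e₂ : Expr) : LProg :=
  .loop 20 (.ite F (.store a (.reg 20) e₁) (.store a (.reg 20) e₂))

/-- At its turn, cell `i` still has its old content, so an array can be updated in place as long as
each new entry depends on no other cell of the array. -/
theorem setIf_spec {n a : ℕ} {F : Form} {e₁ e₂ : Expr} {s : State} (P : ℕ → Prop) [DecidablePred P]
    (f₁ f₂ : ℕ → ℕ)
    (h : ∀ i < n, ∀ s' : State, (∀ y ≠ 20, s'.reg y = s.reg y) → (∀ b ≠ a, s'.arr b = s.arr b) →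
      s'.arr a i = s.arr a i → s'.reg 20 = i →
      (F.holds n s' ↔ P i) ∧ e₁.eval s' = f₁ i ∧ e₂.eval s' = f₂ i) :
    ∀ i < n, ((setIf a F e₁ e₂).run n s).arr a i = if P i then f₁ i else f₂ i := by
  classical
  have := LProg.loop_inv' (n := n) (x := 20) (p := .ite F (.store a (.reg 20) e₁)
    (.store a (.reg 20) e₂)) (s := s) (fun j s' =>
      (∀ i < j, s'.arr a i = if P i then f₁ i else f₂ i) ∧ ∀ i, j ≤ i → s'.arr a i = s.arr a i)
    ⟨by simp, by simp⟩ ?_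
  · exact this.1
  · rintro i hi s' hr ha ⟨h1, h2⟩
    obtain ⟨g1, g2, g3⟩ := h i hi (s'.setReg 20 i)
      (fun y hy => by
        rw [State.setReg_reg, if_neg hy]
        exact hr y (by simp [LProg.regs, hy]))
      (fun b hb => ha b (by simp [LProg.arrs, hb])) (h2 i le_rfl) (by simp)
    have hrun : (LProg.ite F (.store a (.reg 20) e₁) (.store a (.reg 20) e₂)).run n
        (s'.setReg 20 i) = (s'.setReg 20 i).setArr a i (if P i then f₁ i else f₂ i) := by
      simp only [LProg.run, g1, g2, g3]
      split_ifs <;> simp [Expr.eval]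
    rw [hrun]
    refine ⟨fun j hj => ?_, fun j hj => ?_⟩
    · rw [State.setArr_arr]
      by_cases hji : j = i
      · subst hji; simp
      · simp [hji, h1 j (by omega)]
    · rw [State.setArr_arr, if_neg (by omega)]
      exact h2 j (by omega)

/-! ### Searching the accessible classes -/

/-- Class `21` is admissible and not found yet, and the vertex `23` of this class can be recolored
with the class `22`, which is found. -/
def Form.canAdd : Form :=
  .and (.and (.atom (.get 9 (.reg 21))) (.not (.atom (.get 5 (.reg 21)))))
    (.and (.atom (.get 5 (.reg 22))) (.and (.eq (.col 23) (.reg 21)) (.free 23 22)))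

/-- Extend the search tree by the class `21`, if possible with successor `22`. -/
def reachStep : LProg :=
  .ite (.ex 23 .canAdd)
    (.seq (.find 23 .canAdd)
      (.seq (.store 5 (.reg 21) (.add (.get 5 (.reg 22)) (.const 1)))
        (.seq (.store 6 (.reg 21) (.reg 22)) (.store 7 (.reg 21) (.reg 23))))) .skip

/-- Compute a search tree of classes from the root in register `4` over the classes that array `9`
admits, in the arrays `5` (distances), `6` (successors) and `7` (movable vertices). -/
def reach : LProg :=
  .seq (setIf 5 (.eq (.reg 20) (.reg 4)) (.const 1) (.const 0))
    (.loop 20 (.loop 21 (.loop 22 reachStep)))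

/-- The arrays `5`, `6`, `7` hold a search tree. -/
def HasTree (n : ℕ) (E : ℕ → ℕ → Prop) (φ al : ℕ → ℕ) (root : ℕ) (s : State) : Prop :=
  Tree n E φ al (s.arr 5) (s.arr 6) (s.arr 7) root

theorem holds_canAdd {n : ℕ} {s : State} {E : ℕ → ℕ → Prop} (h : Represents s E) (v : ℕ) :
    Form.canAdd.holds n (s.setReg 23 v) ↔ (s.arr 9 (s.reg 21) ≠ 0 ∧ s.arr 5 (s.reg 21) = 0) ∧
      s.arr 5 (s.reg 22) ≠ 0 ∧ s.arr 1 v = s.reg 21 ∧ Free n E (s.arr 1) v (s.reg 22) := by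
  have h' : Represents (s.setReg 23 v) E := h
  simp [Form.canAdd, Form.holds_and, Form.holds_not, Form.holds_atom, Form.holds_eq,
    h'.holds_free, Expr.eval]

theorem reachStep_spec {n : ℕ} {E : ℕ → ℕ → Prop} {φ al : ℕ → ℕ} {root : ℕ} {s : State}
    (hE : Represents s E) (hφ : s.arr 1 = φ) (hal : s.arr 9 = al)
    (ht : HasTree n E φ al root s) (hc : s.reg 21 < n) (hd : s.reg 22 < n) :
    HasTree n E φ al root (reachStep.run n s) ∧
      (∀ b, s.arr 5 b ≠ 0 → (reachStep.run n s).arr 5 b ≠ 0) ∧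
      (al (s.reg 21) ≠ 0 → s.arr 5 (s.reg 22) ≠ 0 →
        ∀ v < n, φ v = s.reg 21 → Free n E φ v (s.reg 22) →
        (reachStep.run n s).arr 5 (s.reg 21) ≠ 0) := by
  subst hφ hal
  rw [reachStep]
  by_cases hex : (Form.ex 23 .canAdd).holds n s
  · rw [LProg.run_ite_pos hex]
    obtain ⟨v, hv, hF, hrun⟩ := LProg.run_find hex
    rw [holds_canAdd hE] at hF
    have hstate : ((LProg.find 23 .canAdd).seq ((LProg.store 5 (.reg 21)
        (.add (.get 5 (.reg 22)) (.const 1))).seq ((LProg.store 6 (.reg 21) (.reg 22)).seq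
          (.store 7 (.reg 21) (.reg 23))))).run n s = (((s.setReg 23 v).setArr 5 (s.reg 21)
            (s.arr 5 (s.reg 22) + 1)).setArr 6 (s.reg 21) (s.reg 22)).setArr 7 (s.reg 21) v := by
      rw [LProg.run_seq, hrun]
      simp [LProg.run, Expr.eval]
    rw [hstate]
    have e5 : ((((s.setReg 23 v).setArr 5 (s.reg 21) (s.arr 5 (s.reg 22) + 1)).setArr 6 (s.reg 21)
        (s.reg 22)).setArr 7 (s.reg 21) v).arr 5 =
        Function.update (s.arr 5) (s.reg 21) (s.arr 5 (s.reg 22) + 1) := by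
      simp [State.setArr]
    have htree := ht.add hc hF.1.1 hF.1.2 hd hF.2.1 hv hF.2.2.1 hF.2.2.2
    refine ⟨?_, ?_, ?_⟩
    · rw [HasTree]
      rw [e5]
      simpa [State.setArr] using htree
    · intro b hb
      have hbc : b ≠ s.reg 21 := by rintro rfl; exact hb hF.1.2
      have := congrFun e5 b
      rw [Function.update_of_ne hbc] at this
      exact fun h => hb (this.symm.trans h)
    · intro _ _ _ _ _ _
      have := congrFun e5 (s.reg 21)
      rw [Function.update_self] at this
      exact fun h => absurd (this.symm.trans h) (by omega)
  · rw [LProg.run_ite_neg hex]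
    refine ⟨ht, fun b hb => hb, fun h1 h2 v hv h3 h4 h5 => hex ⟨v, hv, ?_⟩⟩
    rw [holds_canAdd hE]
    exact ⟨⟨h1, h5⟩, h2, h3, h4⟩

theorem reach_spec {n : ℕ} {E : ℕ → ℕ → Prop} {s : State} (hE : Represents s E)
    (hroot : s.reg 4 < n) (hal : s.arr 9 (s.reg 4) ≠ 0) :
    HasTree n E (s.arr 1) (s.arr 9) (s.reg 4) (reach.run n s) ∧
      Closed n E (s.arr 1) (s.arr 9) ((reach.run n s).arr 5) := by
  rw [reach, LProg.run]
  set s₀ := (setIf 5 (.eq (.reg 20) (.reg 4)) (.const 1) (.const 0)).run n s with hs₀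
  have hacc : ∀ i < n, s₀.arr 5 i = if i = s.reg 4 then 1 else 0 := by
    refine setIf_spec (fun i => i = s.reg 4) (fun _ => 1) (fun _ => 0) ?_
    intro i _ s' hr _ _ h20
    rw [Form.holds_eq]
    simp [Expr.eval, h20, hr]
  have f1 : s₀.arr 1 = s.arr 1 := LProg.run_arr _ _ _ (by decide)
  have f9 : s₀.arr 9 = s.arr 9 := LProg.run_arr _ _ _ (by decide)
  have hE₀ : Represents s₀ E :=
    hE.congr (LProg.run_arr _ _ _ (by decide)) (LProg.run_arr _ _ _ (by decide))
  generalize s.arr 1 = φ at *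
  generalize s.arr 9 = al at *
  generalize s.reg 4 = root at *
  have ht₀ : HasTree n E φ al root s₀ := Tree.init hroot hal hacc
  have hrow : ∀ s' : State, Represents s' E → s'.arr 1 = φ → s'.arr 9 = al →
      HasTree n E φ al root s' → ∀ c < n,
      HasTree n E φ al root ((LProg.loop 22 reachStep).run n (s'.setReg 21 c)) ∧
      (∀ b, s'.arr 5 b ≠ 0 → ((LProg.loop 22 reachStep).run n (s'.setReg 21 c)).arr 5 b ≠ 0) ∧
      ∀ d < n, al c ≠ 0 → s'.arr 5 d ≠ 0 → ∀ v < n, φ v = c → Free n E φ v d →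
        ((LProg.loop 22 reachStep).run n (s'.setReg 21 c)).arr 5 c ≠ 0 := by
    intro s' hE' h1 h9 ht' c hc
    refine LProg.loop_inv' (s := s'.setReg 21 c) (fun i t => HasTree n E φ al root t ∧
      (∀ b, s'.arr 5 b ≠ 0 → t.arr 5 b ≠ 0) ∧
      ∀ d < i, al c ≠ 0 → s'.arr 5 d ≠ 0 → ∀ v < n, φ v = c → Free n E φ v d → t.arr 5 c ≠ 0)
      ⟨ht', fun _ h => h, by simp⟩ ?_
    rintro d hd t hr ha ⟨g1, g2, g3⟩
    have hrep : Represents (t.setReg 22 d) E := hE'.congr (ha 0 (by decide)) (ha 2 (by decide))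
    have hc21 : (t.setReg 22 d).reg 21 = c := by
      have := hr 21 (by decide)
      simp at this
      simp [this]
    obtain ⟨k1, k2, k3⟩ := reachStep_spec (root := root) hrep
      ((ha 1 (by decide)).trans h1) ((ha 9 (by decide)).trans h9) g1 (by rwa [hc21]) (by simpa)
    rw [hc21] at k3
    refine ⟨k1, fun b hb => k2 b (g2 b hb), ?_⟩
    intro d' hd' q1 q2 v hv q3 q4
    by_cases hdd : d' = d
    · subst hdd
      exact k3 q1 (by simpa using g2 _ q2) v hv q3 (by simpa using q4)
    · exact k2 _ (g3 d' (by omega) q1 q2 v hv q3 q4)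
  -- One full scan finds at least every class that can be attached to a class known at the start of
  -- the scan.
  have hround : ∀ s' : State, Represents s' E → s'.arr 1 = φ → s'.arr 9 = al →
      HasTree n E φ al root s' →
      HasTree n E φ al root ((LProg.loop 21 (.loop 22 reachStep)).run n s') ∧
      (∀ b, s'.arr 5 b ≠ 0 → ((LProg.loop 21 (.loop 22 reachStep)).run n s').arr 5 b ≠ 0) ∧
      ∀ c < n, ∀ d < n, al c ≠ 0 → s'.arr 5 d ≠ 0 → ∀ v < n, φ v = c → Free n E φ v d →
        ((LProg.loop 21 (.loop 22 reachStep)).run n s').arr 5 c ≠ 0 := by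
    intro s' hE' h1 h9 ht'
    refine LProg.loop_inv' (s := s') (fun i t => HasTree n E φ al root t ∧
      (∀ b, s'.arr 5 b ≠ 0 → t.arr 5 b ≠ 0) ∧
      ∀ c < i, ∀ d < n, al c ≠ 0 → s'.arr 5 d ≠ 0 → ∀ v < n, φ v = c → Free n E φ v d →
        t.arr 5 c ≠ 0) ⟨ht', fun _ h => h, by simp⟩ ?_
    rintro c hc t hr ha ⟨g1, g2, g3⟩
    obtain ⟨k1, k2, k3⟩ := hrow t (hE'.congr (ha 0 (by decide)) (ha 2 (by decide)))
      ((ha 1 (by decide)).trans h1) ((ha 9 (by decide)).trans h9) g1 c hc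
    refine ⟨k1, fun b hb => k2 b (g2 b hb), ?_⟩
    intro c' hc' d hd q1 q2 v hv q3 q4
    by_cases hcc : c' = c
    · subst hcc
      exact k3 d hd q1 (g2 _ q2) v hv q3 q4
    · exact k2 _ (g3 c' (by omega) d hd q1 q2 v hv q3 q4)
  -- Each round either leaves a closed search or finds a new class. The root is found at the start,
  -- so growth in all `n` rounds would yield `n + 1` classes below `n`.
  have hloop := LProg.loop_inv' (n := n) (x := 20) (p := .loop 21 (.loop 22 reachStep)) (s := s₀)
    (fun i t => HasTree n E φ al root t ∧
      (Closed n E φ al (t.arr 5) ∨ i + 1 ≤ #(found n (t.arr 5)))) ?_ ?_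
  · refine ⟨hloop.1, hloop.2.resolve_right fun h => ?_⟩
    have := card_le_card (filter_subset (fun c => ((LProg.loop 20
      (.loop 21 (.loop 22 reachStep))).run n s₀).arr 5 c ≠ 0) (range n))
    rw [card_range] at this
    rw [found] at h
    omega
  · refine ⟨ht₀, Or.inr ?_⟩
    rw [Nat.zero_add, Nat.one_le_iff_ne_zero, card_ne_zero]
    exact ⟨root, mem_found.2 ⟨hroot, ht₀.root_mem⟩⟩
  · rintro i - t hr ha ⟨g1, g2⟩
    obtain ⟨k1, k2, k3⟩ := hround (t.setReg 20 i)
      (hE₀.congr (ha 0 (by decide)) (ha 2 (by decide)))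
      ((ha 1 (by decide)).trans f1) ((ha 9 (by decide)).trans f9) g1
    refine ⟨k1, ?_⟩
    set t' := (LProg.loop 21 (.loop 22 reachStep)).run n (t.setReg 20 i)
    have hsub : found n (t.arr 5) ⊆ found n (t'.arr 5) := fun b hb => by
      rw [mem_found] at hb ⊢
      exact ⟨hb.1, k2 b hb.2⟩
    by_cases heq : found n (t.arr 5) = found n (t'.arr 5)
    · left
      intro c hc hcal d hd hdacc v hv hφv hF
      have hd' : d ∈ found n (t.arr 5) := heq ▸ mem_found.2 ⟨hd, hdacc⟩
      exact k3 c hc d hd hcal (mem_found.1 hd').2 v hv hφv hF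
    · rcases g2 with g2 | g2
      -- Once the search is closed no class can be added: by induction along the new tree, all its
      -- classes were found before.
      · exfalso
        apply heq
        refine subset_antisymm hsub fun b hb => ?_
        rw [mem_found] at hb ⊢
        refine ⟨hb.1, ?_⟩
        exact k1.induction (P := fun b => t.arr 5 b ≠ 0) g1.root_mem
          (fun c hc hc0 d hd _ ⟨v, hv, h1, h2⟩ hP =>
            g2 c hc (k1.mem c hc hc0) d hd hP v hv h1 h2) b hb.1 hb.2
      · right
        have := card_lt_card (Finset.ssubset_iff_subset_ne.2 ⟨hsub, heq⟩)
        omega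

/-! ### Recoloring along a path -/

/-- Give the color in register `6` to the vertex in register `5`, and go on with the vertex that
leaves this class, up to the root. -/
def augment : LProg :=
  .seq (.assign 7 (.const 0))
    (.loop 20 (.ite (.not (.atom (.reg 7)))
      (.seq (.store 1 (.reg 5) (.reg 6))
        (.ite (.eq (.reg 6) (.reg 4)) (.assign 7 (.const 1))
          (.seq (.assign 5 (.get 7 (.reg 6))) (.assign 6 (.get 6 (.reg 6)))))) .skip))

theorem augment_spec {n r : ℕ} {E : ℕ → ℕ → Prop} {φ al : ℕ → ℕ} {x₀ : ℕ} {s : State}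
    (hsymm : ∀ u < n, ∀ v < n, E u v → E v u) (hirr : ∀ u < n, ¬ E u u)
    (ht : HasTree n E φ al (s.reg 4) s)
    (hp : Pending n r E φ (s.arr 5) x₀ (s.arr 1) (s.reg 5) (s.reg 6)) :
    Augmented n r E φ x₀ (found n (s.arr 5)) (s.reg 4) ((augment.run n s).arr 1) := by
  -- Register `7` signals completion. The value of `acc` at the current class is at most `n` and
  -- decreases in each turn, so the root is reached within `n` turns.
  have hloop := LProg.loop_inv' (n := n) (x := 20) (p := .ite (.not (.atom (.reg 7)))
      (.seq (.store 1 (.reg 5) (.reg 6))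
        (.ite (.eq (.reg 6) (.reg 4)) (.assign 7 (.const 1))
          (.seq (.assign 5 (.get 7 (.reg 6))) (.assign 6 (.get 6 (.reg 6)))))) .skip)
    (s := s.setReg 7 0)
    (fun i t => (t.reg 7 = 0 ∧ Pending n r E φ (s.arr 5) x₀ (t.arr 1) (t.reg 5) (t.reg 6) ∧
        s.arr 5 (t.reg 6) + i ≤ n) ∨
      (t.reg 7 ≠ 0 ∧ Augmented n r E φ x₀ (found n (s.arr 5)) (s.reg 4) (t.arr 1))) ?_ ?_
  · rcases hloop with ⟨_, h, h'⟩ | h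
    · have := (mem_found.1 h.mem).2
      omega
    · exact h.2
  · left
    refine ⟨by simp, hp, ?_⟩
    have h1 := ht.le _ (mem_found.1 hp.mem).1
    have h2 := card_le_card (filter_subset (fun c => s.arr 5 c ≠ 0) (range n))
    rw [card_range] at h2
    simpa using h1.trans h2
  · intro i hi t hr ha hI
    have h4 : t.reg 4 = s.reg 4 := by simpa using hr 4 (by decide)
    have h6 : t.arr 6 = s.arr 6 := ha 6 (by decide)
    have h7 : t.arr 7 = s.arr 7 := ha 7 (by decide)
    rcases hI with ⟨g7, gp, gle⟩ | ⟨g7, ga⟩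
    · have hF : (Form.not (.atom (.reg 7))).holds n (t.setReg 20 i) := by
        simp [Form.holds, Expr.eval, g7]
      have e1 : (LProg.store 1 (.reg 5) (.reg 6)).run n (t.setReg 20 i) =
          (t.setReg 20 i).setArr 1 (t.reg 5) (t.reg 6) := by
        simp [LProg.run, Expr.eval]
      rw [LProg.run_ite_pos hF, LProg.run_seq, e1]
      have e2 : ((t.setReg 20 i).setArr 1 (t.reg 5) (t.reg 6)).arr 1 =
          Function.update (t.arr 1) (t.reg 5) (t.reg 6) := by
        rw [State.setArr_arr_self]; rfl
      by_cases hroot : t.reg 6 = s.reg 4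
      · right
        rw [LProg.run_ite_pos (by rw [Form.holds_eq]; simp [Expr.eval, hroot, h4])]
        refine ⟨by simp [LProg.run, Expr.eval], ?_⟩
        rw [LProg.run, State.setReg_arr, e2]
        rw [hroot] at gp ⊢
        exact gp.finish hsymm hirr
      · left
        rw [LProg.run_ite_neg (by rw [Form.holds_eq]; simp [Expr.eval, hroot, h4])]
        obtain ⟨k1, k2⟩ := gp.step ht hsymm hirr hroot
        refine ⟨by simp [LProg.run, g7], ?_, ?_⟩
        · rw [LProg.run, LProg.run, LProg.run, State.setReg_arr, State.setReg_arr, e2]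
          simpa [Expr.eval, h6, h7] using k1
        · simp [LProg.run, Expr.eval, h6]
          omega
    · right
      have hF : ¬ (Form.not (.atom (.reg 7))).holds n (t.setReg 20 i) := by
        simp [Form.holds, Expr.eval, g7]
      rw [LProg.run_ite_neg hF]
      exact ⟨by simpa [LProg.run] using g7, ga⟩

end RAM

namespace RAM

open MaxMin Finset

/-! ## One step of the recoloring algorithm -/

/-- Put the sizes of the color classes into array `8`. -/
def sizes : LProg :=
  .loop 20 (.seq (.count 13 30 (.eq (.col 30) (.reg 20))) (.store 8 (.reg 20) (.reg 13)))

theorem sizes_spec {n : ℕ} {s : State} :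
    ∀ c < n, (sizes.run n s).arr 8 c = #(cls n (s.arr 1) c) := by
  classical
  refine LProg.loop_inv' (n := n) (x := 20) (fun i t => ∀ c < i, t.arr 8 c = #(cls n (s.arr 1) c))
    (by simp) ?_
  intro i hi t _ ha hI c hc
  have h1 : t.arr 1 = s.arr 1 := ha 1 (by decide)
  have hcount : Nat.count (fun v => (Form.eq (.col 30) (.reg 20)).holds n
      ((t.setReg 20 i).setReg 30 v)) n = #(cls n (s.arr 1) i) := by
    rw [Nat.count_eq_card_filter_range, cls]
    congr 1
    refine filter_congr fun v _ => ?_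
    rw [Form.holds_eq]
    simp [Expr.eval, h1]
  have hrun : ((LProg.count 13 30 (.eq (.col 30) (.reg 20))).seq (.store 8 (.reg 20) (.reg 13))).run n
      (t.setReg 20 i) = ((t.setReg 20 i).setReg 13 #(cls n (s.arr 1) i)).setArr 8 i
        #(cls n (s.arr 1) i) := by
    rw [← hcount]
    simp only [LProg.run, Expr.eval, State.setReg_reg]
    simp
  rw [hrun]
  by_cases hci : c = i
  · subst hci; simp
  · simp [hci, hI c (by omega)]

/-- The class in register `4` is active and too small. -/
def Form.small : Form :=
  .and (.lt (.reg 4) (.reg 1)) (.and (.not (.lt (.get 3 (.reg 4)) (.reg 3)))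
    (.lt (.get 8 (.reg 4)) (.reg 2)))

/-- The active uncolored vertex in register `5` can get the accessible color in register `6`. -/
def Form.grow : Form :=
  .and (.not (.lt (.col 5) (.reg 1))) (.and (.not (.lt (.get 4 (.reg 5)) (.reg 3)))
    (.and (.atom (.get 5 (.reg 6))) (.free 5 6)))

/-- The vertex in register `y` is active and has no accessible color. -/
def Form.outside (y : ℕ) : Form :=
  .and (.not (.lt (.get 4 (.reg y)) (.reg 3)))
    (.not (.and (.lt (.col y) (.reg 1)) (.atom (.get 10 (.col y)))))

/-- The vertex `10` can replace the vertex `9` in the class `8`, and `9` can go to the class `6`. -/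
def Form.one : Form :=
  .and (.eq (.col 9) (.reg 8)) (.and (.outside 10) (.and (.solo 10 9)
    (.and (.atom (.get 5 (.reg 6))) (.free 9 6))))

/-- The vertices `10` and `11` can replace the vertices `9` and `5` in the class `8`, and `5` can go
to the class `6`. -/
def Form.two : Form :=
  .and (.eq (.col 9) (.reg 8)) (.and (.outside 10) (.and (.outside 11)
    (.and (.not (.adj 10 11)) (.and (.not (.eq (.reg 10) (.reg 11))) (.and (.solo 10 9)
      (.and (.solo 11 9) (.and (.eq (.col 5) (.reg 8)) (.and (.not (.eq (.reg 5) (.reg 9)))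
        (.and (.atom (.get 5 (.reg 6))) (.free 5 6))))))))))

/-- Recolor after replacing the vertex `9` by `10`. -/
def swapOne : LProg :=
  .seq (.find 9 (.ex 10 (.ex 6 .one))) (.seq (.find 10 (.ex 6 .one)) (.seq (.find 6 .one)
    (.seq (.store 1 (.reg 10) (.reg 8)) (.seq (.assign 5 (.reg 9))
      (.seq augment (.assign 12 (.const 1)))))))

/-- Recolor after replacing the vertices `9` and `5` by `10` and `11`; `9` becomes uncolored. -/
def swapTwo : LProg :=
  .seq (.find 9 (.ex 10 (.ex 11 (.ex 5 (.ex 6 .two))))) (.seq (.find 10 (.ex 11 (.ex 5 (.ex 6 .two))))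
    (.seq (.find 11 (.ex 5 (.ex 6 .two))) (.seq (.find 5 (.ex 6 .two)) (.seq (.find 6 .two)
      (.seq (.store 1 (.reg 9) (.reg 0)) (.seq (.store 1 (.reg 10) (.reg 8))
        (.seq (.store 1 (.reg 11) (.reg 8)) (.seq augment (.assign 12 (.const 1))))))))))

/-- Try a swap at the class in register `8`, with a search that avoids this class. -/
def attempt (F : Form) (p : LProg) : LProg :=
  .seq (setIf 9 (.and (.atom (.get 10 (.reg 20))) (.not (.eq (.reg 20) (.reg 8)))) (.const 1)
    (.const 0))
    (.ite (.and (.not (.atom (.reg 12))) (.and (.atom (.get 10 (.reg 8)))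
      (.not (.eq (.reg 8) (.reg 4))))) (.seq reach (.ite F p .skip)) .skip)

/-- The parameters of a swap: the accessible classes `A` are in array `10`. -/
structure SwapState (n r : ℕ) (E : ℕ → ℕ → Prop) (vl cl : ℕ → ℕ) (m root : ℕ) (A : Finset ℕ)
    (s : State) : Prop where
  rep : Represents s E
  reg0 : s.reg 0 = n
  reg1 : s.reg 1 = r
  reg3 : s.reg 3 = m
  reg4 : s.reg 4 = root
  arr3 : s.arr 3 = cl
  arr4 : s.arr 4 = vl
  arr10 : found n (s.arr 10) = A

theorem SwapState.congr {n r : ℕ} {E : ℕ → ℕ → Prop} {vl cl : ℕ → ℕ} {m root : ℕ} {A : Finset ℕ}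
    {s s' : State} (h : SwapState n r E vl cl m root A s)
    (hr : ∀ x ∈ [0, 1, 3, 4], s'.reg x = s.reg x) (ha : ∀ a ∈ [0, 2, 3, 4, 10], s'.arr a = s.arr a) :
    SwapState n r E vl cl m root A s' where
  rep := h.rep.congr (ha 0 (by simp)) (ha 2 (by simp))
  reg0 := (hr 0 (by simp)).trans h.reg0
  reg1 := (hr 1 (by simp)).trans h.reg1
  reg3 := (hr 3 (by simp)).trans h.reg3
  reg4 := (hr 4 (by simp)).trans h.reg4
  arr3 := (ha 3 (by simp)).trans h.arr3
  arr4 := (ha 4 (by simp)).trans h.arr4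
  arr10 := by rw [ha 10 (by simp)]; exact h.arr10

theorem SwapState.run {n r : ℕ} {E : ℕ → ℕ → Prop} {vl cl : ℕ → ℕ} {m root : ℕ} {A : Finset ℕ}
    {s : State} (h : SwapState n r E vl cl m root A s) (p : LProg)
    (hr : ∀ x ∈ [0, 1, 3, 4], x ∉ p.regs) (ha : ∀ a ∈ [0, 2, 3, 4, 10], a ∉ p.arrs) :
    SwapState n r E vl cl m root A (p.run n s) :=
  h.congr (fun x hx => p.run_reg n s (hr x hx)) (fun a hx => p.run_arr n s (ha a hx))

/-- What is known when the search along paths has failed. -/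
structure Setting (n r k : ℕ) (E : ℕ → ℕ → Prop) (φ vl cl : ℕ → ℕ) (m root : ℕ)
    (A : Finset ℕ) : Prop where
  symm : ∀ u < n, ∀ v < n, E u v → E v u
  irr : ∀ u < n, ¬ E u u
  le : r ≤ n
  inv : Inv n r k E φ vl cl m
  sub : A ⊆ cols r cl m
  root_mem : root ∈ A
  small : #(cls n φ root) < k

/-! ### Correctness of the two kinds of exchange -/

section

variable {n r k : ℕ} {E : ℕ → ℕ → Prop} {φ vl cl : ℕ → ℕ} {m root : ℕ} {A : Finset ℕ}

theorem Setting.lt (h : Setting n r k E φ vl cl m root A) {c : ℕ} (hc : c ∈ A) : c < n :=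
  (mem_cols.1 (h.sub hc)).1.trans_le h.le

/-- The state after a search that avoids the class `W`. -/
structure Searched (n r : ℕ) (E : ℕ → ℕ → Prop) (φ vl cl : ℕ → ℕ) (m root : ℕ)
    (A : Finset ℕ) (W : ℕ) (al : ℕ → ℕ) (s : State) : Prop extends
    SwapState n r E vl cl m root A s where
  arr1 : s.arr 1 = φ
  reg8 : s.reg 8 = W
  tree : HasTree n E φ al root s
  sub : found n (s.arr 5) ⊆ A
  notMem : W ∉ found n (s.arr 5)
  avoid : ∀ c, Avoid (Move n E φ) A root W c → s.arr 5 c ≠ 0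

/-- The classes `A` are read from array `10`, since array `5` is overwritten by each search. A
failed attempt still changes the search arrays, so it ends in `t` and not in `s`. -/
theorem attempt_spec (h : Setting n r k E φ vl cl m root A) {F : Form} {p : LProg} {s : State}
    (hs : SwapState n r E vl cl m root A s) (h1 : s.arr 1 = φ) (h12 : s.reg 12 = 0)
    (hW : s.reg 8 ∈ A) (hWr : s.reg 8 ≠ root) :
    ∃ al t, Searched n r E φ vl cl m root A (s.reg 8) al t ∧ t.reg 12 = 0 ∧
      (F.holds n t → (attempt F p).run n s = p.run n t) ∧
      (¬ F.holds n t → (attempt F p).run n s = t) := by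
  have hWn := h.lt hW
  have hmem : ∀ c < n, c ∈ A ↔ s.arr 10 c ≠ 0 := fun c hc => by
    rw [← hs.arr10, mem_found]; exact and_iff_right hc
  set q := setIf 9 (.and (.atom (.get 10 (.reg 20))) (.not (.eq (.reg 20) (.reg 8)))) (.const 1)
    (.const 0) with hq
  set s₁ := q.run n s with hs₁
  have hal : ∀ c < n, s₁.arr 9 c = if c ∈ A ∧ c ≠ s.reg 8 then 1 else 0 := by
    refine setIf_spec (fun c => c ∈ A ∧ c ≠ s.reg 8) (fun _ => 1) (fun _ => 0) ?_
    intro c hc s' hr ha _ h20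
    rw [Form.holds_and, Form.holds_not, Form.holds_atom, Form.holds_eq, hmem c hc]
    simp [Expr.eval, h20, hr, ha]
  have hst₁ : SwapState n r E vl cl m root A s₁ := hs.run q (by decide) (by decide)
  have e1 : s₁.arr 1 = φ := (q.run_arr n s (by decide)).trans h1
  have e12 : s₁.reg 12 = 0 := (q.run_reg n s (by decide)).trans h12
  have e8 : s₁.reg 8 = s.reg 8 := q.run_reg n s (by decide)
  have e10 : s₁.arr 10 = s.arr 10 := q.run_arr n s (by decide)
  have hguard : (Form.and (.not (.atom (.reg 12))) (.and (.atom (.get 10 (.reg 8)))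
      (.not (.eq (.reg 8) (.reg 4))))).holds n s₁ := by
    rw [Form.holds_and, Form.holds_and, Form.holds_not, Form.holds_not, Form.holds_eq]
    simp [Form.holds_atom, Expr.eval, e12, e8, e10, hst₁.reg4, hWr, (hmem _ hWn).1 hW]
  have hrn : root < n := h.lt h.root_mem
  have hreach := reach_spec (s := s₁) hst₁.rep (by rw [hst₁.reg4]; exact hrn)
    (by rw [hst₁.reg4, hal _ hrn, if_pos ⟨h.root_mem, hWr.symm⟩]; decide)
  rw [e1, hst₁.reg4] at hreach
  set t := reach.run n s₁ with ht
  have hmt : ∀ c, c ∈ found n (t.arr 5) → c ∈ A ∧ c ≠ s.reg 8 := by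
    intro c hc
    rw [mem_found] at hc
    have := hreach.1.mem c hc.1 hc.2
    rw [hal c hc.1] at this
    by_contra hcon
    exact this (if_neg hcon)
  refine ⟨s₁.arr 9, t, ⟨hst₁.run reach (by decide) (by decide), ?_, ?_, hreach.1, ?_, ?_, ?_⟩, ?_,
    ?_, ?_⟩
  · exact (reach.run_arr n s₁ (by decide)).trans e1
  · exact (reach.run_reg n s₁ (by decide)).trans e8
  · exact fun c hc => (hmt c hc).1
  · exact fun hc => (hmt _ hc).2 rfl
  · intro c hc
    refine hreach.2.mem_of_avoid (fun c hc => h.lt hc) (fun c hc hcW => ?_) hreach.1.root_mem hc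
    rw [hal c (h.lt hc), if_pos ⟨hc, hcW⟩]
    decide
  · exact (reach.run_reg n s₁ (by decide)).trans e12
  · intro hF
    rw [attempt, LProg.run_seq, ← hq, ← hs₁, LProg.run_ite_pos hguard, LProg.run_seq, ← ht,
      LProg.run_ite_pos hF]
  · intro hF
    rw [attempt, LProg.run_seq, ← hq, ← hs₁, LProg.run_ite_pos hguard, LProg.run_seq, ← ht,
      LProg.run_ite_neg hF]
    rfl

theorem attempt_skip {F : Form} {p : LProg} {s : State}
    (hs : SwapState n r E vl cl m root A s)
    (hW : s.reg 12 ≠ 0 ∨ s.reg 8 ∉ found n (s.arr 10) ∧ s.reg 8 < n ∨ s.reg 8 = root) :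
    ((attempt F p).run n s).arr 1 = s.arr 1 ∧ ((attempt F p).run n s).reg 12 = s.reg 12 ∧
      ((attempt F p).run n s).reg 9 = s.reg 9 := by
  rw [attempt, LProg.run_seq]
  set q := setIf 9 (.and (.atom (.get 10 (.reg 20))) (.not (.eq (.reg 20) (.reg 8)))) (.const 1)
    (.const 0) with hq
  have e1 : (q.run n s).arr 1 = s.arr 1 := q.run_arr n s (by decide)
  have e12 : (q.run n s).reg 12 = s.reg 12 := q.run_reg n s (by decide)
  have e9 : (q.run n s).reg 9 = s.reg 9 := q.run_reg n s (by decide)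
  have e8 : (q.run n s).reg 8 = s.reg 8 := q.run_reg n s (by decide)
  have e4 : (q.run n s).reg 4 = s.reg 4 := q.run_reg n s (by decide)
  have e10 : (q.run n s).arr 10 = s.arr 10 := q.run_arr n s (by decide)
  rw [LProg.run_ite_neg]
  · exact ⟨e1, e12, e9⟩
  · rw [Form.holds_and, Form.holds_and, Form.holds_not, Form.holds_not, Form.holds_eq]
    simp only [Form.holds_atom, Expr.eval, e12, e8, e10, e4, hs.reg4]
    rintro ⟨g1, g2, g3⟩
    rcases hW with h | h | h
    · exact g1 h
    · exact h.1 (mem_found.2 ⟨h.2, g2⟩)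
    · exact g3 h

theorem SwapState.holds_outside {s : State} (hs : SwapState n r E vl cl m root A s)
    (h : Setting n r k E φ vl cl m root A) (h1 : s.arr 1 = φ) {y : ℕ} :
    (Form.outside y).holds n s ↔ m ≤ vl (s.reg y) ∧ φ (s.reg y) ∉ A := by
  have : φ (s.reg y) ∈ A ↔ φ (s.reg y) < r ∧ s.arr 10 (φ (s.reg y)) ≠ 0 := by
    constructor
    · intro hA
      refine ⟨(mem_cols.1 (h.sub hA)).1, ?_⟩
      rw [← hs.arr10] at hA
      exact (mem_found.1 hA).2
    · rintro ⟨hr, h0⟩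
      rw [← hs.arr10]
      exact mem_found.2 ⟨hr.trans_le h.le, h0⟩
  rw [Form.outside, Form.holds_and, Form.holds_not, Form.holds_not, Form.holds_and, Form.holds_lt,
    Form.holds_lt, Form.holds_atom, this]
  simp only [Expr.eval, hs.arr4, hs.reg3, hs.reg1, h1, not_lt]

/-- The exchange of two vertices that `swapOne` looks for. -/
def One (n : ℕ) (E : ℕ → ℕ → Prop) (φ vl : ℕ → ℕ) (m : ℕ) (A : Finset ℕ) (W : ℕ) (acc : ℕ → ℕ)
    (z y c : ℕ) : Prop :=
  φ z = W ∧ (m ≤ vl y ∧ φ y ∉ A) ∧ Solo n E φ y z ∧ acc c ≠ 0 ∧ Free n E φ z c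

theorem SwapState.setReg {s : State} (hs : SwapState n r E vl cl m root A s) {x v : ℕ}
    (hx : x ∉ [0, 1, 3, 4]) : SwapState n r E vl cl m root A (s.setReg x v) :=
  hs.congr (fun y hy => by rw [State.setReg_reg, if_neg (by rintro rfl; exact hx hy)])
    (fun _ _ => rfl)

theorem Searched.holds_one {W : ℕ} {al : ℕ → ℕ} {s : State}
    (hs : Searched n r E φ vl cl m root A W al s) (h : Setting n r k E φ vl cl m root A)
    (z y c : ℕ) : Form.one.holds n (((s.setReg 9 z).setReg 10 y).setReg 6 c) ↔
      One n E φ vl m A W (s.arr 5) z y c := by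
  have hs' : SwapState n r E vl cl m root A (((s.setReg 9 z).setReg 10 y).setReg 6 c) :=
    ((hs.toSwapState.setReg (by decide)).setReg (by decide)).setReg (by decide)
  rw [Form.one, Form.holds_and, Form.holds_and, Form.holds_and, Form.holds_and, Form.holds_eq,
    hs'.holds_outside h hs.arr1, hs'.rep.holds_solo (by decide) (by decide),
    hs'.rep.holds_free (by decide) (by decide), Form.holds_atom, One]
  simp [Expr.eval, hs.arr1, hs.reg8]

theorem swapOne_spec (h : Setting n r k E φ vl cl m root A) {W : ℕ} {al : ℕ → ℕ} {s : State}
    (hs : Searched n r E φ vl cl m root A W al s) (hW : W ∈ A)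
    (hF : (Form.ex 9 (.ex 10 (.ex 6 .one))).holds n s) :
    Ready n r k E φ vl cl m A ((swapOne.run n s).reg 9) ((swapOne.run n s).arr 1) ∧
      (swapOne.run n s).reg 12 = 1 := by
  obtain ⟨z, hz, hFz, e1⟩ := LProg.run_find hF
  obtain ⟨y, hy, hFy, e2⟩ := LProg.run_find hFz
  obtain ⟨c, hc, hFc, e3⟩ := LProg.run_find hFy
  rw [hs.holds_one h] at hFc
  obtain ⟨g1, ⟨g2, g3⟩, g4, g5, g6⟩ := hFc
  set s₁ := ((s.setReg 9 z).setReg 10 y).setReg 6 c with hs₁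
  set s₂ := (s₁.setArr 1 y W).setReg 5 z with hs₂
  have hrun : swapOne.run n s = (augment.run n s₂).setReg 12 1 := by
    rw [swapOne, LProg.run_seq, LProg.run_seq, LProg.run_seq, e1, e2, e3, LProg.run_seq,
      LProg.run_seq, LProg.run_seq]
    have : (LProg.assign 5 (.reg 9)).run n ((LProg.store 1 (.reg 10) (.reg 8)).run n s₁) = s₂ := by
      simp [LProg.run, Expr.eval, hs₁, hs₂, hs.reg8]
    rw [this]
    rfl
  have hs₂1 : s₂.arr 1 = Function.update φ y W := by
    rw [hs₂, State.setReg_arr, State.setArr_arr_self, ← hs.arr1]; rfl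
  -- In a single exchange the replaced vertex `z` is itself the one that moves on along the path.
  have hsw : Swap n r E φ (verts n vl m) A W z z {y} (Function.update φ y W) := by
    refine ⟨hW, hz, g1, hz, g1, ?_, ?_, by simp, ?_, ?_, ?_⟩
    · simp only [mem_singleton]
      rintro _ rfl
      exact ⟨mem_verts.2 ⟨hy, g2⟩, g3, g4⟩
    · simp only [mem_singleton]
      rintro _ rfl _ rfl
      exact h.irr _ hy
    · simp
    · intro u hu _
      rw [mem_singleton] at hu
      exact Function.update_of_ne hu _ _
    · left
      refine ⟨rfl, ?_⟩
      rw [Function.update_of_ne, g1]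
      rintro rfl
      exact g3 (g1 ▸ hW)
  obtain ⟨htree, hpend⟩ := hsw.pending h.inv h.symm h.sub hs.sub hs.notMem hs.tree
    (mem_found.2 ⟨hc, g5⟩) g6
  have a5 : s₂.arr 5 = s.arr 5 := by simp [hs₂, hs₁, State.setArr]
  have a6 : s₂.arr 6 = s.arr 6 := by simp [hs₂, hs₁, State.setArr]
  have a7 : s₂.arr 7 = s.arr 7 := by simp [hs₂, hs₁, State.setArr]
  have r4 : s₂.reg 4 = root := by simp [hs₂, hs₁, hs.reg4]
  have hsp := augment_spec (s := s₂) (φ := Function.update φ y W) (al := al) (r := r) (x₀ := z) h.symm h.irr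
    (by rw [HasTree, a5, a6, a7, r4]; exact htree)
    (by rw [hs₂1, a5]; simpa [hs₂, hs₁] using hpend)
  rw [a5, r4] at hsp
  have hready := hsw.ready h.inv hsp h.sub hs.sub hs.notMem
    (mem_found.2 ⟨hs.tree.root_lt, hs.tree.root_mem⟩) h.small (by simp)
  have e9 : (swapOne.run n s).reg 9 = z := by
    rw [hrun, State.setReg_reg, if_neg (by decide), augment.run_reg n s₂ (by decide)]
    simp [hs₂, hs₁]
  refine ⟨?_, by rw [hrun]; simp⟩
  rw [e9, hrun, State.setReg_arr]
  exact hready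

/-- The exchange of vertices that `swapTwo` looks for. -/
def Two (n : ℕ) (E : ℕ → ℕ → Prop) (φ vl : ℕ → ℕ) (m : ℕ) (A : Finset ℕ) (W : ℕ) (acc : ℕ → ℕ)
    (z y y' w c : ℕ) : Prop :=
  φ z = W ∧ (m ≤ vl y ∧ φ y ∉ A) ∧ (m ≤ vl y' ∧ φ y' ∉ A) ∧ ¬ E y y' ∧ y ≠ y' ∧ Solo n E φ y z ∧
    Solo n E φ y' z ∧ φ w = W ∧ w ≠ z ∧ acc c ≠ 0 ∧ Free n E φ w c

theorem Searched.holds_two {W : ℕ} {al : ℕ → ℕ} {s : State}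
    (hs : Searched n r E φ vl cl m root A W al s) (h : Setting n r k E φ vl cl m root A)
    (z y y' w c : ℕ) : Form.two.holds n
      (((((s.setReg 9 z).setReg 10 y).setReg 11 y').setReg 5 w).setReg 6 c) ↔
      Two n E φ vl m A W (s.arr 5) z y y' w c := by
  have hs' : SwapState n r E vl cl m root A
      (((((s.setReg 9 z).setReg 10 y).setReg 11 y').setReg 5 w).setReg 6 c) :=
    ((((hs.toSwapState.setReg (by decide)).setReg (by decide)).setReg (by decide)).setReg
      (by decide)).setReg (by decide)
  simp only [Form.two, Form.holds_and, Form.holds_not, Form.holds_eq]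
  rw [hs'.holds_outside h hs.arr1, hs'.holds_outside h hs.arr1,
    hs'.rep.holds_solo (by decide) (by decide), hs'.rep.holds_solo (by decide) (by decide),
    hs'.rep.holds_free (by decide) (by decide), Form.holds_atom, hs'.rep.holds_adj, Two]
  simp [Expr.eval, hs.arr1, hs.reg8]

theorem swapTwo_spec (h : Setting n r k E φ vl cl m root A)
    (hq : 2 * (#(cols r cl m) - #A) + 1 ≤ #(cols r cl m)) {W : ℕ} {al : ℕ → ℕ} {s : State}
    (hs : Searched n r E φ vl cl m root A W al s) (hW : W ∈ A)
    (hF : (Form.ex 9 (.ex 10 (.ex 11 (.ex 5 (.ex 6 .two))))).holds n s) :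
    Ready n r k E φ vl cl m A ((swapTwo.run n s).reg 9) ((swapTwo.run n s).arr 1) ∧
      (swapTwo.run n s).reg 12 = 1 := by
  obtain ⟨z, hz, hFz, e1⟩ := LProg.run_find hF
  obtain ⟨y, hy, hFy, e2⟩ := LProg.run_find hFz
  obtain ⟨y', hy', hFy', e3⟩ := LProg.run_find hFy
  obtain ⟨w, hw, hFw, e4⟩ := LProg.run_find hFy'
  obtain ⟨c, hc, hFc, e5⟩ := LProg.run_find hFw
  rw [hs.holds_two h] at hFc
  obtain ⟨g1, ⟨g2, g3⟩, ⟨g2', g3'⟩, gE, gne, g4, g4', gw, gwz, g5, g6⟩ := hFc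
  set s₁ := ((((s.setReg 9 z).setReg 10 y).setReg 11 y').setReg 5 w).setReg 6 c with hs₁
  set s₂ := ((s₁.setArr 1 z n).setArr 1 y W).setArr 1 y' W with hs₂
  have hrun : swapTwo.run n s = (augment.run n s₂).setReg 12 1 := by
    rw [swapTwo, LProg.run_seq, LProg.run_seq, LProg.run_seq, LProg.run_seq, LProg.run_seq, e1, e2,
      e3, e4, e5, LProg.run_seq, LProg.run_seq, LProg.run_seq, LProg.run_seq]
    have : (LProg.store 1 (.reg 11) (.reg 8)).run n ((LProg.store 1 (.reg 10) (.reg 8)).run n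
        ((LProg.store 1 (.reg 9) (.reg 0)).run n s₁)) = s₂ := by
      simp [LProg.run, Expr.eval, hs₁, hs₂, hs.reg8, hs.reg0]
    rw [this]
    rfl
  set φ' := Function.update (Function.update (Function.update φ z n) y W) y' W with hφ'
  have hs₂1 : s₂.arr 1 = φ' := by
    rw [hs₂, State.setArr_arr_self, State.setArr_arr_self, State.setArr_arr_self, hφ', ← hs.arr1]
    rfl
  have hzy : z ≠ y := by rintro rfl; exact g3 (g1 ▸ hW)
  have hzy' : z ≠ y' := by rintro rfl; exact g3' (g1 ▸ hW)
  -- Here `w` moves on along the path, while `z` gets the color `n ≥ r` and is thus uncolored.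
  have hsw : Swap n r E φ (verts n vl m) A W z w {y, y'} φ' := by
    refine ⟨hW, hz, g1, hw, gw, ?_, ?_, ?_, ?_, ?_, ?_⟩
    · simp only [mem_insert, mem_singleton]
      rintro _ (rfl | rfl)
      · exact ⟨mem_verts.2 ⟨hy, g2⟩, g3, g4⟩
      · exact ⟨mem_verts.2 ⟨hy', g2'⟩, g3', g4'⟩
    · simp only [mem_insert, mem_singleton]
      rintro _ (rfl | rfl) _ (rfl | rfl)
      · exact h.irr _ hy
      · exact gE
      · exact fun hE => gE (h.symm _ hy' _ hy hE)
      · exact h.irr _ hy'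
    · rw [card_pair gne, card_pair gwz.symm]
    · simp only [mem_insert, mem_singleton]
      rintro _ (rfl | rfl)
      · rw [hφ', Function.update_of_ne gne, Function.update_self]
      · rw [hφ', Function.update_self]
    · intro u hu huz
      simp only [mem_insert, mem_singleton, not_or] at hu
      rw [hφ', Function.update_of_ne hu.2, Function.update_of_ne hu.1, Function.update_of_ne huz]
    · right
      rw [hφ', Function.update_of_ne hzy', Function.update_of_ne hzy, Function.update_self]
      exact h.le
  obtain ⟨htree, hpend⟩ := hsw.pending h.inv h.symm h.sub hs.sub hs.notMem hs.tree
    (mem_found.2 ⟨hc, g5⟩) g6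
  have a5 : s₂.arr 5 = s.arr 5 := by simp [hs₂, hs₁, State.setArr]
  have a6 : s₂.arr 6 = s.arr 6 := by simp [hs₂, hs₁, State.setArr]
  have a7 : s₂.arr 7 = s.arr 7 := by simp [hs₂, hs₁, State.setArr]
  have r4 : s₂.reg 4 = root := by simp [hs₂, hs₁, hs.reg4]
  have hsp := augment_spec (s := s₂) (φ := φ') (al := al) (r := r) (x₀ := w) h.symm h.irr
    (by rw [HasTree, a5, a6, a7, r4]; exact htree)
    (by rw [hs₂1, a5]; simpa [hs₂, hs₁] using hpend)
  rw [a5, r4] at hsp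
  have hready := hsw.ready h.inv hsp h.sub hs.sub hs.notMem
    (mem_found.2 ⟨hs.tree.root_lt, hs.tree.root_mem⟩) h.small (Or.inr hq)
  have e9 : (swapTwo.run n s).reg 9 = z := by
    rw [hrun, State.setReg_reg, if_neg (by decide), augment.run_reg n s₂ (by decide)]
    simp [hs₂, hs₁]
  refine ⟨?_, by rw [hrun]; simp⟩
  rw [e9, hrun, State.setReg_arr]
  exact hready

end

end RAM

/-! ### Only the levels of actual vertices and colors matter -/

namespace MaxMin

open Finset

theorem cols_congr {r : ℕ} {cl cl' : ℕ → ℕ} (h : ∀ c < r, cl' c = cl c) (i : ℕ) :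
    cols r cl' i = cols r cl i :=
  filter_congr fun c hc => by rw [h c (mem_range.1 hc)]

theorem verts_congr {n : ℕ} {vl vl' : ℕ → ℕ} (h : ∀ v < n, vl' v = vl v) (i : ℕ) :
    verts n vl' i = verts n vl i :=
  filter_congr fun c hc => by rw [h c (mem_range.1 hc)]

theorem pot_congr {n r k : ℕ} {φ cl cl' : ℕ → ℕ} {m : ℕ} (h : ∀ c < r, cl' c = cl c) :
    pot n r k φ cl' m = pot n r k φ cl m :=
  sum_congr rfl fun c hc => by rw [cols_congr h, h c (mem_range.1 hc)]

theorem Inv.congr {n r k : ℕ} {E : ℕ → ℕ → Prop} {φ vl vl' cl cl' : ℕ → ℕ} {m : ℕ}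
    (hI : Inv n r k E φ vl cl m) (hv : ∀ v < n, vl' v = vl v) (hc : ∀ c < r, cl' c = cl c) :
    Inv n r k E φ vl' cl' m where
  proper := hI.proper
  size := hI.size
  act v hvn hφ i hi := by rw [hv v hvn, hc _ hφ]; exact hI.act v hvn hφ i hi
  deg i hi := by rw [verts_congr hv, cols_congr hc]; exact hI.deg i hi
  large i hi := by rw [verts_congr hv, cols_congr hc]; exact hI.large i hi

end MaxMin

namespace RAM

open MaxMin Finset

/-! ## The recoloring algorithm -/

/-- Admit all active classes to the search. -/
def admitAll : LProg :=
  setIf 9 (.and (.lt (.reg 20) (.reg 1)) (.not (.lt (.get 3 (.reg 20)) (.reg 3)))) (.const 1)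
    (.const 0)

/-- Color a new vertex after recoloring along a path. -/
def growStep : LProg :=
  .seq (.find 5 (.ex 6 .grow)) (.seq (.find 6 .grow) augment)

/-- Try all swaps. -/
def swaps : LProg :=
  .seq (.loop 8 (attempt (.ex 9 (.ex 10 (.ex 6 .one))) swapOne))
    (.loop 8 (attempt (.ex 9 (.ex 10 (.ex 11 (.ex 5 (.ex 6 .two))))) swapTwo))

/-- Go up one level; the accessible classes and the vertex `9` stay behind. -/
def push : LProg :=
  .seq (setIf 3 (.and (.not (.lt (.get 3 (.reg 20)) (.reg 3))) (.not (.atom (.get 10 (.reg 20)))))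
    (.add (.reg 3) (.const 1)) (.sub (.get 3 (.reg 20)) (.sub (.get 3 (.reg 20)) (.reg 3))))
  (.seq (setIf 4 (.and (.outside 20) (.not (.eq (.reg 20) (.reg 9))))
    (.add (.reg 3) (.const 1)) (.sub (.get 4 (.reg 20)) (.sub (.get 4 (.reg 20)) (.reg 3))))
  (.assign 3 (.add (.reg 3) (.const 1))))

/-- Swap and go up one level. -/
def swapPhase : LProg :=
  .seq (setIf 10 (.atom (.get 5 (.reg 20))) (.const 1) (.const 0))
    (.seq (.assign 12 (.const 0)) (.seq swaps push))

/-- One round of the recoloring algorithm. -/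
def iter : LProg :=
  .seq sizes (.ite (.ex 4 .small)
    (.seq (.find 4 .small) (.seq admitAll (.seq reach (.ite (.ex 5 (.ex 6 .grow)) growStep swapPhase))))
    (.assign 3 (.sub (.reg 3) (.const 1))))

section

variable {n r k : ℕ} {E : ℕ → ℕ → Prop} {φ vl cl : ℕ → ℕ} {m root : ℕ} {A : Finset ℕ}

/-- Register `12` is the success flag. While it is `0` the coloring is `φ` and each class tried is
recorded with its failed search; after a success the remaining turns preserve the coloring and the
hidden vertex. -/
theorem attempts_spec (h : Setting n r k E φ vl cl m root A) {F : Form} {p : LProg} {s : State}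
    (hr : ∀ x ∈ [0, 1, 3, 4], x ∉ (LProg.loop 8 (attempt F p)).regs)
    (ha : ∀ a ∈ [0, 2, 3, 4, 10], a ∉ (LProg.loop 8 (attempt F p)).arrs)
    (hs : SwapState n r E vl cl m root A s)
    (hsucc : s.reg 12 = 0 → ∀ W ∈ A, ∀ al t, Searched n r E φ vl cl m root A W al t →
      F.holds n t → Ready n r k E φ vl cl m A ((p.run n t).reg 9) ((p.run n t).arr 1) ∧
        (p.run n t).reg 12 = 1)
    (h0 : s.reg 12 = 0 ∧ s.arr 1 = φ ∨
      s.reg 12 ≠ 0 ∧ Ready n r k E φ vl cl m A (s.reg 9) (s.arr 1)) :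
    (((LProg.loop 8 (attempt F p)).run n s).reg 12 = 0 ∧
      ((LProg.loop 8 (attempt F p)).run n s).arr 1 = φ ∧ s.reg 12 = 0 ∧
      ∀ W ∈ A, W ≠ root → ∃ al t, Searched n r E φ vl cl m root A W al t ∧ ¬ F.holds n t) ∨
    (((LProg.loop 8 (attempt F p)).run n s).reg 12 ≠ 0 ∧
      Ready n r k E φ vl cl m A (((LProg.loop 8 (attempt F p)).run n s).reg 9)
        (((LProg.loop 8 (attempt F p)).run n s).arr 1)) := by
  have key := LProg.loop_inv' (n := n) (x := 8) (p := attempt F p) (s := s) (fun i t =>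
    (t.reg 12 = 0 ∧ t.arr 1 = φ ∧ s.reg 12 = 0 ∧ ∀ W < i, W ∈ A → W ≠ root →
      ∃ al t, Searched n r E φ vl cl m root A W al t ∧ ¬ F.holds n t) ∨
    (t.reg 12 ≠ 0 ∧ Ready n r k E φ vl cl m A (t.reg 9) (t.arr 1))) ?_ ?_
  · exact key.imp (fun g => ⟨g.1, g.2.1, g.2.2.1, fun W hW => g.2.2.2 W (h.lt hW) hW⟩) id
  · exact h0.imp (fun g => ⟨g.1, g.2, g.1, by simp⟩) id
  · intro i hi t htr hta hI
    have ht : SwapState n r E vl cl m root A (t.setReg 8 i) :=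
      (hs.congr (fun x hx => htr x (hr x hx)) (fun a hx => hta a (ha a hx))).setReg (by decide)
    have h8 : (t.setReg 8 i).reg 8 = i := by simp
    rcases hI with ⟨g1, g2, g3, g4⟩ | ⟨g1, g2⟩
    · by_cases hiA : i ∈ A ∧ i ≠ root
      · obtain ⟨al, t', k1, k2, k3, k4⟩ := attempt_spec h (F := F) (p := p) ht g2 (by simpa using g1)
          (by rw [h8]; exact hiA.1) (by rw [h8]; exact hiA.2)
        rw [h8] at k1
        by_cases hF : F.holds n t'
        · right
          rw [k3 hF]
          obtain ⟨q1, q2⟩ := hsucc g3 i hiA.1 al t' k1 hF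
          exact ⟨by rw [q2]; decide, q1⟩
        · left
          rw [k4 hF]
          refine ⟨k2, k1.arr1, g3, fun W hW hWA hWr => ?_⟩
          by_cases hWi : W = i
          · subst hWi; exact ⟨al, t', k1, hF⟩
          · exact g4 W (by omega) hWA hWr
      · obtain ⟨k1, k2, k3⟩ := attempt_skip (F := F) (p := p) ht (by
          right
          rw [h8, ht.arr10]
          by_cases hr : i = root
          · exact Or.inr hr
          · exact Or.inl ⟨fun hA => hiA ⟨hA, hr⟩, hi⟩)
        left
        rw [k1, k2]
        refine ⟨by simpa using g1, g2, g3, fun W hW hWA hWr => ?_⟩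
        by_cases hWi : W = i
        · subst hWi; exact absurd ⟨hWA, hWr⟩ hiA
        · exact g4 W (by omega) hWA hWr
    · obtain ⟨k1, k2, k3⟩ := attempt_skip (F := F) (p := p) ht (Or.inl (by simpa using g1))
      right
      rw [k1, k2, k3]
      exact ⟨by simpa using g1, by simpa using g2⟩

/-- Failure of all single exchanges is exactly the hypothesis of `Stuck.exists_swap`, whose
configuration the second loop would then detect. If the first loop succeeds, the second one only
skips. -/
theorem swaps_spec (h : Setting n r k E φ vl cl m root A)
    (hst : Stuck n k E φ (verts n vl m) (cols r cl m) A root) {s : State}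
    (hs : SwapState n r E vl cl m root A s) (h1 : s.arr 1 = φ) (h12 : s.reg 12 = 0) :
    Ready n r k E φ vl cl m A ((swaps.run n s).reg 9) ((swaps.run n s).arr 1) := by
  rw [swaps, LProg.run_seq]
  set p₁ := LProg.loop 8 (attempt (.ex 9 (.ex 10 (.ex 6 .one))) swapOne)
  have hs₁ : SwapState n r E vl cl m root A (p₁.run n s) := hs.run p₁ (by decide) (by decide)
  have k₁ := attempts_spec h (by decide) (by decide) hs
    (fun _ W hW al t ht hF => swapOne_spec h ht hW hF) (Or.inl ⟨h12, h1⟩)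
  rcases k₁ with ⟨g1, g2, -, g3⟩ | ⟨g1, g2⟩
  · obtain ⟨hq, W, hW, hWr, z, hz, hzW, y, hy, hyA, y', hy', hyA', hne, hE, hso, hso', w, hw, hwW,
        hwz, c, hc, hF⟩ := hst.exists_swap (by
      intro W hW hWr z hz hzW c hc hF y hy hyA hso
      obtain ⟨al, t, ht, hno⟩ := g3 W hW hWr
      rw [mem_verts] at hy
      exact hno ⟨z, hz, y, hy.1, c, h.lt hc.2.1, (ht.holds_one h z y c).2
        ⟨hzW, ⟨hy.2, hyA⟩, hso, ht.avoid c hc, hF⟩⟩)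
    have k₂ := attempts_spec h (by decide) (by decide) hs₁
      (fun _ W hW al t ht hF => swapTwo_spec h hq ht hW hF) (Or.inl ⟨g1, g2⟩)
    rcases k₂ with ⟨-, -, -, g4⟩ | ⟨-, g4⟩
    · obtain ⟨al, t, ht, hno⟩ := g4 W hW hWr
      rw [mem_verts] at hy hy'
      exact absurd ⟨z, hz, y, hy.1, y', hy'.1, w, hw, c, h.lt hc.2.1,
        (ht.holds_two h z y y' w c).2 ⟨hzW, ⟨hy.2, hyA⟩, ⟨hy'.2, hyA'⟩, hE, hne, hso, hso', hwW, hwz,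
          ht.avoid c hc, hF⟩⟩ hno
    · exact g4
  · have k₂ := attempts_spec h (F := .ex 9 (.ex 10 (.ex 11 (.ex 5 (.ex 6 .two))))) (p := swapTwo)
      (by decide) (by decide) hs₁ (fun g => absurd g g1) (Or.inr ⟨g1, g2⟩)
    rcases k₂ with ⟨-, -, g4, -⟩ | ⟨-, g4⟩
    · exact absurd g4 g1
    · exact g4

theorem push_spec (h : Setting n r k E φ vl cl m root A)
    (hst : Stuck n k E φ (verts n vl m) (cols r cl m) A root) {s : State}
    (hs : SwapState n r E vl cl m root A s)
    (hr : Ready n r k E φ vl cl m A (s.reg 9) (s.arr 1)) :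
    (push.run n s).arr 1 = s.arr 1 ∧ (push.run n s).reg 3 = m + 1 ∧
      Inv n r k E (s.arr 1) ((push.run n s).arr 4) ((push.run n s).arr 3) (m + 1) ∧
      pot n r k (s.arr 1) ((push.run n s).arr 3) (m + 1) < pot n r k φ cl m := by
  have hmem : ∀ c < n, c ∈ A ↔ s.arr 10 c ≠ 0 := fun c hc => by
    rw [← hs.arr10, mem_found]; exact and_iff_right hc
  have hcol : ∀ v, s.arr 1 v ∈ A ↔ s.arr 1 v < r ∧ s.arr 10 (s.arr 1 v) ≠ 0 := by
    intro v
    constructor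
    · intro hA
      exact ⟨(mem_cols.1 (h.sub hA)).1, (hmem _ (h.lt hA)).1 hA⟩
    · rintro ⟨hr, h0⟩
      exact (hmem _ (hr.trans_le h.le)).2 h0
  rw [push, LProg.run_seq, LProg.run_seq]
  set p := setIf 3 (.and (.not (.lt (.get 3 (.reg 20)) (.reg 3)))
    (.not (.atom (.get 10 (.reg 20))))) (.add (.reg 3) (.const 1))
    (.sub (.get 3 (.reg 20)) (.sub (.get 3 (.reg 20)) (.reg 3)))
  set q := setIf 4 (.and (.outside 20) (.not (.eq (.reg 20) (.reg 9))))
    (.add (.reg 3) (.const 1)) (.sub (.get 4 (.reg 20)) (.sub (.get 4 (.reg 20)) (.reg 3)))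
  set s₁ := p.run n s with hs₁
  set s₂ := q.run n s₁ with hs₂
  have a₁ : ∀ a, a ∉ p.arrs → s₁.arr a = s.arr a := fun a ha => p.run_arr n s ha
  have b₁ : ∀ a, a ∉ p.regs → s₁.reg a = s.reg a := fun a ha => p.run_reg n s ha
  -- The truncated expression `a - (a - m)` is `min a m`: it resets settled active entries to `m`
  -- and leaves lower levels alone.
  have hcl : ∀ c < n, s₁.arr 3 c = pushLevel cl m (· ∈ A) c := by
    intro c hc
    have := setIf_spec (n := n) (a := 3) (s := s) (F := .and (.not (.lt (.get 3 (.reg 20)) (.reg 3)))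
      (.not (.atom (.get 10 (.reg 20))))) (e₁ := .add (.reg 3) (.const 1))
      (e₂ := .sub (.get 3 (.reg 20)) (.sub (.get 3 (.reg 20)) (.reg 3)))
      (fun c => m ≤ cl c ∧ c ∉ A) (fun _ => m + 1) (fun c => cl c - (cl c - m)) (by
        intro i hi s' hr ha hai h20
        rw [Form.holds_and, Form.holds_not, Form.holds_not, Form.holds_lt, Form.holds_atom, hmem i hi]
        simp [Expr.eval, h20, hr, ha, hai, hs.arr3, hs.reg3]) c hc
    rw [hs₁, this, pushLevel]
    split_ifs <;> first | omega | (exfalso; tauto)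
  have hvl : ∀ v < n, s₂.arr 4 v = pushLevel vl m (fun v => s.arr 1 v ∈ A ∨ v = s.reg 9) v := by
    intro v hv
    have := setIf_spec (n := n) (a := 4) (s := s₁) (F := .and (.outside 20)
      (.not (.eq (.reg 20) (.reg 9)))) (e₁ := .add (.reg 3) (.const 1))
      (e₂ := .sub (.get 4 (.reg 20)) (.sub (.get 4 (.reg 20)) (.reg 3)))
      (fun v => m ≤ vl v ∧ ¬ (s.arr 1 v ∈ A ∨ v = s.reg 9)) (fun _ => m + 1)
      (fun v => vl v - (vl v - m)) (by
        intro i hi s' hr ha hai h20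
        rw [Form.holds_and, Form.outside, Form.holds_and, Form.holds_not, Form.holds_not,
          Form.holds_not, Form.holds_and, Form.holds_lt, Form.holds_lt, Form.holds_atom,
          Form.holds_eq, hcol]
        have e1 : s₁.arr 1 = s.arr 1 := a₁ 1 (by decide)
        have e4 : s₁.arr 4 = s.arr 4 := a₁ 4 (by decide)
        have e10 : s₁.arr 10 = s.arr 10 := a₁ 10 (by decide)
        have f1 : s₁.reg 1 = s.reg 1 := b₁ 1 (by decide)
        have f3 : s₁.reg 3 = s.reg 3 := b₁ 3 (by decide)
        have f9 : s₁.reg 9 = s.reg 9 := b₁ 9 (by decide)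
        simp [Expr.eval, h20, hr, ha, hai, hs.arr4, hs.reg3, hs.reg1, e1, e4, e10, f1, f3, f9]
        tauto) v hv
    rw [hs₂, this, pushLevel]
    split_ifs <;> first | omega | (exfalso; tauto)
  have hcl' : ∀ c < r, s₂.arr 3 c = pushLevel cl m (· ∈ A) c := by
    intro c hc
    have : s₂.arr 3 = s₁.arr 3 := q.run_arr n s₁ (by decide)
    rw [this, hcl c (hc.trans_le h.le)]
  obtain ⟨e, he, he'⟩ := hr.cov_le
  obtain ⟨k1, k2⟩ := h.inv.push hr.recolored h.sub h.root_mem hr.cov_eq he he' hr.hidden hr.outside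
    hst.nbr
  refine ⟨(q.run_arr n s₁ (by decide)).trans (a₁ 1 (by decide)), ?_, ?_, ?_⟩
  · have e1 : s₂.reg 3 = s₁.reg 3 := q.run_reg n s₁ (by decide)
    have e2 : s₁.reg 3 = s.reg 3 := b₁ 3 (by decide)
    simp [LProg.run, Expr.eval, e1, e2, hs.reg3]
  · exact k1.congr hvl hcl'
  · have : ((LProg.assign 3 (.add (.reg 3) (.const 1))).run n s₂).arr 3 = s₂.arr 3 := rfl
    rw [this, pot_congr hcl']
    exact k2

end

/-- The parameters of the recoloring algorithm. -/
structure Params (n r k : ℕ) (E : ℕ → ℕ → Prop) (s : State) : Prop where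
  rep : Represents s E
  reg0 : s.reg 0 = n
  reg1 : s.reg 1 = r
  reg2 : s.reg 2 = k

theorem Params.run {n r k : ℕ} {E : ℕ → ℕ → Prop} {s : State} (h : Params n r k E s) (p : LProg)
    (hr : ∀ x ∈ [0, 1, 2], x ∉ p.regs) (ha : ∀ a ∈ [0, 2], a ∉ p.arrs) :
    Params n r k E (p.run n s) where
  rep := h.rep.congr (p.run_arr n s (ha 0 (by simp))) (p.run_arr n s (ha 2 (by simp)))
  reg0 := (p.run_reg n s (hr 0 (by simp))).trans h.reg0
  reg1 := (p.run_reg n s (hr 1 (by simp))).trans h.reg1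
  reg2 := (p.run_reg n s (hr 2 (by simp))).trans h.reg2

/-- The potential of a state. -/
def spot (n r k : ℕ) (s : State) : ℕ := pot n r k (s.arr 1) (s.arr 3) (s.reg 3)

theorem swapPhase_spec {n r k : ℕ} {E : ℕ → ℕ → Prop} {s : State}
    (hsymm : ∀ u < n, ∀ v < n, E u v → E v u) (hirr : ∀ u < n, ¬ E u u) (hrn : r ≤ n)
    (hs : Params n r k E s) (hI : Inv n r k E (s.arr 1) (s.arr 4) (s.arr 3) (s.reg 3))
    (hsmall : #(cls n (s.arr 1) (s.reg 4)) < k)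
    (hst : Stuck n k E (s.arr 1) (verts n (s.arr 4) (s.reg 3)) (cols r (s.arr 3) (s.reg 3))
      (found n (s.arr 5)) (s.reg 4)) :
    Inv n r k E ((swapPhase.run n s).arr 1) ((swapPhase.run n s).arr 4) ((swapPhase.run n s).arr 3)
      ((swapPhase.run n s).reg 3) ∧ spot n r k (swapPhase.run n s) < spot n r k s ∧
      (swapPhase.run n s).reg 3 = s.reg 3 + 1 := by
  rw [swapPhase, LProg.run_seq, LProg.run_seq, LProg.run_seq]
  set q := setIf 10 (.atom (.get 5 (.reg 20))) (.const 1) (.const 0)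
  set s₁ := q.run n s with hs₁
  have h10 : ∀ c < n, s₁.arr 10 c = if s.arr 5 c ≠ 0 then 1 else 0 := by
    refine setIf_spec (fun c => s.arr 5 c ≠ 0) (fun _ => 1) (fun _ => 0) ?_
    intro i hi s' hr ha hai h20
    rw [Form.holds_atom]
    simp [Expr.eval, h20, ha]
  have hA : found n (s₁.arr 10) = found n (s.arr 5) := by
    ext c
    simp only [mem_found]
    refine and_congr_right fun hc => ?_
    rw [h10 c hc]
    split_ifs with h <;> simp [h]
  have hp₁ : Params n r k E s₁ := hs.run q (by decide) (by decide)
  set s₂ := (LProg.assign 12 (.const 0)).run n s₁ with hs₂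
  have hsw : SwapState n r E (s.arr 4) (s.arr 3) (s.reg 3) (s.reg 4) (found n (s.arr 5)) s₁ :=
    ⟨hp₁.rep, hp₁.reg0, hp₁.reg1, q.run_reg n s (by decide), q.run_reg n s (by decide),
      q.run_arr n s (by decide), q.run_arr n s (by decide), hA⟩
  have hset : Setting n r k E (s.arr 1) (s.arr 4) (s.arr 3) (s.reg 3) (s.reg 4)
      (found n (s.arr 5)) := ⟨hsymm, hirr, hrn, hI, hst.sub, hst.root, hsmall⟩
  have hsw₂ := hsw.run (.assign 12 (.const 0)) (by decide) (by decide)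
  have hready := swaps_spec hset hst hsw₂ (q.run_arr n s (by decide) : s₁.arr 1 = s.arr 1)
    (by simp [LProg.run, Expr.eval])
  have hsw₃ := hsw₂.run swaps (by decide) (by decide)
  obtain ⟨k1, k2, k3, k4⟩ := push_spec hset hst hsw₃ hready
  rw [spot, spot, k1, k2]
  exact ⟨k3, k4, rfl⟩

theorem growStep_spec {n r k : ℕ} {E : ℕ → ℕ → Prop} {al : ℕ → ℕ} {s : State}
    (hsymm : ∀ u < n, ∀ v < n, E u v → E v u) (hirr : ∀ u < n, ¬ E u u)
    (hs : Params n r k E s) (hI : Inv n r k E (s.arr 1) (s.arr 4) (s.arr 3) (s.reg 3))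
    (hsmall : #(cls n (s.arr 1) (s.reg 4)) < k)
    (ht : HasTree n E (s.arr 1) al (s.reg 4) s)
    (hsub : found n (s.arr 5) ⊆ cols r (s.arr 3) (s.reg 3))
    (hF : (Form.ex 5 (.ex 6 .grow)).holds n s) :
    Inv n r k E ((growStep.run n s).arr 1) (s.arr 4) (s.arr 3) (s.reg 3) ∧
      pot n r k ((growStep.run n s).arr 1) (s.arr 3) (s.reg 3) < spot n r k s := by
  obtain ⟨x, hx, hFx, e1⟩ := LProg.run_find hF
  obtain ⟨c, hc, hFc, e2⟩ := LProg.run_find hFx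
  rw [growStep, LProg.run_seq, LProg.run_seq, e1, e2]
  have hrep : Represents ((s.setReg 5 x).setReg 6 c) E := hs.rep
  rw [Form.grow, Form.holds_and, Form.holds_and, Form.holds_and, Form.holds_not, Form.holds_not,
    Form.holds_lt, Form.holds_lt, Form.holds_atom, hrep.holds_free (by decide) (by decide)] at hFc
  simp [Expr.eval, hs.reg1] at hFc
  obtain ⟨g1, g2, g3, g4⟩ := hFc
  have haug := augment_spec (n := n) (r := r) (E := E) (φ := s.arr 1) (al := al) (x₀ := x)
    (s := (s.setReg 5 x).setReg 6 c) hsymm hirr (by simpa [HasTree] using ht)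
    (by
      simp only [State.setReg_reg, State.setReg_arr]
      refine Pending.init (mem_found.2 ⟨hc, g3⟩) hx ?_ ?_ g4
      · intro hcon
        have := (mem_cols.1 (hsub hcon)).1
        omega
      · intro u hu w hw _ _
        exact hI.proper u hu w hw)
  simp only [State.setReg_arr] at haug
  have h4 : ((s.setReg 5 x).setReg 6 c).reg 4 = s.reg 4 := by simp
  rw [h4] at haug
  exact haug.grow hI hx g2 g1 hsub (mem_found.2 ⟨ht.root_lt, ht.root_mem⟩) hsmall

/-- Growth lowers the potential at the same level; an exchange lowers it while the level rises by
one; without small active classes the level drops and the potential stays. The factor `2` makes all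
three decrease the sum. At level `0` the level cannot drop, but then the absence of small classes
means potential `0`. -/
theorem iter_spec {n r k : ℕ} {E : ℕ → ℕ → Prop} {s : State}
    (hsymm : ∀ u < n, ∀ v < n, E u v → E v u) (hirr : ∀ u < n, ¬ E u u) (hrn : r ≤ n)
    (hs : Params n r k E s) (hI : Inv n r k E (s.arr 1) (s.arr 4) (s.arr 3) (s.reg 3)) :
    Inv n r k E ((iter.run n s).arr 1) ((iter.run n s).arr 4) ((iter.run n s).arr 3)
      ((iter.run n s).reg 3) ∧ spot n r k (iter.run n s) ≤ spot n r k s ∧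
      (spot n r k (iter.run n s) = 0 ∨
        2 * spot n r k (iter.run n s) + (iter.run n s).reg 3 < 2 * spot n r k s + s.reg 3) := by
  have hsz : ∀ c < n, (sizes.run n s).arr 8 c = #(cls n (s.arr 1) c) := sizes_spec
  rw [iter, LProg.run_seq]
  have hs₁ := hs.run sizes (by decide) (by decide)
  have e1 : (sizes.run n s).arr 1 = s.arr 1 := sizes.run_arr n s (by decide)
  have e3 : (sizes.run n s).arr 3 = s.arr 3 := sizes.run_arr n s (by decide)
  have e4 : (sizes.run n s).arr 4 = s.arr 4 := sizes.run_arr n s (by decide)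
  have f3 : (sizes.run n s).reg 3 = s.reg 3 := sizes.run_reg n s (by decide)
  have hspot : spot n r k s = spot n r k (sizes.run n s) := by rw [spot, spot, e1, e3, f3]
  rw [hspot, ← f3]
  rw [← e1, ← e3, ← e4, ← f3] at hI
  rw [← e1] at hsz
  clear e1 e3 e4 f3 hspot hs
  generalize sizes.run n s = s₁ at hs₁ hI hsz ⊢
  have hsmall : ∀ c < n, Form.small.holds n (s₁.setReg 4 c) ↔
      c ∈ cols r (s₁.arr 3) (s₁.reg 3) ∧ #(cls n (s₁.arr 1) c) < k := by
    intro c hc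
    rw [Form.small, Form.holds_and, Form.holds_and, Form.holds_not, Form.holds_lt, Form.holds_lt,
      Form.holds_lt, mem_cols, ← hsz c hc]
    simp [Expr.eval, hs₁.reg1, hs₁.reg2, and_assoc]
  by_cases hF : (Form.ex 4 .small).holds n s₁
  · rw [LProg.run_ite_pos hF, LProg.run_seq, LProg.run_seq, LProg.run_seq]
    obtain ⟨c, hc, hFc, e⟩ := LProg.run_find hF
    rw [hsmall c hc] at hFc
    rw [e]
    set s₂ := s₁.setReg 4 c with hs₂
    have hp₃ : Params n r k E (admitAll.run n s₂) :=
      Params.run (⟨hs₁.rep, hs₁.reg0, hs₁.reg1, hs₁.reg2⟩ : Params n r k E s₂) admitAll (by decide)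
        (by decide)
    have hal : ∀ i < n, (admitAll.run n s₂).arr 9 i =
        if i ∈ cols r (s₁.arr 3) (s₁.reg 3) then 1 else 0 := by
      refine setIf_spec (fun i => i ∈ cols r (s₁.arr 3) (s₁.reg 3)) (fun _ => 1) (fun _ => 0) ?_
      intro i hi s' hr ha hai h20
      rw [Form.holds_and, Form.holds_not, Form.holds_lt, Form.holds_lt, mem_cols]
      simp [Expr.eval, h20, ha, hr, hs₂, hs₁.reg1]
    set s₃ := admitAll.run n s₂ with hs₃
    have hal' : ∀ i < n, s₃.arr 9 i ≠ 0 ↔ i ∈ cols r (s₁.arr 3) (s₁.reg 3) := by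
      intro i hi
      rw [hal i hi]
      split_ifs with h <;> simp [h]
    have a1 : s₃.arr 1 = s₁.arr 1 := admitAll.run_arr n s₂ (by decide)
    have a3 : s₃.arr 3 = s₁.arr 3 := admitAll.run_arr n s₂ (by decide)
    have a4 : s₃.arr 4 = s₁.arr 4 := admitAll.run_arr n s₂ (by decide)
    have b3 : s₃.reg 3 = s₁.reg 3 := (admitAll.run_reg n s₂ (by decide)).trans (by simp [hs₂])
    have b4 : s₃.reg 4 = c := (admitAll.run_reg n s₂ (by decide)).trans (by simp [hs₂])
    obtain ⟨htree, hclosed⟩ := reach_spec hp₃.rep (by rwa [b4])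
      (by rw [b4, hal' c hc]; exact hFc.1)
    have hp₄ := hp₃.run reach (by decide) (by decide)
    have c1 : (reach.run n s₃).arr 1 = s₁.arr 1 := (reach.run_arr n s₃ (by decide)).trans a1
    have c3 : (reach.run n s₃).arr 3 = s₁.arr 3 := (reach.run_arr n s₃ (by decide)).trans a3
    have c4 : (reach.run n s₃).arr 4 = s₁.arr 4 := (reach.run_arr n s₃ (by decide)).trans a4
    have d3 : (reach.run n s₃).reg 3 = s₁.reg 3 := (reach.run_reg n s₃ (by decide)).trans b3
    have d4 : (reach.run n s₃).reg 4 = c := (reach.run_reg n s₃ (by decide)).trans b4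
    have hspot : spot n r k s₁ = spot n r k (reach.run n s₃) := by rw [spot, spot, c1, c3, d3]
    rw [hspot, ← d3]
    rw [← c1, ← c3, ← c4, ← d3] at hI
    rw [← c3, ← d3] at hal'
    rw [← c1, ← c3, ← d3, ← d4] at hFc
    rw [a1, ← c1, b4, ← d4] at htree
    rw [a1, ← c1] at hclosed
    generalize s₃.arr 9 = al at htree hclosed hal'
    generalize reach.run n s₃ = s₄ at htree hclosed hp₄ hI hal' hFc ⊢
    have hsub : found n (s₄.arr 5) ⊆ cols r (s₄.arr 3) (s₄.reg 3) := fun c hc => by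
      rw [mem_found] at hc
      exact (hal' c hc.1).1 (htree.mem c hc.1 hc.2)
    by_cases hG : (Form.ex 5 (.ex 6 .grow)).holds n s₄
    · rw [LProg.run_ite_pos hG]
      obtain ⟨k1, k2⟩ := growStep_spec hsymm hirr hp₄ hI hFc.2 htree hsub hG
      have g3 : (growStep.run n s₄).arr 3 = s₄.arr 3 := growStep.run_arr n s₄ (by decide)
      have g4 : (growStep.run n s₄).arr 4 = s₄.arr 4 := growStep.run_arr n s₄ (by decide)
      have q3 : (growStep.run n s₄).reg 3 = s₄.reg 3 := growStep.run_reg n s₄ (by decide)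
      rw [spot, g3, g4, q3]
      exact ⟨k1, k2.le, Or.inr (by omega)⟩
    · rw [LProg.run_ite_neg hG]
      have hst := hI.stuck hsymm hrn hal' hFc.2 htree hclosed (by
        intro x hx hxm hφ d hd hfree
        rw [mem_found] at hd
        refine hG ⟨x, hx, d, hd.1, ?_⟩
        have hrep : Represents ((s₄.setReg 5 x).setReg 6 d) E := hp₄.rep
        rw [Form.grow, Form.holds_and, Form.holds_and, Form.holds_and, Form.holds_not,
          Form.holds_not, Form.holds_lt, Form.holds_lt, Form.holds_atom,
          hrep.holds_free (by decide) (by decide)]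
        simp [Expr.eval, hp₄.reg1]
        exact ⟨hφ, hxm, hd.2, hfree⟩)
      obtain ⟨k1, k2, k3⟩ := swapPhase_spec hsymm hirr hrn hp₄ hI hFc.2 hst
      exact ⟨k1, k2.le, Or.inr (by omega)⟩
  · rw [LProg.run_ite_neg hF]
    have hfull : ∀ c ∈ cols r (s₁.arr 3) (s₁.reg 3), k ≤ #(cls n (s₁.arr 1) c) := by
      intro c hc
      by_contra! hlt
      have hcn := (mem_cols.1 hc).1.trans_le hrn
      exact hF ⟨c, hcn, (hsmall c hcn).2 ⟨hc, hlt⟩⟩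
    have hrun : (LProg.assign 3 (.sub (.reg 3) (.const 1))).run n s₁ =
        s₁.setReg 3 (s₁.reg 3 - 1) := rfl
    rw [hrun]
    have hsp : spot n r k (s₁.setReg 3 (s₁.reg 3 - 1)) = spot n r k s₁ := by
      rw [spot, spot, State.setReg_arr, State.setReg_reg, if_pos rfl, pot_pop hfull]
    rw [hsp]
    refine ⟨by simpa using hI.pop, le_rfl, ?_⟩
    rcases Nat.eq_zero_or_pos (s₁.reg 3) with h0 | h0
    · left
      rw [h0] at hfull
      rw [spot, h0]
      exact pot_eq_zero hfull
    · right
      simp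
      omega

end RAM

/-! ### The initial configuration and the supply of free colors -/

namespace MaxMin

open Finset

theorem Inv.init {n r k : ℕ} {E : ℕ → ℕ → Prop} {φ vl cl : ℕ → ℕ} (hrn : r ≤ n)
    (hφ : ∀ v < n, φ v = n) (hdeg : ∀ v < n, ∀ [DecidablePred (E v)], #{u ∈ range n | E v u} < r)
    (hlarge : r * (k + 1) ≤ n) : Inv n r k E φ vl cl 0 := by
  have hv : verts n vl 0 = range n := filter_true_of_mem fun _ _ => Nat.zero_le _
  have hc : cols r cl 0 = range r := filter_true_of_mem fun _ _ => Nat.zero_le _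
  refine ⟨?_, ?_, ?_, ?_, ?_⟩
  · intro u hu v _ _ hr
    rw [hφ u hu] at hr
    omega
  · intro c hc
    have : cls n φ c = ∅ := by
      refine filter_eq_empty_iff.2 fun v hv => ?_
      rw [hφ v (mem_range.1 hv)]
      omega
    simp [this]
  · intro v hv hr
    rw [hφ v hv] at hr
    omega
  · intro i hi v hvi _
    obtain rfl : i = 0 := by omega
    rw [hv, hc, card_range]
    exact hdeg v (mem_verts.1 hvi).1
  · intro i hi
    obtain rfl : i = 0 := by omega
    rw [hv, hc, card_range, card_range]
    exact hlarge

theorem pot_le {n r k : ℕ} {φ cl : ℕ → ℕ} {m : ℕ} : pot n r k φ cl m ≤ r * (r * k) := by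
  calc pot n r k φ cl m ≤ ∑ _c ∈ range r, r * k := by
        refine sum_le_sum fun c _ => Nat.mul_le_mul ?_ (Nat.sub_le _ _)
        exact (card_le_card (filter_subset _ _)).trans (card_range r).le
    _ = r * (r * k) := by simp

theorem exists_free {n r : ℕ} {E : ℕ → ℕ → Prop} {φ : ℕ → ℕ} {v : ℕ}
    (hdeg : ∀ [DecidablePred (E v)], #{u ∈ range n | E v u} < r) : ∃ c < r, Free n E φ v c := by
  classical
  by_contra! hcon
  have : range r ⊆ ({u ∈ range n | E v u} : Finset ℕ).image φ := by
    intro c hc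
    have hF := hcon c (mem_range.1 hc)
    simp only [Free] at hF
    push Not at hF
    obtain ⟨u, hu, hE, he⟩ := hF
    exact mem_image.2 ⟨u, by simp [hu, hE], he⟩
  have h1 := (card_le_card this).trans card_image_le
  rw [card_range] at h1
  exact absurd hdeg (by omega)

end MaxMin

namespace RAM

open MaxMin Finset

/-! ## The main loop -/

/-- Repeat the rounds of the recoloring algorithm. -/
def recolor : LProg := .loop 24 (.loop 25 (.seq iter iter))

/-- The measure starts at most at `2 * (r * (r * k)) ≤ 2 * (n * n)`. Two rounds in each turn of a
double loop make `2 * (n * n)` rounds, which exhaust it. -/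
theorem recolor_spec {n r k : ℕ} {E : ℕ → ℕ → Prop} {s : State}
    (hsymm : ∀ u < n, ∀ v < n, E u v → E v u) (hirr : ∀ u < n, ¬ E u u) (hrn : r ≤ n)
    (hrk : r * k ≤ n) (hs : Params n r k E s) (hm : s.reg 3 = 0)
    (hI : Inv n r k E (s.arr 1) (s.arr 4) (s.arr 3) (s.reg 3)) :
    Inv n r k E ((recolor.run n s).arr 1) ((recolor.run n s).arr 4) ((recolor.run n s).arr 3)
      ((recolor.run n s).reg 3) ∧ ∀ c < r, k ≤ #(cls n ((recolor.run n s).arr 1) c) := by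
  let J : ℕ → State → Prop := fun j t => Params n r k E t ∧
    Inv n r k E (t.arr 1) (t.arr 4) (t.arr 3) (t.reg 3) ∧
    (spot n r k t = 0 ∨ 2 * spot n r k t + t.reg 3 + j ≤ 2 * (n * n))
  have hiter : ∀ j t, J j t → J (j + 1) (iter.run n t) := by
    rintro j t ⟨h1, h2, h3⟩
    obtain ⟨k1, k2, k3⟩ := iter_spec hsymm hirr hrn h1 h2
    refine ⟨h1.run iter (by decide) (by decide), k1, ?_⟩
    omega
  have hset : ∀ j t x v, x ∉ [0, 1, 2, 3] → J j t → J j (t.setReg x v) := by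
    rintro j t x v hx ⟨h1, h2, h3⟩
    have hr : ∀ y ∈ [0, 1, 2, 3], (t.setReg x v).reg y = t.reg y := fun y hy => by
      rw [State.setReg_reg, if_neg (by rintro rfl; exact hx hy)]
    have e3 := hr 3 (by simp)
    refine ⟨⟨h1.rep, (hr 0 (by simp)).trans h1.reg0, (hr 1 (by simp)).trans h1.reg1,
      (hr 2 (by simp)).trans h1.reg2⟩, ?_, ?_⟩
    · rw [e3]; exact h2
    · rw [spot, e3]; exact h3
  have hJ : J (2 * (n * n)) (recolor.run n s) := by
    refine LProg.loop_inv (fun i t => J (2 * (i * n)) t) ?_ ?_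
    · refine ⟨hs, hI, Or.inr ?_⟩
      have h1 : spot n r k s ≤ r * (r * k) := pot_le
      have h2 : r * (r * k) ≤ n * n := Nat.mul_le_mul hrn hrk
      omega
    · intro i _ t ht
      have := LProg.loop_inv (n := n) (x := 25) (p := .seq iter iter) (s := t.setReg 24 i)
        (fun j t => J (2 * (i * n) + 2 * j) t) (hset _ _ _ _ (by decide) ht)
        (fun j _ t ht => hiter _ _ (hiter _ _ (hset _ _ _ _ (by decide) ht)))
      have he : 2 * ((i + 1) * n) = 2 * (i * n) + 2 * n := by ring
      rw [he]
      exact this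
  refine ⟨hJ.2.1, le_card_of_pot_eq_zero (?_ : spot n r k _ = 0)⟩
  have := hJ.2.2
  omega

/-! ## Coloring the remaining vertices -/

/-- The color in register `6` is less than the number of colors and free for the vertex `20`. -/
def Form.choice : Form := .and (.lt (.reg 6) (.reg 1)) (.free 20 6)

/-- Color the uncolored vertices greedily. -/
def greedy : LProg :=
  .loop 20 (.ite (.lt (.col 20) (.reg 1)) .skip
    (.seq (.find 6 .choice) (.store 1 (.reg 20) (.reg 6))))

/-- A vertex with fewer than `r` neighbors always has a free color below `r`. Only uncolored
vertices are changed, so the classes below `r` can only grow. -/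
theorem greedy_spec {n r k : ℕ} {E : ℕ → ℕ → Prop} {s : State}
    (hsymm : ∀ u < n, ∀ v < n, E u v → E v u) (hirr : ∀ u < n, ¬ E u u) (hrn : r ≤ n)
    (hs : Params n r k E s)
    (hproper : ∀ u < n, ∀ v < n, E u v → s.arr 1 u < r → s.arr 1 u ≠ s.arr 1 v)
    (hdeg : ∀ v < n, ∀ [DecidablePred (E v)], #{u ∈ range n | E v u} < r)
    (hsize : ∀ c < r, k ≤ #(cls n (s.arr 1) c)) :
    (∀ v < n, (greedy.run n s).arr 1 v < r) ∧
    (∀ u < n, ∀ v < n, E u v → (greedy.run n s).arr 1 u ≠ (greedy.run n s).arr 1 v) ∧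
    ∀ c < r, k ≤ #(cls n ((greedy.run n s).arr 1) c) := by
  have key := LProg.loop_inv' (n := n) (x := 20) (p := .ite (.lt (.col 20) (.reg 1)) .skip
    (.seq (.find 6 .choice) (.store 1 (.reg 20) (.reg 6)))) (s := s) (fun i t =>
      (∀ v < i, t.arr 1 v < r) ∧
      (∀ u < n, ∀ v < n, E u v → t.arr 1 u < r → t.arr 1 u ≠ t.arr 1 v) ∧
      ∀ c < r, k ≤ #(cls n (t.arr 1) c)) ⟨by simp, hproper, hsize⟩ ?_
  · exact ⟨key.1, fun u hu v hv hE => key.2.1 u hu v hv hE (key.1 u hu), key.2.2⟩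
  · rintro i hi t hr ha ⟨h1, h2, h3⟩
    have hrep : Represents t E := hs.rep.congr (ha 0 (by decide)) (ha 2 (by decide))
    have hr1 : t.reg 1 = r := (hr 1 (by decide)).trans hs.reg1
    have hF : (Form.lt (.col 20) (.reg 1)).holds n (t.setReg 20 i) ↔ t.arr 1 i < r := by
      rw [Form.holds_lt]; simp [Expr.eval, hr1]
    by_cases hc : t.arr 1 i < r
    · rw [LProg.run_ite_pos (hF.2 hc)]
      refine ⟨fun v hv => ?_, h2, h3⟩
      by_cases hvi : v = i
      · rw [hvi]; exact hc
      · exact h1 v (by omega)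
    · rw [LProg.run_ite_neg (mt hF.1 hc)]
      have hchoice : ∀ c, Form.choice.holds n ((t.setReg 20 i).setReg 6 c) ↔
          c < r ∧ Free n E (t.arr 1) i c := by
        intro c
        have hrep' : Represents ((t.setReg 20 i).setReg 6 c) E := hrep
        rw [Form.choice, Form.holds_and, Form.holds_lt, hrep'.holds_free (by decide) (by decide)]
        simp [Expr.eval, hr1]
      obtain ⟨c₀, hc₀, hfree₀⟩ := exists_free (φ := t.arr 1) (hdeg i hi)
      obtain ⟨c, -, hFc, hrun⟩ := LProg.run_find (x := 6) (F := .choice) (s := t.setReg 20 i)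
        ⟨c₀, hc₀.trans_le hrn, (hchoice c₀).2 ⟨hc₀, hfree₀⟩⟩
      rw [hchoice] at hFc
      rw [LProg.run_seq, hrun]
      have e : ((LProg.store 1 (.reg 20) (.reg 6)).run n ((t.setReg 20 i).setReg 6 c)).arr 1 =
          Function.update (t.arr 1) i c := by
        rw [LProg.run, State.setArr_arr_self]
        simp [Expr.eval]
      rw [e]
      refine ⟨fun v hv => ?_, ?_, fun d hd => (h3 d hd).trans (card_le_card fun v hv => ?_)⟩
      · by_cases hvi : v = i
        · rw [hvi, Function.update_self]; exact hFc.1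
        · rw [Function.update_of_ne hvi]; exact h1 v (by omega)
      · intro u hu w hw hE hur
        by_cases hui : u = i
        · have hwi : w ≠ i := by rintro rfl; exact hirr w hw (hui ▸ hE)
          rw [hui, Function.update_self, Function.update_of_ne hwi]
          exact (hFc.2 w hw (hui ▸ hE)).symm
        · by_cases hwi : w = i
          · rw [hwi, Function.update_self, Function.update_of_ne hui]
            exact hFc.2 u hu (hsymm u hu i hi (hwi ▸ hE))
          · rw [Function.update_of_ne hui] at hur ⊢
            rw [Function.update_of_ne hwi]
            exact h2 u hu w hw hE hur
      · rw [mem_cls] at hv ⊢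
        refine ⟨hv.1, ?_⟩
        rw [Function.update_of_ne]
        · exact hv.2
        · rintro rfl; exact hc (hv.2 ▸ hd)

/-! ## Initialization -/

/-- Put the offsets of the rows of the adjacency matrix into array `2`. -/
def rows : LProg :=
  .seq (.assign 13 (.const 0))
    (.loop 20 (.seq (.store 2 (.reg 20) (.reg 13)) (.assign 13 (.add (.reg 13) (.reg 0)))))

theorem rows_spec {n : ℕ} {s : State} (h0 : s.reg 0 = n) :
    ∀ u < n, (rows.run n s).arr 2 u = u * n := by
  rw [rows, LProg.run_seq]
  refine (LProg.loop_inv' (n := n) (x := 20) (fun i t => t.reg 13 = i * n ∧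
    ∀ u < i, t.arr 2 u = u * n) ⟨by simp [LProg.run, Expr.eval], by simp⟩ ?_).2
  rintro i hi t hr ha ⟨h1, h2⟩
  have hr0 : t.reg 0 = n := (hr 0 (by decide)).trans (by simp [LProg.run, h0])
  refine ⟨by simp [LProg.run, Expr.eval, h1, hr0, Nat.succ_mul], fun u hu => ?_⟩
  simp only [LProg.run, Expr.eval, State.setReg_arr, State.setArr_arr, State.setReg_reg]
  by_cases hui : u = i
  · simp [hui, h1]
  · simpa [hui] using h2 u (by omega)

/-- Put one more than the maximum degree into register `1`. -/
def numColors : LProg :=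
  .seq (.assign 1 (.const 0))
    (.seq (.loop 20 (.seq (.count 13 21 (.adj 20 21))
      (.assign 1 (.add (.reg 1) (.sub (.reg 13) (.reg 1))))))
    (.assign 1 (.add (.reg 1) (.const 1))))

/-- The relation `E` on the numbers below `n` is adjacency in `G`. -/
def Models {n : ℕ} (E : ℕ → ℕ → Prop) (G : SimpleGraph (Fin n)) : Prop :=
  ∀ u v : Fin n, E u v ↔ G.Adj u v

theorem card_filter_fin {n : ℕ} (P : ℕ → Prop) [DecidablePred P] :
    #{u : Fin n | P u} = #{u ∈ range n | P u} := by
  rw [card_filter, card_filter, sum_range]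

theorem Models.card {n : ℕ} {E : ℕ → ℕ → Prop} {G : SimpleGraph (Fin n)} [DecidableRel G.Adj]
    (h : Models E G) (u : Fin n) [DecidablePred (E u)] :
    #{v ∈ range n | E u v} = G.degree u := by
  rw [← G.card_neighborFinset_eq_degree, G.neighborFinset_eq_filter]
  simp_rw [← h u]
  exact (card_filter_fin (E u)).symm

/-- The truncated expression `a + (b - a)` keeps the running maximum of the degrees. -/
theorem numColors_spec {n : ℕ} {E : ℕ → ℕ → Prop} {G : SimpleGraph (Fin n)} [DecidableRel G.Adj]
    (hE : Models E G) {s : State} (hs : Represents s E) :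
    (numColors.run n s).reg 1 = G.maxDegree + 1 := by
  classical
  rw [numColors, LProg.run_seq, LProg.run_seq]
  have key := LProg.loop_inv' (n := n) (x := 20) (p := .seq (.count 13 21 (.adj 20 21))
      (.assign 1 (.add (.reg 1) (.sub (.reg 13) (.reg 1)))))
    (s := (LProg.assign 1 (.const 0)).run n s) (fun i t => t.reg 1 ≤ G.maxDegree ∧
      ∀ u : Fin n, (u : ℕ) < i → G.degree u ≤ t.reg 1) ⟨by simp [LProg.run, Expr.eval], by simp⟩ ?_
  · have : G.maxDegree ≤ _ := G.maxDegree_le_of_forall_degree_le _ fun u => key.2 u u.2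
    have := le_antisymm key.1 this
    simp only [LProg.run, Expr.eval, State.setReg_reg, if_pos] at this ⊢
    rw [this]
  · rintro i hi t hr ha ⟨h1, h2⟩
    have hrep : Represents t E := hs.congr (ha 0 (by decide)) (ha 2 (by decide))
    have hcount : Nat.count (fun v => (Form.adj 20 21).holds n
        ((t.setReg 20 i).setReg 21 v)) n = G.degree ⟨i, hi⟩ := by
      rw [Nat.count_eq_card_filter_range, ← hE.card]
      congr 1
      refine filter_congr fun v _ => ?_
      have hrep' : Represents ((t.setReg 20 i).setReg 21 v) E := hrep
      rw [hrep'.holds_adj]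
      simp
    have hrun : ((LProg.seq (.count 13 21 (.adj 20 21))
        (.assign 1 (.add (.reg 1) (.sub (.reg 13) (.reg 1))))).run n (t.setReg 20 i)).reg 1 =
        t.reg 1 + (G.degree ⟨i, hi⟩ - t.reg 1) := by
      rw [← hcount]
      simp [LProg.run, Expr.eval]
    rw [hrun]
    have hmax := G.degree_le_maxDegree ⟨i, hi⟩
    refine ⟨by omega, fun u hu => ?_⟩
    by_cases hui : (u : ℕ) = i
    · obtain rfl : u = ⟨i, hi⟩ := Fin.ext hui
      omega
    · have := h2 u (by omega)
      omega

/-- Put one less than the quotient of the number of vertices by register `1` into register `2`. -/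
def classSize : LProg :=
  .seq (.assign 14 (.reg 0))
    (.seq (.loop 20 (.ite (.lt (.reg 14) (.reg 1)) .skip
      (.seq (.assign 14 (.sub (.reg 14) (.reg 1))) (.assign 2 (.add (.reg 2) (.const 1))))))
    (.assign 2 (.sub (.reg 2) (.const 1))))

/-- Division by repeated subtraction. The quotient is positive because `r ≤ n`, and lowering it by
one leaves the slack `k + 1` that the invariant demands at level `0`. -/
theorem classSize_spec {n r : ℕ} {s : State} (h0 : s.reg 0 = n) (h1 : s.reg 1 = r)
    (h2 : s.reg 2 = 0) (hr : 0 < r) (hrn : r ≤ n) :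
    r * ((classSize.run n s).reg 2 + 1) ≤ n ∧ n < r * ((classSize.run n s).reg 2 + 2) := by
  rw [classSize, LProg.run_seq, LProg.run_seq]
  have key := LProg.loop_inv' (n := n) (x := 20) (p := .ite (.lt (.reg 14) (.reg 1)) .skip
      (.seq (.assign 14 (.sub (.reg 14) (.reg 1))) (.assign 2 (.add (.reg 2) (.const 1)))))
    (s := (LProg.assign 14 (.reg 0)).run n s) (fun i t => r * t.reg 2 + t.reg 14 = n ∧
      (t.reg 14 < r ∨ i ≤ t.reg 2)) ⟨by simp [LProg.run, Expr.eval, h0, h2], by simp⟩ ?_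
  · set t := (LProg.loop 20 (.ite (.lt (.reg 14) (.reg 1)) .skip
      (.seq (.assign 14 (.sub (.reg 14) (.reg 1))) (.assign 2 (.add (.reg 2) (.const 1)))))).run n
      ((LProg.assign 14 (.reg 0)).run n s)
    obtain ⟨k1, k2⟩ := key
    have hlt : t.reg 14 < r := by
      rcases k2 with h | h
      · exact h
      · have := Nat.mul_le_mul hr h
        omega
    have hpos : 0 < t.reg 2 := by
      by_contra! h
      obtain h : t.reg 2 = 0 := by omega
      rw [h, mul_zero] at k1
      omega
    obtain ⟨q, hq⟩ : ∃ q, t.reg 2 = q + 1 := ⟨t.reg 2 - 1, by omega⟩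
    have hrun : ((LProg.assign 2 (.sub (.reg 2) (.const 1))).run n t).reg 2 = q := by
      simp [LProg.run, Expr.eval, hq]
    rw [hrun]
    rw [hq] at k1
    rw [show r * (q + 2) = r * (q + 1) + r by ring]
    omega
  · rintro i hi t hr' ha ⟨k1, k2⟩
    have hr1 : t.reg 1 = r := (hr' 1 (by decide)).trans (by simp [LProg.run, h1])
    have hF : (Form.lt (.reg 14) (.reg 1)).holds n (t.setReg 20 i) ↔ t.reg 14 < r := by
      rw [Form.holds_lt]; simp [Expr.eval, hr1]
    by_cases hlt : t.reg 14 < r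
    · rw [LProg.run_ite_pos (hF.2 hlt)]
      simp [LProg.run, k1, hlt]
    · rw [LProg.run_ite_neg (mt hF.1 hlt)]
      simp [LProg.run, Expr.eval, hr1]
      rw [mul_add]
      omega

/-- Give every vertex the color `n`. -/
def clear : LProg := .loop 20 (.store 1 (.reg 20) (.reg 0))

theorem clear_spec {n : ℕ} {s : State} (h0 : s.reg 0 = n) : ∀ v < n, (clear.run n s).arr 1 v = n := by
  refine LProg.loop_inv' (n := n) (x := 20) (fun i t => ∀ v < i, t.arr 1 v = n) (by simp) ?_
  intro i hi t hr _ h v hv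
  have hr0 : t.reg 0 = n := (hr 0 (by decide)).trans h0
  simp only [LProg.run, Expr.eval, State.setReg_arr, State.setArr_arr, State.setReg_reg]
  by_cases hvi : v = i
  · simp [hvi, hr0]
  · simpa [hvi] using h v (by omega)

/-- The coloring algorithm. -/
def algorithm : LProg :=
  .seq rows (.seq numColors (.seq classSize (.seq clear (.seq recolor greedy))))

theorem algorithm_spec {n : ℕ} (hn : 0 < n) (G : SimpleGraph (Fin n)) [DecidableRel G.Adj] :
    ∃ k, n < (G.maxDegree + 1) * (k + 2) ∧
      (∀ v < n, (algorithm.run n (inputGraph G)).arr 1 v < G.maxDegree + 1) ∧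
      (∀ u v, G.Adj u v → (algorithm.run n (inputGraph G)).arr 1 u ≠
        (algorithm.run n (inputGraph G)).arr 1 v) ∧
      ∀ c < G.maxDegree + 1, k ≤ #(cls n ((algorithm.run n (inputGraph G)).arr 1) c) := by
  simp only [algorithm, LProg.run_seq]
  set s₀ := inputGraph G
  set s₁ := rows.run n s₀
  set s₂ := numColors.run n s₁
  set s₃ := classSize.run n s₂
  set s₄ := clear.run n s₃
  set s₅ := recolor.run n s₄
  have z : ∀ x, x ≠ 0 → s₀.reg x = 0 := fun x hx => by simp [s₀, inputGraph, hx]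
  have z0 : s₀.reg 0 = n := by simp [s₀, inputGraph]
  have h2 : ∀ u < n, s₁.arr 2 u = u * n := rows_spec z0
  have ha0 : s₁.arr 0 = s₀.arr 0 := rows.run_arr n s₀ (by decide)
  -- The relation is read off from the memory for all pairs of numbers; it agrees with adjacency
  -- only below `n`, which is all that is used.
  obtain ⟨E, hrep⟩ : ∃ E, Represents s₁ E := ⟨fun u v => s₁.arr 0 (s₁.arr 2 u + v) ≠ 0,
    fun _ _ => Iff.rfl⟩
  have hE : Models E G := by
    intro u v
    rw [← hrep u v, h2 u u.2, ha0]
    have : s₀.arr 0 (u * n + v) ≠ 0 ↔ ∃ u' v' : Fin n, (u : ℕ) * n + v = u' * n + v' ∧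
        G.Adj u' v' := by
      simp [s₀, inputGraph]
    rw [this]
    constructor
    · rintro ⟨u', v', he, hadj⟩
      have e1 : (u : ℕ) = u' := by
        have := congrArg (· / n) he
        simpa [Nat.add_comm, Nat.add_mul_div_right _ _ hn, Nat.div_eq_of_lt] using this
      have e2 : (v : ℕ) = v' := by rw [e1] at he; omega
      rwa [Fin.ext e1, Fin.ext e2]
    · exact fun h => ⟨u, v, rfl, h⟩
  have hsymm : ∀ u < n, ∀ v < n, E u v → E v u := fun u hu v hv h =>
    (hE ⟨v, hv⟩ ⟨u, hu⟩).2 ((hE ⟨u, hu⟩ ⟨v, hv⟩).1 h).symm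
  have hirr : ∀ u < n, ¬ E u u := fun u hu h => G.loopless.irrefl _ ((hE ⟨u, hu⟩ ⟨u, hu⟩).1 h)
  have hdeg : ∀ v < n, ∀ [DecidablePred (E v)], #{u ∈ range n | E v u} < G.maxDegree + 1 := by
    intro v hv _
    rw [hE.card ⟨v, hv⟩]
    exact Nat.lt_succ_of_le (G.degree_le_maxDegree _)
  have hrn : G.maxDegree + 1 ≤ n := by
    have : Nonempty (Fin n) := ⟨⟨0, hn⟩⟩
    simpa using G.maxDegree_lt_card_verts
  have hr : s₂.reg 1 = G.maxDegree + 1 := numColors_spec hE hrep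
  have hr0 : s₂.reg 0 = n := (numColors.run_reg n s₁ (by decide)).trans
    ((rows.run_reg n s₀ (by decide)).trans z0)
  have hr2 : s₂.reg 2 = 0 := (numColors.run_reg n s₁ (by decide)).trans
    ((rows.run_reg n s₀ (by decide)).trans (z 2 (by decide)))
  have hr3 : s₄.reg 3 = 0 := (clear.run_reg n s₃ (by decide)).trans
    ((classSize.run_reg n s₂ (by decide)).trans ((numColors.run_reg n s₁ (by decide)).trans
      ((rows.run_reg n s₀ (by decide)).trans (z 3 (by decide)))))
  have hpos : 0 < G.maxDegree + 1 := Nat.succ_pos _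
  generalize G.maxDegree + 1 = r at *
  obtain ⟨hk, hk'⟩ := classSize_spec hr0 hr hr2 hpos hrn
  have hp₄ : Params n r (s₃.reg 2) E s₄ := by
    refine ⟨hrep.congr ?_ ?_, ?_, ?_, clear.run_reg n s₃ (by decide)⟩
    · exact (clear.run_arr n s₃ (by decide)).trans ((classSize.run_arr n s₂ (by decide)).trans
        (numColors.run_arr n s₁ (by decide)))
    · exact (clear.run_arr n s₃ (by decide)).trans ((classSize.run_arr n s₂ (by decide)).trans
        (numColors.run_arr n s₁ (by decide)))
    · exact (clear.run_reg n s₃ (by decide)).trans ((classSize.run_reg n s₂ (by decide)).trans hr0)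
    · exact (clear.run_reg n s₃ (by decide)).trans ((classSize.run_reg n s₂ (by decide)).trans hr)
  have hclear : ∀ v < n, s₄.arr 1 v = n :=
    clear_spec ((classSize.run_reg n s₂ (by decide)).trans hr0)
  obtain ⟨hI, hsize⟩ := recolor_spec hsymm hirr hrn
    ((Nat.mul_le_mul_left _ (Nat.le_succ _)).trans hk) hp₄ hr3
    (by rw [hr3]; exact Inv.init hrn hclear hdeg hk)
  obtain ⟨g1, g2, g3⟩ := greedy_spec hsymm hirr hrn (hp₄.run recolor (by decide) (by decide))
    hI.proper hdeg hsize
  exact ⟨s₃.reg 2, hk', g1, fun u v h => g2 u u.2 v v.2 ((hE u v).2 h), g3⟩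

end RAM

/-! ## The approximation ratio -/

open Finset

theorem minColorClass_le {V : Type*} [Fintype V] (φ : V → ℕ) (v : V) :
    minColorClass φ ≤ colorClassSize φ v :=
  ciInf_le (OrderBot.bddBelow _) v

/-- At least χ colors occur, and each of their disjoint classes has at least the minimal size. -/
theorem minColorClass_mul_chromaticNumber_le {V : Type*} [Fintype V] (G : SimpleGraph V)
    (φ : G.Coloring ℕ) : minColorClass φ * G.chromaticNumber.toNat ≤ Fintype.card V := by
  classical
  have h1 : G.chromaticNumber.toNat ≤ #(univ.image φ) := by
    have hcol : G.Colorable #(univ.image φ) := by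
      let ψ : G.Coloring (univ.image φ) := SimpleGraph.Coloring.mk
        (fun v => ⟨φ v, mem_image_of_mem _ (mem_univ v)⟩)
        (fun {v w} h he => φ.valid h (congrArg Subtype.val he))
      simpa using ψ.colorable
    exact ENat.toNat_le_of_le_natCast hcol.chromaticNumber_le
  calc minColorClass φ * G.chromaticNumber.toNat ≤ minColorClass φ * #(univ.image φ) :=
        Nat.mul_le_mul_left _ h1
    _ = ∑ _c ∈ univ.image φ, minColorClass φ := by simp [mul_comm]
    _ ≤ ∑ c ∈ univ.image φ, #{v | φ v = c} := by
        refine sum_le_sum fun c hc => ?_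
        obtain ⟨v, -, rfl⟩ := mem_image.1 hc
        exact minColorClass_le φ v
    _ = Fintype.card V := (card_eq_sum_card_image φ univ).symm

theorem maxMinColoring_mul_chromaticNumber_le {V : Type*} [Fintype V] (G : SimpleGraph V) :
    maxMinColoring G * G.chromaticNumber.toNat ≤ Fintype.card V := by
  rcases Nat.eq_zero_or_pos G.chromaticNumber.toNat with h | h
  · simp [h]
  · rw [← Nat.le_div_iff_mul_le h]
    refine ciSup_le' fun φ => ?_
    rw [Nat.le_div_iff_mul_le h]
    exact minColorClass_mul_chromaticNumber_le G φ

theorem le_minColorClass {n : ℕ} (hn : 0 < n) {f : ℕ → ℕ} {k : ℕ}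
    (h : ∀ v < n, k ≤ #(MaxMin.cls n f (f v))) : k ≤ minColorClass fun v : Fin n => f v := by
  have : Nonempty (Fin n) := ⟨⟨0, hn⟩⟩
  refine le_ciInf fun v => ?_
  rw [colorClassSize, RAM.card_filter_fin fun u => f u = f v]
  exact h v v.2

/-- For `5 * D ≤ n` one has `(D + 1) * K ≥ n - 4 * D`, and `(n + 36 * D) * (n - 4 * D) ≥ n * n`
because `32 * n ≥ 144 * D`. For `n ≤ 5 * D` the bound `(D + 1) * K ≥ D` suffices, since `36 * D * D
≥ n * n`. For `D = 0` there is no error term, so exactness has to be assumed. -/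
theorem approximation_bound {n D k K : ℕ} (hn : 0 < n) (hk : n < (D + 1) * (k + 2)) (hK : k ≤ K)
    (hpos : 1 ≤ K) (h0 : D = 0 → n ≤ K) :
    (n : ℝ) ≤ (1 + 36 * (D / n)) * (D + 1) * K := by
  have hn' : (0 : ℝ) < n := by exact_mod_cast hn
  have hpos' : (1 : ℝ) ≤ K := by exact_mod_cast hpos
  rcases Nat.eq_zero_or_pos D with rfl | hD
  · simpa using h0 rfl
  have hD' : (1 : ℝ) ≤ D := by exact_mod_cast hD
  have hk' : (n : ℝ) < (D + 1) * (K + 2) := by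
    have : n < (D + 1) * (K + 2) := hk.trans_le (Nat.mul_le_mul_left _ (by omega))
    exact_mod_cast this
  have key : (n : ℝ) * n ≤ (n + 36 * D) * ((D + 1) * K) := by
    rcases le_total (5 * (D : ℝ)) n with h | h
    · have h1 : (n : ℝ) - 4 * D ≤ (D + 1) * K := by nlinarith
      nlinarith [mul_le_mul_of_nonneg_left h1 (by positivity : (0 : ℝ) ≤ n + 36 * D)]
    · have h1 : (D : ℝ) ≤ (D + 1) * K := by nlinarith
      nlinarith [mul_le_mul_of_nonneg_left h1 (by positivity : (0 : ℝ) ≤ n + 36 * D)]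
  have : (1 + 36 * ((D : ℝ) / n)) * (D + 1) * K = (n + 36 * D) * ((D + 1) * K) / n := by
    field_simp
  rw [this, le_div_iff₀ hn']
  exact key

theorem mainTheorem12 :
    ∃ (C : ℝ) (p : RAM.Prog),
      IsMaxMinColoringApprox p fun {n} G _ =>
        (1 + C * (G.maxDegree / n)) *
          ((G.maxDegree + 1) / (G.chromaticNumber.toNat : ℝ)) := by
  -- The input lies in register `0`, which is even and simulates itself. The first instruction
  -- copies `n` to register `1` as the loop bound, at a cost of `2` steps.
  refine ⟨36, .seq (.assign 1 (.reg 0)) (RAM.algorithm.compile 1), RAM.algorithm.cost + 2, ?_⟩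
  intro n G _
  have hrel : RAM.Rel n ((RAM.inputGraph G).setReg 1 n) (RAM.inputGraph G) :=
    ⟨rfl, fun x => by rw [RAM.State.setReg_reg, if_neg (by omega)]; simp [RAM.inputGraph],
      by simp⟩
  obtain ⟨σ, t, hex, ht, hR, -⟩ := RAM.LProg.exec_compile n RAM.algorithm 1 le_rfl hrel
  have hout : ∀ v, RAM.outputColors n σ v = (RAM.algorithm.run n (RAM.inputGraph G)).arr 1 v :=
    fun v => by rw [RAM.outputColors, hR.arr]
  refine ⟨σ, 2 + t, RAM.Exec.seq (s' := (RAM.inputGraph G).setReg 1 n) ?_ hex, ?_, ?_, ?_⟩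
  · exact RAM.Exec.assign (RAM.inputGraph G) 1 (.reg 0)
  · simp; omega
  · intro u v h
    obtain ⟨k, -, -, hproper, -⟩ := RAM.algorithm_spec (n := n) (Nat.zero_lt_of_lt u.2) G
    rw [hout, hout]
    exact hproper u v h
  · intro hn
    obtain ⟨k, hk, hlt, -, hsize⟩ := RAM.algorithm_spec hn G
    have hfun : RAM.outputColors n σ = fun v : Fin n =>
      (RAM.algorithm.run n (RAM.inputGraph G)).arr 1 v := funext hout
    rw [hfun]
    generalize (RAM.algorithm.run n (RAM.inputGraph G)).arr 1 = f at *
    set K := minColorClass fun v : Fin n => f v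
    have hK : (n : ℝ) ≤ (1 + 36 * (G.maxDegree / n)) * (G.maxDegree + 1) * K := by
      refine approximation_bound hn hk ?_ ?_ ?_
      · exact le_minColorClass hn fun v hv => hsize _ (hlt v hv)
      · exact le_minColorClass hn fun v hv => card_pos.2 ⟨v, MaxMin.mem_cls.2 ⟨hv, rfl⟩⟩
      · intro h0
        refine le_minColorClass hn fun v hv => ?_
        have : MaxMin.cls n f (f v) = range n := filter_true_of_mem fun u hu => by
          have := hlt v hv
          have := hlt u (mem_range.1 hu)
          omega
        rw [this, card_range]
    have hχ : 0 < G.chromaticNumber.toNat := by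
      have : Nonempty (Fin n) := ⟨⟨0, hn⟩⟩
      have hc := G.colorable_of_fintype
      rw [Nat.pos_iff_ne_zero, Ne, ENat.toNat_eq_zero, not_or]
      exact ⟨hc.chromaticNumber_pos.ne',
        SimpleGraph.chromaticNumber_ne_top_iff_exists.2 ⟨_, hc⟩⟩
    have hχ' : (0 : ℝ) < G.chromaticNumber.toNat := by exact_mod_cast hχ
    have hopt : (maxMinColoring G : ℝ) * G.chromaticNumber.toNat ≤ n := by
      have := maxMinColoring_mul_chromaticNumber_le G
      rw [Fintype.card_fin] at this
      exact_mod_cast this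
    beta_reduce
    rw [← mul_div_assoc, div_mul_eq_mul_div, le_div_iff₀ hχ']
    exact hopt.trans hK
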